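/- For $n\ge 4$ let $\beta_1,\dots,\beta_{n-1}$ be the elementary braids on $n$ strands ($\beta_j$ crosses strand $j$ over strand $j+1$), and write $j$ for $\beta_j$ and $\bar j$ for $\beta_j^{-1}$. Put $\Gamma_r=r.(r-1).\cdots.2.1.1.2.\cdots.(r-1).r$, $\Phi_4=\bar2.\bar2.1.\bar2$, $\Psi_4=2.2.2.\bar1.2$ and, for $n\ge4$, $\Phi_{n+1}=(n-2).(n-1).\Phi_n.(\overline{n-1})$ and $\Psi_{n+1}=(\overline{n-1}).\Psi_n.(n-1)$. For $k\ge 0$ let $B_{n,k}$ be the $n$-strand braid $$B_{n,k}=\Gamma_{n-2}^{-k}.\Phi_n.\Gamma_{n-2}^{k}.(n-1).\Psi_n.(\overline{n-1}).$$ The closed braids $B_{n,k}$ are unknots in $S^3$. For $m\ge2$ let $L_{2m,k}$ be the 2-component link in $S^3$ that is the preimage of the axis $A$ of the closed braid $B_{2m,k}$ in the double cover of $S^3$ branched over $B_{2m,k}$, both components being oriented as lifts of $A$. Let $\Delta_{L_{2m,k}}(t_1,t_2)\in\mathbb Z[t_1^{\pm1},t_2^{\pm1}]$ be its Alexander polynomial,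 i.e. a greatest common divisor of the first elementary ideal of the Alexander module of the link group (well defined up to units), and let $\bar\Delta_{L_{2m,k}}(t)=\Delta_{L_{2m,k}}(t,t)$ be its reduced Alexander polynomial. Let $D_{2m,j}$ ($1\le j\le 2m-1$) be the $(2m-1)\times(2m-1)$ integer matrix $I+J_{2m-1,j}$, where the only nonzero entries of $J_{2m-1,j}$ are $1$ in position $(j,j-1)$ and $-1$ in position $(j,j+1)$ (whenever these positions exist); it is the matrix, on the first homology of the fiber of $L_{2m,k}$, of the Dehn twist that corresponds to $\beta_j$. Let $\Omega_{2m,k}$, the homology monodromy of the fibered link $L_{2m,k}$, be the product of the matrices $D_{2m,j}^{\pm1}$ obtained by replacing each letter $\beta_j^{\pm1}$ of $B_{2m,k}$ by $D_{2m,j}^{\pm1}$. **Theorem.** For every integer $k\ge 0$, up to multiplication by units $\pm t^{i}$ of $\mathbb Z[t,t^{-1}]$: (a) for $m=2$, $\ \bar\Delta_{L_{4,k}}(t)=t^2-(140k^2-174k+56)\,t+1$; (b) for $m\ge3$, $$\bar\Delta_{L_{2m,k}}(t)=(t^{2m-2}+1)-(140k^2-222k+92)(t^{2m-3}+t)+(136k^2-258k+119)\sum_{j=1}^{m-2}t^{2j}-(140k^2-270k+128)\sum_{j=1}^{m-3}t^{2j+1}.$$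 Moreover, if $P_{m,k}(t)$ denotes the right-hand side in (a) or (b), then $\det(tI-\Omega_{2m,k})=(t-1)\,P_{m,k}(t)$ for all $m\ge 2$ and $k\ge0$. -/

import Mathlib

open Polynomial
open scoped LaurentPolynomial

/-! ### Braid words

The letter `j ≥ 1` of a braid word stands for the elementary braid `β_j`, in which strand `j`
crosses strand `j + 1`; its inverse is the opposite crossing. A word whose letters are all `< n`
is a braid on `n` strands. -/

/-- Braid words: the letter `j` stands for `β_j`. -/
abbrev BraidWord : Type := FreeGroup ℕ

/-- The elementary braid `β_j`. -/
def braidGen (j : ℕ) : BraidWord := FreeGroup.of j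

/-- `Γ_r = r.(r-1).⋯.2.1.1.2.⋯.(r-1).r`. -/
def gammaWord : ℕ → BraidWord
  | 0 => 1
  | r + 1 => braidGen (r + 1) * gammaWord r * braidGen (r + 1)

/-- `Φ_4 = 2⁻¹.2⁻¹.1.2⁻¹` and `Φ_{n+1} = (n-2).(n-1).Φ_n.(n-1)⁻¹` for `n ≥ 4`
(the values at `n < 4` are not used). -/
def phiWord : ℕ → BraidWord
  | 0 | 1 | 2 | 3 => 1
  | 4 => (braidGen 2)⁻¹ * (braidGen 2)⁻¹ * braidGen 1 * (braidGen 2)⁻¹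
  | n + 5 => braidGen (n + 2) * braidGen (n + 3) * phiWord (n + 4) * (braidGen (n + 3))⁻¹

/-- `Ψ_4 = 2.2.2.1⁻¹.2` and `Ψ_{n+1} = (n-1)⁻¹.Ψ_n.(n-1)` for `n ≥ 4`
(the values at `n < 4` are not used). -/
def psiWord : ℕ → BraidWord
  | 0 | 1 | 2 | 3 => 1
  | 4 => braidGen 2 * braidGen 2 * braidGen 2 * (braidGen 1)⁻¹ * braidGen 2
  | n + 5 => (braidGen (n + 3))⁻¹ * psiWord (n + 4) * braidGen (n + 3)

/-- The `n`-strand braid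
`B_{n,k} = Γ_{n-2}^{-k}.Φ_n.Γ_{n-2}^k.(n-1).Ψ_n.(n-1)⁻¹`, for `n ≥ 4` and `k ≥ 0`. -/
def braidB (n k : ℕ) : BraidWord :=
  (gammaWord (n - 2) ^ k)⁻¹ * phiWord n * gammaWord (n - 2) ^ k *
    braidGen (n - 1) * psiWord n * (braidGen (n - 1))⁻¹

/-! ### The exterior of a closed braid together with its axis

The complement of `n` points in a disk has free fundamental group on the loops `x_0, …, x_{n-1}`
around the points, and a braid acts on it by Artin's representation. The complement in `S³` of the
closed braid and its axis is the mapping torus of the braid. -/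

/-- Artin's automorphism for adjacent punctures `a`, `b`:
`x_a ↦ x_a x_b x_a⁻¹`, `x_b ↦ x_a`, and the other generators are fixed. -/
def artinHalfTwist {n : ℕ} (a b : Fin n) (hab : a ≠ b) : MulAut (FreeGroup (Fin n)) :=
  MonoidHom.toMulEquiv
    (FreeGroup.lift fun i =>
      if i = a then FreeGroup.of a * FreeGroup.of b * (FreeGroup.of a)⁻¹
      else if i = b then FreeGroup.of a else FreeGroup.of i)
    (FreeGroup.lift fun i =>
      if i = a then FreeGroup.of b
      else if i = b then (FreeGroup.of b)⁻¹ * FreeGroup.of a * FreeGroup.of b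
      else FreeGroup.of i)
    (by
      ext i
      by_cases h1 : i = a
      · subst h1; simp [hab.symm, mul_assoc]
      · by_cases h2 : i = b
        · subst h2; simp [h1]
        · simp [h1, h2])
    (by
      ext i
      by_cases h1 : i = a
      · subst h1; simp [hab.symm]
      · by_cases h2 : i = b
        · subst h2; simp [h1, mul_assoc]
        · simp [h1, h2])

/-- The action of `β_j` (`1 ≤ j ≤ n - 1`), which exchanges the `j`-th and the `(j+1)`-st of the
`n` punctures; letters outside this range do not occur in braids on `n` strands. -/
def artinLetter (n j : ℕ) : MulAut (FreeGroup (Fin n)) :=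
  if h : 1 ≤ j ∧ j < n then
    artinHalfTwist ⟨j - 1, by omega⟩ ⟨j, h.2⟩ (by simp only [ne_eq, Fin.mk.injEq]; omega)
  else 1

/-- Artin's representation of braids on `n` strands. -/
def artinAction (n : ℕ) : BraidWord →* MulAut (FreeGroup (Fin n)) :=
  FreeGroup.lift (artinLetter n)

/-- The fundamental group of the complement in `S³` of the closed `n`-braid `w` and its axis `A`:
the semidirect product of the free group on `x_0, …, x_{n-1}` (meridians of the closed braid)
with the infinite cyclic group generated by a meridian `t` of `A`, where
`t x_i t⁻¹` is the image of `x_i` under the braid. -/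
abbrev ClosedBraidAxisGroup (n : ℕ) (w : BraidWord) : Type :=
  SemidirectProduct (FreeGroup (Fin n)) (Multiplicative ℤ)
    (zpowersHom (MulAut (FreeGroup (Fin n))) (artinAction n w))

/-- The meridian `x_i` of the closed braid. -/
def braidMeridian (n : ℕ) (w : BraidWord) (i : Fin n) : ClosedBraidAxisGroup n w :=
  SemidirectProduct.inl (FreeGroup.of i)

/-- The meridian `t` of the axis. -/
def axisMeridian (n : ℕ) (w : BraidWord) : ClosedBraidAxisGroup n w :=
  SemidirectProduct.inr (Multiplicative.ofAdd 1)

/-! ### The double cover branched over the closed braid -/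

/-- The parity of the word length on the free group. -/
def freeParity (n : ℕ) : FreeGroup (Fin n) →* Multiplicative (ZMod 2) :=
  FreeGroup.lift fun _ => Multiplicative.ofAdd 1

theorem freeParity_artinHalfTwist {n : ℕ} (a b : Fin n) (hab : a ≠ b) :
    (freeParity n).comp (artinHalfTwist a b hab).toMonoidHom = freeParity n := by
  ext i
  by_cases h1 : i = a
  · subst h1; simp [freeParity, artinHalfTwist]
  · by_cases h2 : i = b
    · subst h2; simp [freeParity, artinHalfTwist, h1]
    · simp [freeParity, artinHalfTwist, h1, h2]

/-- The automorphisms of the free group that preserve parity. -/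
def parityPreserving (n : ℕ) : Subgroup (MulAut (FreeGroup (Fin n))) where
  carrier := {f | ∀ x, freeParity n (f x) = freeParity n x}
  one_mem' := fun _ => rfl
  mul_mem' := fun {f g} hf hg x => by
    change freeParity n (f (g x)) = _
    rw [hf, hg]
  inv_mem' := fun {f} hf x => by
    rw [← hf (f⁻¹ x)]
    change freeParity n (f (f.symm x)) = _
    rw [MulEquiv.apply_symm_apply]

theorem artinAction_mem_parityPreserving (n : ℕ) (w : BraidWord) :
    artinAction n w ∈ parityPreserving n := by
  induction w using FreeGroup.induction_on with
  | C1 => rw [map_one]; exact one_mem _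
  | of j =>
    rw [artinAction, FreeGroup.lift_apply_of, artinLetter]
    split_ifs with h
    · exact fun x => DFunLike.congr_fun (freeParity_artinHalfTwist _ _ _) x
    · exact one_mem _
  | inv_of j hj => rw [map_inv]; exact inv_mem hj
  | mul x y hx hy => rw [map_mul]; exact mul_mem hx hy

/-- The linking number modulo 2 with the closed braid: `x_i ↦ 1` and `t ↦ 0`. -/
def linkingParity (n : ℕ) (w : BraidWord) :
    ClosedBraidAxisGroup n w →* Multiplicative (ZMod 2) :=
  SemidirectProduct.lift (freeParity n) 1 (by
    intro g
    ext i
    have h : zpowersHom (MulAut (FreeGroup (Fin n))) (artinAction n w) g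
        ∈ parityPreserving n := by
      rw [zpowersHom_apply]
      exact zpow_mem (artinAction_mem_parityPreserving n w) _
    simpa using congrArg Multiplicative.toAdd (h (FreeGroup.of i)))

/-- The fundamental group of the unbranched double cover of the complement of the closed braid and
its axis in which the meridians of the closed braid do not lift to loops. -/
abbrev DoubleCoverGroup (n : ℕ) (w : BraidWord) : Type := (linkingParity n w).ker

theorem braidMeridian_sq_mem (n : ℕ) (w : BraidWord) (i : Fin n) :
    braidMeridian n w i ^ 2 ∈ (linkingParity n w).ker := by
  simp only [MonoidHom.mem_ker, map_pow, braidMeridian, linkingParity, SemidirectProduct.lift_inl,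
    freeParity, FreeGroup.lift_apply_of]
  decide

theorem axisMeridian_mem (n : ℕ) (w : BraidWord) :
    axisMeridian n w ∈ (linkingParity n w).ker := by
  simp [MonoidHom.mem_ker, axisMeridian, linkingParity]

/-- The group of the link `L_w`, the preimage of the axis `A` of the closed `n`-braid `w` (`n` even)
in the double cover of `S³` branched over the closed braid. The complement of `L_w` is obtained
from the unbranched double cover by filling in the branch curve, so that its fundamental group is
the quotient of `DoubleCoverGroup n w` in which the meridians `x_i²` of the branch curve are
killed. -/
abbrev CoverLinkGroup (n : ℕ) (w : BraidWord) : Type :=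
  DoubleCoverGroup n w ⧸ Subgroup.normalClosure
    (Set.range fun i : Fin n =>
      (⟨braidMeridian n w i ^ 2, braidMeridian_sq_mem n w i⟩ : DoubleCoverGroup n w))

/-- The meridian `t` of the first component of `L_w`. -/
def coverMeridianFst (n : ℕ) (w : BraidWord) : CoverLinkGroup n w :=
  QuotientGroup.mk ⟨axisMeridian n w, axisMeridian_mem n w⟩

/-- The meridian `x_i t x_i⁻¹` of the second component of `L_w`, the image of the first one under
the covering transformation. Its conjugacy class does not depend on `i`. -/
def coverMeridianSnd (n : ℕ) (w : BraidWord) (i : Fin n) : CoverLinkGroup n w :=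
  QuotientGroup.mk ⟨braidMeridian n w i * axisMeridian n w * (braidMeridian n w i)⁻¹,
    (linkingParity n w).normal_ker.conj_mem _ (axisMeridian_mem n w) _⟩

/-! ### Alexander polynomials -/

/-- The `d`-th elementary (Fitting) ideal of a finitely generated module: it is generated by the
minors of order `n` of the matrices whose rows are relations between `n + d` generators. -/
def elementaryIdeal (R M : Type*) [CommRing R] [AddCommGroup M] [Module R M] (d : ℕ) : Ideal R :=
  Ideal.span {r : R | ∃ (n : ℕ) (x : Fin (n + d) → M) (ρ : Matrix (Fin n) (Fin (n + d)) R)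
    (c : Fin n → Fin (n + d)),
    Submodule.span R (Set.range x) = ⊤ ∧ (∀ i, ∑ j, ρ i j • x j = 0) ∧
      r = (ρ.submatrix id c).det}

/-- The defining relations `d(gh) = dg + ψ(g) dh` of the Alexander module. -/
noncomputable def alexanderRelations {G A : Type} [Group G] [AddCommGroup A] (ψ : G →* Multiplicative A) :
    Submodule (AddMonoidAlgebra ℤ A) (G →₀ AddMonoidAlgebra ℤ A) :=
  Submodule.span _ (Set.range fun p : G × G =>
    Finsupp.single (p.1 * p.2) 1 - Finsupp.single p.1 1 -
      Finsupp.single p.2 (AddMonoidAlgebra.single (ψ p.1).toAdd 1))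

/-- The Alexander module of a homomorphism `ψ : G → A` to an abelian group: the module over the
group ring `ℤ[A]` with generators `dg` for `g ∈ G` and relations `d(gh) = dg + ψ(g) dh`
(for a presentation of `G` it is presented by the Fox Jacobian matrix). -/
abbrev AlexanderModule {G A : Type} [Group G] [AddCommGroup A] (ψ : G →* Multiplicative A) : Type :=
  (G →₀ AddMonoidAlgebra ℤ A) ⧸ alexanderRelations ψ

/-- `ψ` is the abelianization of the group of `L_w`, identified with `ℤ²` (written additively) by
means of the meridians of the two components. -/
def IsMeridianAbelianization (n : ℕ) (w : BraidWord)
    (ψ : CoverLinkGroup n w →* Multiplicative (ℤ × ℤ)) : Prop :=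
  ψ.ker = commutator (CoverLinkGroup n w) ∧
    ψ (coverMeridianFst n w) = Multiplicative.ofAdd (1, 0) ∧
    ∀ i, ψ (coverMeridianSnd n w i) = Multiplicative.ofAdd (0, 1)

/-- `Δ ∈ ℤ[t₁^{±1}, t₂^{±1}]`, the group ring of `ℤ²`, is an Alexander polynomial of the
2-component link `L_w`: a greatest common divisor of the first elementary ideal of its Alexander
module. It is determined up to units. -/
def IsAlexanderPolynomial (n : ℕ) (w : BraidWord) (Δ : AddMonoidAlgebra ℤ (ℤ × ℤ)) : Prop :=
  ∃ ψ : CoverLinkGroup n w →* Multiplicative (ℤ × ℤ), IsMeridianAbelianization n w ψ ∧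
    ∀ d : AddMonoidAlgebra ℤ (ℤ × ℤ),
      d ∣ Δ ↔ ∀ p ∈ elementaryIdeal (AddMonoidAlgebra ℤ (ℤ × ℤ)) (AlexanderModule ψ) 1, d ∣ p

/-- The substitution `t₁ = t₂ = t`. -/
noncomputable def diagonalSubst : AddMonoidAlgebra ℤ (ℤ × ℤ) →+* ℤ[T;T⁻¹] :=
  AddMonoidAlgebra.mapDomainRingHom ℤ
    ((AddMonoidHom.id ℤ).coprod (AddMonoidHom.id ℤ) : ℤ × ℤ →+ ℤ)

/-- `δ(t) = Δ(t, t)` for an Alexander polynomial `Δ(t₁, t₂)` of `L_w`. -/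
def IsReducedAlexanderPolynomial (n : ℕ) (w : BraidWord) (δ : ℤ[T;T⁻¹]) : Prop :=
  ∃ Δ, IsAlexanderPolynomial n w Δ ∧ diagonalSubst Δ = δ

/-! ### The homology monodromy -/

/-- The matrix with entries `1` in position `(j, j - 1)`, `-1` in position `(j, j + 1)` and `0`
elsewhere, where rows and columns are numbered `1, …, n - 1`. -/
def dehnJ (n j : ℕ) : Matrix (Fin (n - 1)) (Fin (n - 1)) ℤ :=
  Matrix.of fun a b =>
    if (a : ℕ) + 1 = j then
      if (b : ℕ) + 1 + 1 = j then 1 else if (b : ℕ) + 1 = j + 1 then -1 else 0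
    else 0

theorem dehnJ_mul_self (n j : ℕ) : dehnJ n j * dehnJ n j = 0 := by
  ext a b
  rw [Matrix.mul_apply]
  refine Finset.sum_eq_zero fun c _ => ?_
  simp only [dehnJ, Matrix.of_apply]
  split_ifs <;> omega

/-- The matrix `I + J` of the Dehn twist about the curve `C_j` of the chain `C_1, …, C_{n-1}`,
which lifts `β_j` and is `a ↦ a + (a · C_j) C_j` on the first homology of the fiber, as an
invertible matrix; the curves of the chain are a basis of this homology group. -/
def dehnTwist (n j : ℕ) : (Matrix (Fin (n - 1)) (Fin (n - 1)) ℤ)ˣ where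
  val := 1 + dehnJ n j
  inv := 1 - dehnJ n j
  val_inv := by rw [add_mul, mul_sub, mul_sub, dehnJ_mul_self]; simp
  inv_val := by rw [sub_mul, mul_add, mul_add, dehnJ_mul_self]; simp

/-- The homology monodromy of the fibered link `L_w`: the product of the matrices of the Dehn
twists that correspond to the letters of the `n`-strand braid `w`. -/
def homologyMonodromy (n : ℕ) (w : BraidWord) : Matrix (Fin (n - 1)) (Fin (n - 1)) ℤ :=
  (FreeGroup.lift (dehnTwist n) w : (Matrix (Fin (n - 1)) (Fin (n - 1)) ℤ)ˣ)

/-! Once the squares of the meridians `x_i` are killed, the `x_i` are involutions, and Artin's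
action, read on the loops `y_i = x_i x_l` of the double cover, becomes the core operation `(a, b) ↦
(a b⁻¹ a, a)`. The group of the covering link is generated by the first meridian `t` and the `y_i`;
taking the last strand for `l`, the relations are `core(y)_i core(y)_l⁻¹ t = t y_i`
(`crossDiff_relation`). That nothing else is needed is expressed by a universal property,
`exists_coverLinkHom`, and not by rewriting a presentation.

Differentiating these relations gives a presentation matrix `(t₁ - Fox | 1 - α)` of the Alexander
module with one more generator than relations (`alexMatrix_relations`, `alexMatrix_complete`). It
kills the vector of values `ψ(g) - 1` on the generators, so by Cramer's rule its maximal minors are,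
up to sign, the entries of that vector times one element `δ`, where `det(t₁ - Fox) = δ (t₁ - 1)`.
The entries have no common factor, hence `δ` is the Alexander polynomial (`exists_alexander_gcd`).
At `t₁ = t₂ = t` every `α_i` becomes `1`, so `δ(t,t) (t - 1)` is the characteristic polynomial of
the integral Fox matrix. The abelianization is identified with `ℤ²` by using that the closed braid
has only constant colorings in abelian groups.

The transpose of this integral Fox matrix and the homology monodromy both come from representing
`β_j` by a transvection along the `j`-th member of a chain with the same intersection numbers. One
computation with abstract chains (`IsTwistChain`) therefore serves for both. Conjugating a
transvection moves its curve, so for `n = 2e+4` the braid `B_{n,k}` becomes the product of the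
twists along `z_{2e+1}, …, z_2` and a fixed word in the twists along three curves `f`, `p`, `z_1`
(`IsTwistChain.twistRep_braidB`). Among these three curves only the number `f·p = 2k - 1` depends on
`k`.

In the family `f, p, z_1, …, z_{2e+1}` the monodromy is almost triangular, and lengthening the chain
by one curve borders the matrix in a uniform way. This gives a linear recursion for the
characteristic polynomials, with characteristic roots `X` and `-1` (`headCharpoly_rec`); the sizes
`3` and `4` are computed directly, and solving the recursion gives the stated formulas. The same
factorization shows that a linear function invariant under the monodromy on the strand lattice
vanishes on the chain, which is the statement on colorings (`IsTwistChain.eq_zero_of_invariant`). -/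

/-! ### The core action of braids on tuples -/

section Core

variable {H H' : Type*} [Group H] [Group H']

/-- The braid operation of the core quandle on tuples:
`a_i ↦ a_i a_j⁻¹ a_i`, `a_j ↦ a_i`, and the other entries are fixed. -/
def coreHalfTwist (H : Type*) [Group H] {n : ℕ} (i j : Fin n) (hij : i ≠ j) :
    Equiv.Perm (Fin n → H) where
  toFun a x := if x = i then a i * (a j)⁻¹ * a i else if x = j then a i else a x
  invFun a x := if x = i then a j else if x = j then a j * (a i)⁻¹ * a j else a x
  left_inv a := by
    funext x
    by_cases h1 : x = i
    · subst h1; simp [hij.symm]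
    · by_cases h2 : x = j
      · subst h2; simp [hij.symm, mul_assoc]
      · simp [h1, h2]
  right_inv a := by
    funext x
    by_cases h1 : x = i
    · subst h1; simp [hij.symm, mul_assoc]
    · by_cases h2 : x = j
      · subst h2; simp [hij.symm]
      · simp [h1, h2]

/-- The core action of `β_j` on `n`-tuples. -/
def coreLetter (H : Type*) [Group H] (n j : ℕ) : Equiv.Perm (Fin n → H) :=
  if h : 1 ≤ j ∧ j < n then
    coreHalfTwist H ⟨j - 1, by omega⟩ ⟨j, h.2⟩ (by simp only [ne_eq, Fin.mk.injEq]; omega)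
  else 1

/-- The core action as a homomorphism to the opposite group, since it is a right action. -/
def coreHom (H : Type*) [Group H] (n : ℕ) : BraidWord →* (Equiv.Perm (Fin n → H))ᵐᵒᵖ :=
  FreeGroup.lift fun j => MulOpposite.op (coreLetter H n j)

/-- The core action of a braid word on tuples (a right action). -/
def coreAct {n : ℕ} (w : BraidWord) (a : Fin n → H) : Fin n → H :=
  (coreHom H n w).unop a

@[simp] theorem coreAct_one {n : ℕ} (a : Fin n → H) : coreAct 1 a = a := by simp [coreAct]

theorem coreAct_mul {n : ℕ} (v w : BraidWord) (a : Fin n → H) :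
    coreAct (v * w) a = coreAct w (coreAct v a) := by simp [coreAct]

theorem coreAct_inv_coreAct {n : ℕ} (w : BraidWord) (a : Fin n → H) :
    coreAct w⁻¹ (coreAct w a) = a := by rw [← coreAct_mul, mul_inv_cancel, coreAct_one]

theorem coreAct_coreAct_inv {n : ℕ} (w : BraidWord) (a : Fin n → H) :
    coreAct w (coreAct w⁻¹ a) = a := by rw [← coreAct_mul, inv_mul_cancel, coreAct_one]

theorem coreAct_of {n : ℕ} (j : ℕ) (a : Fin n → H) :
    coreAct (FreeGroup.of j) a = coreLetter H n j a := by simp [coreAct, coreHom]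

/-- Two families of tuples are related by the core action as soon as they are so for letters. -/
theorem coreAct_intertwine {n : ℕ} (F : (Fin n → H) → (Fin n → H'))
    (hF : ∀ j a, F (coreLetter H n j a) = coreLetter H' n j (F a)) (w : BraidWord)
    (a : Fin n → H) : F (coreAct w a) = coreAct w (F a) := by
  induction w using FreeGroup.induction_on generalizing a with
  | C1 => simp
  | of j => rw [coreAct_of, coreAct_of, hF]
  | inv_of j hj =>
    rw [← coreAct_inv_coreAct (FreeGroup.of j) (F (coreAct (FreeGroup.of j)⁻¹ a)), ← hj,
      coreAct_coreAct_inv]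
  | mul x y hx hy => rw [coreAct_mul, coreAct_mul, hy, hx]

/-- The core operation is a word in the group operations, so homomorphisms respect it. Passing to
coordinates, quotients, Fox coefficients and abelian images below all rests on this naturality. -/
theorem coreAct_map {n : ℕ} (φ : H →* H') (w : BraidWord) (a : Fin n → H) (i : Fin n) :
    φ (coreAct w a i) = coreAct w (fun i => φ (a i)) i := by
  refine congrFun (coreAct_intertwine (fun a i => φ (a i)) (fun j a => ?_) w a) i
  funext x
  simp only [coreLetter]
  split_ifs with h
  · simp only [coreHalfTwist, Equiv.coe_fn_mk]
    split_ifs <;> simp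
  · rfl

/-- The word `a b⁻¹ a` is a palindrome, so inversion respects it although it reverses products. This
controls the second coordinate in the wreath product argument. -/
theorem coreAct_inv {n : ℕ} (w : BraidWord) (a : Fin n → H) (i : Fin n) :
    (coreAct w a i)⁻¹ = coreAct w (fun i => (a i)⁻¹) i := by
  refine congrFun (coreAct_intertwine (fun a i => (a i)⁻¹) (fun j a => ?_) w a) i
  funext x
  simp only [coreLetter]
  split_ifs with h
  · simp only [coreHalfTwist, Equiv.coe_fn_mk]
    split_ifs <;> simp [mul_assoc]
  · rfl

theorem coreAct_mem {n : ℕ} (S : Subgroup H) (w : BraidWord) (a : Fin n → H)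
    (ha : ∀ i, a i ∈ S) (i : Fin n) : coreAct w a i ∈ S := by
  have := coreAct_map S.subtype w (fun i => ⟨a i, ha i⟩) i
  simp only [Subgroup.subtype_apply] at this
  rw [← this]; exact SetLike.coe_mem _

/-- On involutions `b_i`, Artin's representation is the core action on the products `b_i τ`. -/
theorem artinAction_core {n : ℕ} (w : BraidWord) (τ : H) (hτ : τ * τ = 1) (b : Fin n → H)
    (hb : ∀ i, b i * b i = 1) :
    (∀ i, FreeGroup.lift b (artinAction n w (FreeGroup.of i)) *
      FreeGroup.lift b (artinAction n w (FreeGroup.of i)) = 1) ∧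
    (fun i => FreeGroup.lift b (artinAction n w (FreeGroup.of i)) * τ) =
      coreAct w fun i => b i * τ := by
  have hτ' : τ⁻¹ = τ := inv_eq_of_mul_eq_one_left hτ
  induction w using FreeGroup.induction_on generalizing b with
  | C1 => simp [hb]
  | of j =>
    have hb' : ∀ i, (b i)⁻¹ = b i := fun i => inv_eq_of_mul_eq_one_left (hb i)
    have hb2 : ∀ i x, b i * (b i * x) = x := fun i x => by rw [← mul_assoc, hb, one_mul]
    simp only [coreAct_of, artinAction, FreeGroup.lift_apply_of, artinLetter, coreLetter]
    split_ifs with h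
    · constructor
      · intro i
        simp only [artinHalfTwist, MonoidHom.toMulEquiv_apply, FreeGroup.lift_apply_of]
        split_ifs <;> simp [hb, hb', hb2, mul_assoc]
      · funext i
        simp only [artinHalfTwist, MonoidHom.toMulEquiv_apply, FreeGroup.lift_apply_of,
          coreHalfTwist, Equiv.coe_fn_mk]
        split_ifs
        · simp [mul_assoc, hb']
        · simp
        · simp
    · simp [hb]
  | inv_of j hj =>
    have hb' : ∀ i, (b i)⁻¹ = b i := fun i => inv_eq_of_mul_eq_one_left (hb i)
    have hb2 : ∀ i x, b i * (b i * x) = x := fun i x => by rw [← mul_assoc, hb, one_mul]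
    have h1 : ∀ i, FreeGroup.lift b (artinAction n (FreeGroup.of j)⁻¹ (FreeGroup.of i)) *
        FreeGroup.lift b (artinAction n (FreeGroup.of j)⁻¹ (FreeGroup.of i)) = 1 := by
      intro i
      simp only [map_inv, artinAction, FreeGroup.lift_apply_of, artinLetter]
      split_ifs with h
      · change FreeGroup.lift b ((artinHalfTwist _ _ _).symm _) *
          FreeGroup.lift b ((artinHalfTwist _ _ _).symm _) = 1
        simp only [artinHalfTwist, MonoidHom.toMulEquiv_symm_apply, FreeGroup.lift_apply_of]
        split_ifs <;> simp [hb, hb', hb2, mul_assoc]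
      · simp [hb]
    refine ⟨h1, ?_⟩
    -- The case of the positive letter is applied to the images under the inverse letter, which are
    -- involutions by `h1`; the two substitutions cancel, and the core action of the letter is then
    -- inverted.
    obtain ⟨-, h2⟩ := hj _ h1
    have h3 : ∀ x, FreeGroup.lift
        (fun i => FreeGroup.lift b (artinAction n (FreeGroup.of j)⁻¹ (FreeGroup.of i))) x =
        FreeGroup.lift b (artinAction n (FreeGroup.of j)⁻¹ x) := fun x =>
      (FreeGroup.lift_unique ((FreeGroup.lift b).comp
        (artinAction n (FreeGroup.of j)⁻¹).toMonoidHom) (fun i => rfl)).symm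
    have h4 : ∀ x, artinAction n (FreeGroup.of j)⁻¹ (artinAction n (FreeGroup.of j) x) = x :=
      fun x => by rw [map_inv, MulAut.inv_apply_self]
    simp only [h3, h4, FreeGroup.lift_apply_of] at h2
    rw [h2, coreAct_inv_coreAct]
  | mul x y hx hy =>
    obtain ⟨hx1, hx2⟩ := hx b hb
    have h3 : ∀ z, FreeGroup.lift
        (fun i => FreeGroup.lift b (artinAction n x (FreeGroup.of i))) z =
        FreeGroup.lift b (artinAction n x z) := fun z =>
      (FreeGroup.lift_unique ((FreeGroup.lift b).comp
        (artinAction n x).toMonoidHom) (fun i => rfl)).symm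
    obtain ⟨hy1, hy2⟩ := hy _ hx1
    simp only [h3] at hy1 hy2
    refine ⟨fun i => ?_, ?_⟩
    · rw [map_mul, MulAut.mul_apply]; exact hy1 i
    · simp only [map_mul, MulAut.mul_apply]
      rw [hy2, hx2, coreAct_mul]

end Core

/-! ### The group of the covering link -/

/-- The compatibility required by `SemidirectProduct.lift` for an infinite cyclic complement follows
from the case of its generator by induction on the exponent. -/
theorem conj_zpow_compat {N H : Type*} [Group N] [Group H] (Φ : MulAut N) (f : N →* H) (t : H)
    (h : ∀ x, f (Φ x) = t * f x * t⁻¹) (g : Multiplicative ℤ) :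
    f.comp (zpowersHom (MulAut N) Φ g).toMonoidHom =
      (MulAut.conj (zpowersHom H t g)).toMonoidHom.comp f := by
  have key : ∀ (k : ℤ) (x : N), f ((Φ ^ k) x) = t ^ k * f x * (t ^ k)⁻¹ := by
    intro k
    induction k using Int.induction_on with
    | zero => simp
    | succ k ih =>
      intro x
      rw [add_comm, zpow_add, MulAut.mul_apply, zpow_one, h, ih, zpow_add, zpow_one]
      simp [mul_assoc]
    | pred k ih =>
      intro x
      have h' : ∀ y, f (Φ⁻¹ y) = t⁻¹ * f y * t := by
        intro y
        have := h (Φ⁻¹ y)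
        rw [MulAut.apply_inv_self] at this
        rw [this]; group
      rw [sub_eq_add_neg, add_comm, zpow_add, MulAut.mul_apply, zpow_neg_one, h', ih, zpow_add,
        zpow_neg_one]
      simp [mul_assoc]
  ext x
  simp only [zpowersHom_apply]
  exact key _ x

section Cover

variable {n : ℕ} {w : BraidWord}

/-- The loop `x_i x_j` in the group of the covering link. -/
def pairLoop (n : ℕ) (w : BraidWord) (i j : Fin n) : CoverLinkGroup n w :=
  QuotientGroup.mk ⟨braidMeridian n w i * braidMeridian n w j, by
    simp only [MonoidHom.mem_ker, map_mul, braidMeridian, linkingParity,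
      SemidirectProduct.lift_inl, freeParity, FreeGroup.lift_apply_of]
    decide⟩

theorem axisMeridian_mul_inl (f : FreeGroup (Fin n)) :
    axisMeridian n w * SemidirectProduct.inl f * (axisMeridian n w)⁻¹ =
      SemidirectProduct.inl (artinAction n w f) := by
  rw [axisMeridian, ← map_inv, ← SemidirectProduct.inl_aut]
  simp

/-! ### Homomorphisms out of the group of the covering link -/

section Exists

variable {H : Type*} [Group H]

/-- The functions on the deck group, inside the wreath product. -/
def wreathBase (H : Type*) [Group H] : (Multiplicative (ZMod 2) → H) →*
    RegularWreathProduct H (Multiplicative (ZMod 2)) where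
  toFun d := ⟨d, 1⟩
  map_one' := rfl
  map_mul' a b := by ext <;> simp

/-- A function on the deck group with prescribed values. -/
def deckPair (x y : H) : Multiplicative (ZMod 2) → H := fun q => if q = 1 then x else y

theorem deck_sq : (Multiplicative.ofAdd (1 : ZMod 2)) * Multiplicative.ofAdd 1 = 1 := by decide

/-- A homomorphism on the index two subgroup is obtained from one on the whole group with values in
the wreath product of `H` with `ℤ/2`. Send `x_i` to the involution `(a_i, a_i⁻¹) σ` and `t` to `(t₁,
t₂)`. By `artinAction_core` the braid acts on the elements `x_i σ` of the base by the core action in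
each coordinate, so the relation for `t x_i t⁻¹` is the hypothesis in the first coordinate and its
inverse in the second. -/
theorem exists_coverLinkHom (a : Fin n → H) (t₁ t₂ : H)
    (h : ∀ i, t₁ * a i * t₂⁻¹ = coreAct w a i) :
    ∃ φ : CoverLinkGroup n w →* H, φ (coverMeridianFst n w) = t₁ ∧
      (∀ i, φ (coverMeridianSnd n w i) = a i * t₂ * (a i)⁻¹) ∧
      ∀ i j, φ (pairLoop n w i j) = a i * (a j)⁻¹ := by
  set σ : RegularWreathProduct H (Multiplicative (ZMod 2)) :=
    RegularWreathProduct.inl (Multiplicative.ofAdd 1) with hσ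
  have hσσ : σ * σ = 1 := by rw [hσ, ← map_mul, deck_sq, map_one]
  set d : Fin n → (Multiplicative (ZMod 2) → H) := fun i => deckPair (a i) (a i)⁻¹ with hd
  set X : Fin n → RegularWreathProduct H (Multiplicative (ZMod 2)) :=
    fun i => wreathBase H (d i) * σ with hX
  set τ := wreathBase H (deckPair t₁ t₂) with hτ
  have h10 : (Multiplicative.ofAdd (1 : ZMod 2))⁻¹ ≠ 1 := by decide
  have h11 : (Multiplicative.ofAdd (1 : ZMod 2)) ≠ 1 := by decide
  have hq : ∀ q : Multiplicative (ZMod 2), q ≠ 1 → q = Multiplicative.ofAdd 1 := by decide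
  have hXX : ∀ i, X i * X i = 1 := by
    intro i
    ext q
    · rcases eq_or_ne q 1 with rfl | h1
      · simp [hX, wreathBase, hσ, hd, deckPair]
      · obtain rfl := hq q h1
        simp [hX, wreathBase, hσ, hd, deckPair]
    · simp [hX, wreathBase, hσ]; decide
  have hact : ∀ i, FreeGroup.lift X (artinAction n w (FreeGroup.of i)) =
      τ * X i * τ⁻¹ := by
    intro i
    have h1 := congrFun (artinAction_core w σ hσσ X hXX).2 i
    have h2 : (fun i => X i * σ) = fun i => wreathBase H (d i) := by
      funext i; rw [hX]; simp only [mul_assoc, hσσ, mul_one]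
    rw [h2, ← coreAct_map] at h1
    have h3 : FreeGroup.lift X (artinAction n w (FreeGroup.of i)) =
        wreathBase H (coreAct w d i) * σ := by
      rw [← h1, mul_assoc, hσσ, mul_one]
    rw [h3]
    have h4 : coreAct w d i 1 = coreAct w a i := by
      have := coreAct_map (Pi.evalMonoidHom (fun _ => H) (1 : Multiplicative (ZMod 2))) w d i
      simpa [hd, deckPair] using this
    have h5 : coreAct w d i (Multiplicative.ofAdd 1) = (coreAct w a i)⁻¹ := by
      have := coreAct_map (Pi.evalMonoidHom (fun _ => H)
        (Multiplicative.ofAdd (1 : ZMod 2))) w d i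
      rw [coreAct_inv]
      simpa [hd, deckPair] using this
    rw [← h i] at h4 h5
    simp only [hd] at h4 h5
    ext q
    · rcases eq_or_ne q 1 with rfl | h1
      · simp [wreathBase, hσ, h4, hX, hτ, hd, deckPair]
      · obtain rfl := hq q h1
        simp [wreathBase, hσ, h5, hX, hτ, hd, deckPair, mul_assoc]
    · simp [wreathBase, hσ, hX, hτ]
  set F : ClosedBraidAxisGroup n w →* RegularWreathProduct H (Multiplicative (ZMod 2)) :=
    SemidirectProduct.lift (FreeGroup.lift X) (zpowersHom _ τ)
      (conj_zpow_compat _ _ _ (by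
        have : (FreeGroup.lift X).comp (artinAction n w).toMonoidHom =
            (MulAut.conj τ).toMonoidHom.comp (FreeGroup.lift X) := by
          ext1 i; simpa using hact i
        intro x; simpa using DFunLike.congr_fun this x)) with hF
  have hFX : ∀ i, F (braidMeridian n w i) = X i := fun i => by simp [hF, braidMeridian]
  have hFt : F (axisMeridian n w) = τ := by simp [hF, axisMeridian]
  have hright : ∀ g, (F g).right = linkingParity n w g := by
    have : (RegularWreathProduct.rightHom).comp F = linkingParity n w := by
      apply SemidirectProduct.hom_ext
      · ext i
        simp [hF, linkingParity, hX, wreathBase, hσ, freeParity]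
      · ext
        simp [hF, linkingParity, hτ, wreathBase]
    exact fun g => DFunLike.congr_fun this g
  -- Reading off the coordinate at `1` is multiplicative only where the deck component is trivial,
  -- that is, on the group of the double cover.
  let ev : DoubleCoverGroup n w →* H :=
    { toFun := fun k => (F k).left 1
      map_one' := by simp
      map_mul' := fun x y => by
        have hx : (F x).right = 1 := by rw [hright]; exact x.2
        simp [hx] }
  have hev : ∀ (k : DoubleCoverGroup n w), ev k = (F k).left 1 := fun _ => rfl
  refine ⟨QuotientGroup.lift _ ev (fun x hx => ?_), ?_, ?_, ?_⟩
  · have hle : Subgroup.normalClosure (Set.range fun i : Fin n =>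
      (⟨braidMeridian n w i ^ 2, braidMeridian_sq_mem n w i⟩ : DoubleCoverGroup n w)) ≤
        ev.ker := by
      apply Subgroup.normalClosure_le_normal
      rintro _ ⟨i, rfl⟩
      change (F (braidMeridian n w i ^ 2)).left 1 = 1
      rw [map_pow, hFX, pow_two, hXX]
      rfl
    exact hle hx
  · simp only [coverMeridianFst, QuotientGroup.lift_mk, hev, hFt]
    simp [hτ, wreathBase, deckPair]
  · intro i
    simp only [coverMeridianSnd, QuotientGroup.lift_mk, hev, map_mul, map_inv, hFt, hFX]
    simp [hτ, hX, hσ, hd, wreathBase, deckPair, mul_assoc]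
  · intro i j
    simp only [pairLoop, QuotientGroup.lift_mk, hev, map_mul, hFX]
    simp [hX, hσ, hd, wreathBase, deckPair]

end Exists

/-! ### The group of the covering link inside the orbifold group -/

variable (n w)

/-- The closed subgroup killed in the orbifold group of the branched cover. -/
def branchKernel : Subgroup (ClosedBraidAxisGroup n w) :=
  Subgroup.normalClosure (Set.range fun i : Fin n => braidMeridian n w i ^ 2)

instance : (branchKernel n w).Normal := by unfold branchKernel; infer_instance

/-- The squares of the meridians of the branch curve, in the group of the double cover. -/
def coverKernel : Subgroup (DoubleCoverGroup n w) :=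
  Subgroup.normalClosure (Set.range fun i : Fin n =>
      (⟨braidMeridian n w i ^ 2, braidMeridian_sq_mem n w i⟩ : DoubleCoverGroup n w))

instance : (coverKernel n w).Normal := by unfold coverKernel; infer_instance

variable {n w}

theorem branchKernel_le_ker : branchKernel n w ≤ (linkingParity n w).ker := by
  apply Subgroup.normalClosure_le_normal
  rintro _ ⟨i, rfl⟩
  exact braidMeridian_sq_mem n w i

theorem sq_mem_coverKernel (i : Fin n) :
    (⟨braidMeridian n w i ^ 2, braidMeridian_sq_mem n w i⟩ : DoubleCoverGroup n w) ∈
      coverKernel n w :=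
  Subgroup.subset_normalClosure ⟨i, rfl⟩

theorem linkingParity_braidMeridian (i : Fin n) :
    linkingParity n w (braidMeridian n w i) = Multiplicative.ofAdd 1 := by
  simp [braidMeridian, linkingParity, freeParity]

/-- For odd `g` one has `g x_i² g⁻¹ = (g x_i) x_i² (g x_i)⁻¹` with `g x_i` even. Hence the normal
closure formed in the double cover is already normal in the whole group. -/
theorem conj_sq_mem (g : ClosedBraidAxisGroup n w) (i : Fin n) :
    g * braidMeridian n w i ^ 2 * g⁻¹ ∈
      (coverKernel n w).map (linkingParity n w).ker.subtype := by
  have even : ∀ k ∈ (linkingParity n w).ker, k * braidMeridian n w i ^ 2 * k⁻¹ ∈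
      (coverKernel n w).map (linkingParity n w).ker.subtype := by
    intro k hk
    have h := (inferInstance : (coverKernel n w).Normal).conj_mem _ (sq_mem_coverKernel i) ⟨k, hk⟩
    have h' := Subgroup.mem_map_of_mem (linkingParity n w).ker.subtype h
    simpa only [map_mul, map_inv, Subgroup.subtype_apply] using h'
  by_cases hg : g ∈ (linkingParity n w).ker
  · exact even g hg
  · have h2 : g * braidMeridian n w i ∈ (linkingParity n w).ker := by
      rw [MonoidHom.mem_ker] at hg ⊢
      rw [map_mul, linkingParity_braidMeridian]
      revert hg
      generalize linkingParity n w g = q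
      revert q
      decide
    have := even _ h2
    convert this using 1
    simp [pow_two, mul_assoc]

theorem branchKernel_eq_map :
    branchKernel n w = (coverKernel n w).map (linkingParity n w).ker.subtype := by
  have hnormal : ((coverKernel n w).map (linkingParity n w).ker.subtype).Normal := by
    refine ⟨fun x hx g => ?_⟩
    obtain ⟨k, hk, rfl⟩ := hx
    have hle : coverKernel n w ≤ ((coverKernel n w).map (linkingParity n w).ker.subtype).comap
        ((MulAut.conj g).toMonoidHom.comp (linkingParity n w).ker.subtype) := by
      rw [coverKernel, Subgroup.normalClosure, Subgroup.closure_le]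
      intro y hy
      obtain ⟨_, ⟨i, rfl⟩, hc⟩ := Group.mem_conjugatesOfSet_iff.1 hy
      obtain ⟨c, rfl⟩ := isConj_iff.1 hc
      have := conj_sq_mem (g * (c : ClosedBraidAxisGroup n w)) i
      change g * ((c : ClosedBraidAxisGroup n w) * braidMeridian n w i ^ 2 *
        (c : ClosedBraidAxisGroup n w)⁻¹) * g⁻¹ ∈
          (coverKernel n w).map (linkingParity n w).ker.subtype
      convert this using 1
      simp [mul_assoc]
    exact hle hk
  apply le_antisymm
  · apply Subgroup.normalClosure_le_normal
    rintro _ ⟨i, rfl⟩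
    exact ⟨_, sq_mem_coverKernel i, rfl⟩
  · rw [Subgroup.map_le_iff_le_comap]
    apply Subgroup.normalClosure_le_normal
    rintro _ ⟨i, rfl⟩
    exact Subgroup.subset_normalClosure ⟨i, rfl⟩

variable (n w)

/-- The inclusion of the group of the covering link into the orbifold group. -/
def coverInclusion :
    CoverLinkGroup n w →* ClosedBraidAxisGroup n w ⧸ branchKernel n w :=
  QuotientGroup.map _ (branchKernel n w) (linkingParity n w).ker.subtype (by
    rw [← Subgroup.map_le_iff_le_comap, branchKernel_eq_map]; rfl)

variable {n w}

theorem coverInclusion_mk (k : DoubleCoverGroup n w) :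
    coverInclusion n w (QuotientGroup.mk k) =
      QuotientGroup.mk (k : ClosedBraidAxisGroup n w) := rfl

/-- Both normal closures of the `x_i²` agree by `branchKernel_eq_map`. Identities in the covering
link group may therefore be checked in the orbifold group, where each `x_i` exists as an involution.
-/
theorem coverInclusion_injective : Function.Injective (coverInclusion n w) := by
  rw [injective_iff_map_eq_one]
  intro x hx
  obtain ⟨k, rfl⟩ := QuotientGroup.mk_surjective x
  rw [coverInclusion_mk, QuotientGroup.eq_one_iff, branchKernel_eq_map] at hx
  obtain ⟨k', hk', h⟩ := hx
  obtain rfl := Subtype.ext h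
  exact (QuotientGroup.eq_one_iff _).2 hk'

theorem mk_braidMeridian_mul_self (i : Fin n) :
    (QuotientGroup.mk (braidMeridian n w i) : ClosedBraidAxisGroup n w ⧸ branchKernel n w) *
      QuotientGroup.mk (braidMeridian n w i) = 1 := by
  rw [← QuotientGroup.mk_mul, QuotientGroup.eq_one_iff, ← pow_two]
  exact Subgroup.subset_normalClosure ⟨i, rfl⟩

theorem coverInclusion_pairLoop (i j : Fin n) :
    coverInclusion n w (pairLoop n w i j) =
      QuotientGroup.mk (braidMeridian n w i) * QuotientGroup.mk (braidMeridian n w j) := rfl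

theorem pairLoop_self (i : Fin n) : pairLoop n w i i = 1 := by
  apply coverInclusion_injective
  rw [coverInclusion_pairLoop, mk_braidMeridian_mul_self, map_one]

/-- The monodromy relations in the group of the covering link. -/
theorem coreAct_pairLoop (i l : Fin n) :
    coreAct w (fun i => pairLoop n w i l) i =
      coverMeridianFst n w * (coverMeridianSnd n w i)⁻¹ * pairLoop n w i l := by
  apply coverInclusion_injective
  rw [coreAct_map]
  simp only [coverInclusion_pairLoop]
  set b : Fin n → ClosedBraidAxisGroup n w ⧸ branchKernel n w :=
    fun i => QuotientGroup.mk (braidMeridian n w i) with hb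
  have hbb : ∀ i, b i * b i = 1 := fun i => mk_braidMeridian_mul_self i
  have hbi : ∀ i, (b i)⁻¹ = b i := fun i => inv_eq_of_mul_eq_one_left (hbb i)
  -- The auxiliary involution is taken to be `x_l` itself, so that the core action is on the loops
  -- `x_i x_l`.
  have h1 := congrFun (artinAction_core w (b l) (hbb l) b hbb).2 i
  have h2 : ∀ x, FreeGroup.lift b x = QuotientGroup.mk
      (SemidirectProduct.inl x : ClosedBraidAxisGroup n w) := fun x =>
    (FreeGroup.lift_unique ((QuotientGroup.mk' (branchKernel n w)).comp
      SemidirectProduct.inl) (fun i => rfl)).symm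
  rw [← h1, h2, ← axisMeridian_mul_inl]
  simp only [map_mul, map_inv, coverInclusion_pairLoop]
  change QuotientGroup.mk (axisMeridian n w) * b i * (QuotientGroup.mk (axisMeridian n w))⁻¹ *
    b l = QuotientGroup.mk (axisMeridian n w) * (b i * QuotientGroup.mk (axisMeridian n w) *
      (b i)⁻¹)⁻¹ * (b i * b l)
  simp [mul_assoc]

/-- A Schreier argument: reading a word in the `x_i` letter by letter, the prefix lies in the image
of `S` either as it stands or after multiplication by `x_l`. For an even word the parity excludes
the second case. -/
theorem closure_coverLinkGroup (l : Fin n) :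
    Subgroup.closure (insert (coverMeridianFst n w) (Set.range fun i => pairLoop n w i l)) =
      ⊤ := by
  set S := Subgroup.closure
    (insert (coverMeridianFst n w) (Set.range fun i => pairLoop n w i l)) with hS
  set b : Fin n → ClosedBraidAxisGroup n w ⧸ branchKernel n w :=
    fun i => QuotientGroup.mk (braidMeridian n w i) with hb
  have hbb : ∀ i, b i * b i = 1 := fun i => mk_braidMeridian_mul_self i
  have hbi : ∀ i, (b i)⁻¹ = b i := fun i => inv_eq_of_mul_eq_one_left (hbb i)
  have hb2 : ∀ i x, b i * (b i * x) = x := fun i x => by rw [← mul_assoc, hbb, one_mul]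
  have hy : ∀ i, b i * b l ∈ S.map (coverInclusion n w) := fun i =>
    ⟨pairLoop n w i l, Subgroup.subset_closure (Or.inr ⟨i, rfl⟩), rfl⟩
  have hmul : ∀ (i : Fin n) (x : ClosedBraidAxisGroup n w ⧸ branchKernel n w),
      (x ∈ S.map (coverInclusion n w) ∨ x * b l ∈ S.map (coverInclusion n w)) →
      (x * b i ∈ S.map (coverInclusion n w) ∨ x * b i * b l ∈ S.map (coverInclusion n w)) := by
    rintro i x (h | h)
    · right; rw [mul_assoc]; exact mul_mem h (hy i)
    · left
      have := mul_mem h (inv_mem (hy i))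
      simpa [mul_assoc, hbi, hb2] using this
  have hfree : ∀ f : FreeGroup (Fin n), ∀ x : ClosedBraidAxisGroup n w ⧸ branchKernel n w,
      (x ∈ S.map (coverInclusion n w) ∨ x * b l ∈ S.map (coverInclusion n w)) →
      (x * FreeGroup.lift b f ∈ S.map (coverInclusion n w) ∨
        x * FreeGroup.lift b f * b l ∈ S.map (coverInclusion n w)) := by
    intro f
    induction f using FreeGroup.induction_on with
    | C1 => simp
    | of i => intro x hx; rw [FreeGroup.lift_apply_of]; exact hmul i x hx
    | inv_of i _ => intro x hx; rw [map_inv, FreeGroup.lift_apply_of, hbi]; exact hmul i x hx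
    | mul f g hf hg => intro x hx; rw [map_mul, ← mul_assoc]; exact hg _ (hf x hx)
  have hlift : ∀ x, FreeGroup.lift b x = QuotientGroup.mk
      (SemidirectProduct.inl x : ClosedBraidAxisGroup n w) := fun x =>
    (FreeGroup.lift_unique ((QuotientGroup.mk' (branchKernel n w)).comp
      SemidirectProduct.inl) (fun i => rfl)).symm
  rw [eq_top_iff]
  rintro x -
  obtain ⟨⟨k, hk⟩, rfl⟩ := QuotientGroup.mk_surjective x
  have ht : (QuotientGroup.mk (SemidirectProduct.inr k.right : ClosedBraidAxisGroup n w) :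
      ClosedBraidAxisGroup n w ⧸ branchKernel n w) ∈ S.map (coverInclusion n w) := by
    have h1 : (SemidirectProduct.inr k.right : ClosedBraidAxisGroup n w) =
        axisMeridian n w ^ (k.right.toAdd) := by
      rw [axisMeridian, ← map_zpow, ← ofAdd_zsmul]; simp
    rw [h1, QuotientGroup.mk_zpow]
    have h2 : (QuotientGroup.mk (axisMeridian n w) :
        ClosedBraidAxisGroup n w ⧸ branchKernel n w) ∈ S.map (coverInclusion n w) :=
      ⟨coverMeridianFst n w, Subgroup.subset_closure (Or.inl rfl), rfl⟩
    exact zpow_mem h2 _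
  have hk1 : (SemidirectProduct.inl k.left : ClosedBraidAxisGroup n w) ∈
      (linkingParity n w).ker := by
    rw [MonoidHom.mem_ker] at hk ⊢
    simpa [linkingParity, SemidirectProduct.lift] using hk
  have hk2 : (QuotientGroup.mk (SemidirectProduct.inl k.left : ClosedBraidAxisGroup n w) :
      ClosedBraidAxisGroup n w ⧸ branchKernel n w) ∈ S.map (coverInclusion n w) := by
    have := hfree k.left 1 (Or.inl (one_mem _))
    rw [one_mul, hlift] at this
    refine this.resolve_right ?_
    rintro ⟨s, -, hs⟩
    obtain ⟨⟨s, hs'⟩, rfl⟩ := QuotientGroup.mk_surjective s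
    rw [coverInclusion_mk] at hs
    change _ = ((SemidirectProduct.inl k.left * braidMeridian n w l :
      ClosedBraidAxisGroup n w) : ClosedBraidAxisGroup n w ⧸ branchKernel n w) at hs
    have h3 := branchKernel_le_ker (QuotientGroup.eq.1 hs)
    rw [MonoidHom.mem_ker] at h3 hk1 hs'
    change linkingParity n w (s⁻¹ * _) = 1 at h3
    rw [map_mul, map_inv, map_mul, hs', hk1, linkingParity_braidMeridian] at h3
    exact absurd h3 (by decide)
  obtain ⟨s, hs, hse⟩ := mul_mem hk2 ht
  rw [← QuotientGroup.mk_mul, SemidirectProduct.inl_left_mul_inr_right] at hse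
  have : s = QuotientGroup.mk ⟨k, hk⟩ := coverInclusion_injective hse
  rwa [← this]

end Cover

/-! ### Elementary ideals of modules of deficiency one -/

section ElementaryIdeal

open Matrix

variable {R M : Type*} [CommRing R] [AddCommGroup M] [Module R M]

/-- Cramer's rule: multiplying on the right by the identity matrix with last column replaced by `v`
makes the matrix block triangular, because `Q v = 0`. -/
theorem det_fromRows_replicateRow_mul {ι : Type*} [Fintype ι] [DecidableEq ι]
    (Q : Matrix ι (ι ⊕ Unit) R) (a v : ι ⊕ Unit → R) (hQv : Q *ᵥ v = 0) :
    (fromRows Q (replicateRow Unit a)).det * v (Sum.inr ()) =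
      (Q.submatrix id Sum.inl).det * (a ⬝ᵥ v) := by
  set V : Matrix (ι ⊕ Unit) (ι ⊕ Unit) R :=
    fromBlocks 1 (Matrix.of fun i _ => v (Sum.inl i)) 0 (Matrix.of fun _ _ => v (Sum.inr ()))
    with hV
  have hdet : V.det = v (Sum.inr ()) := by
    rw [hV, det_fromBlocks_zero₂₁]; simp
  have hmul : fromRows Q (replicateRow Unit a) * V =
      fromBlocks (Q.submatrix id Sum.inl) 0 (Matrix.of fun _ j => a (Sum.inl j))
        (Matrix.of fun _ _ => a ⬝ᵥ v) := by
    have hcol : ∀ (b : ι ⊕ Unit → R), (∑ x, b x * V x (Sum.inr ())) = b ⬝ᵥ v := by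
      intro b
      simp [dotProduct, hV]
    ext i j
    rcases i with i | i <;> rcases j with j | j
    · simp [Matrix.mul_apply, hV, Matrix.one_apply]
    · have := congrFun hQv i
      simpa [Matrix.mul_apply, hcol, mulVec] using this
    · simp [Matrix.mul_apply, hV, Matrix.one_apply]
    · simpa [Matrix.mul_apply] using hcol a
  rw [← hdet, ← det_mul, hmul, det_fromBlocks_zero₁₂]
  simp

theorem det_fromRows_single {κ : Type*} [Fintype κ] [DecidableEq κ]
    (ρ : Matrix κ (κ ⊕ Unit) R) :
    (fromRows ρ (replicateRow Unit (Pi.single (Sum.inr ()) 1))).det =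
      (ρ.submatrix id Sum.inl).det := by
  have : fromRows ρ (replicateRow Unit (Pi.single (Sum.inr ()) (1 : R))) =
      fromBlocks (ρ.submatrix id Sum.inl) (ρ.submatrix id Sum.inr) 0 1 := by
    ext i j
    rcases i with i | i <;> rcases j with j | j <;> simp
  rw [this, det_fromBlocks_zero₂₁]; simp

theorem exists_coeff_of_span_eq_top {ι κ : Type*} [Fintype ι] (z : ι → M) (x : κ → M)
    (hz : Submodule.span R (Set.range z) = ⊤) :
    ∃ A : Matrix κ ι R, ∀ i, ∑ j, A i j • z j = x i := by
  have : ∀ i, ∃ a : ι → R, ∑ j, a j • z j = x i := fun i => by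
    have : x i ∈ Submodule.span R (Set.range z) := hz ▸ Submodule.mem_top
    exact (Submodule.mem_span_range_iff_exists_fun R).1 this
  choose A hA using this
  exact ⟨Matrix.of A, hA⟩

theorem sum_mul_smul {ι κ μ : Type*} [Fintype ι] [Fintype κ] (A : Matrix μ κ R)
    (B : Matrix κ ι R) (z : ι → M) (i : μ) :
    ∑ j, (A * B) i j • z j = ∑ k, A i k • ∑ j, B k j • z j := by
  simp only [Matrix.mul_apply, Finset.sum_smul, Finset.smul_sum, mul_smul]
  exact Finset.sum_comm

theorem exists_mul_of_relations {ι κ μ : Type*} [Fintype ι] [Fintype κ] (z : κ → M)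
    (Q : Matrix ι κ R)
    (hcomplete : ∀ r : κ → R, ∑ j, r j • z j = 0 → ∃ c : ι → R, r = c ᵥ* Q)
    (B : Matrix μ κ R) (hB : ∀ i, ∑ j, B i j • z j = 0) : ∃ C : Matrix μ ι R, B = C * Q := by
  choose C hC using fun i => hcomplete (B i) (hB i)
  refine ⟨Matrix.of C, ?_⟩
  ext i j
  exact congrFun (hC i) j

/-- The minors of any presentation are multiples of the determinants obtained by adding a row to
a given presentation matrix of deficiency one. -/
theorem exists_det_eq {ι κ : Type*} [Fintype ι] [DecidableEq ι] [Fintype κ] [DecidableEq κ]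
    (z : ι ⊕ Unit → M) (Q : Matrix ι (ι ⊕ Unit) R)
    (hz : Submodule.span R (Set.range z) = ⊤)
    (hcomplete : ∀ r : ι ⊕ Unit → R, ∑ j, r j • z j = 0 → ∃ c : ι → R, r = c ᵥ* Q)
    (x : κ ⊕ Unit → M) (hx : Submodule.span R (Set.range x) = ⊤)
    (ρ : Matrix κ (κ ⊕ Unit) R) (hρ : ∀ i, ∑ j, ρ i j • x j = 0) :
    ∃ (s : R) (a : ι ⊕ Unit → R), (ρ.submatrix id Sum.inl).det =
      s * (fromRows Q (replicateRow Unit a)).det := by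
  obtain ⟨A, hA⟩ := exists_coeff_of_span_eq_top z x hz
  obtain ⟨B, hB⟩ := exists_coeff_of_span_eq_top x z hx
  obtain ⟨C, hC⟩ := exists_mul_of_relations z Q hcomplete (ρ * A) (fun i => by
    rw [sum_mul_smul]; simp only [hA, hρ])
  obtain ⟨E, hE⟩ := exists_mul_of_relations z Q hcomplete (1 - B * A) (fun i => by
    simp only [Matrix.sub_apply, sub_smul, Finset.sum_sub_distrib]
    rw [sum_mul_smul]; simp only [hA, hB]
    simp [Matrix.one_apply])
  -- Bordering `ρ` by this unit row gives a square matrix whose determinant is the minor without the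
  -- last column.
  set u : Matrix Unit (κ ⊕ Unit) R := replicateRow Unit (Pi.single (Sum.inr ()) 1) with hu
  set a : Matrix Unit (ι ⊕ Unit) R := u * A with ha
  have ha' : a = replicateRow Unit (a ()) := by ext i j; rfl
  set S : Matrix ((κ ⊕ Unit) ⊕ (ι ⊕ Unit)) ((κ ⊕ Unit) ⊕ (ι ⊕ Unit)) R :=
    fromBlocks (fromRows ρ 0) (fromBlocks C 0 0 1) (-B) (fromCols E 0) with hS
  refine ⟨S.det, a (), ?_⟩
  rw [← ha', ← det_fromRows_single, ← hu]
  -- The identity encodes `ρ A = C Q` and `1 - B A = E Q`. All factors except `S` are block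
  -- triangular, so determinants give `det (ρ; u) = det S · det (Q; a)`.
  have h1 : fromBlocks (fromRows ρ u) 0 (-B) (1 : Matrix (ι ⊕ Unit) (ι ⊕ Unit) R) *
      fromBlocks 1 A 0 1 = S * fromBlocks 1 0 (fromRows 0 u) (fromRows Q a) := by
    rw [hS, fromBlocks_multiply, fromBlocks_multiply]
    congr 1
    · ext i j
      rcases i with i | i <;> simp [Matrix.mul_apply]
    · rw [fromRows_mul, hC, ← ha]
      ext i j
      rcases i with i | i <;> simp [Matrix.mul_apply]
    · simp [fromCols_mul_fromRows]
    · rw [fromCols_mul_fromRows, Matrix.zero_mul, add_zero, ← hE]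
      simp [sub_eq_neg_add]
  have h2 := congrArg Matrix.det h1
  rw [det_mul, det_mul, det_fromBlocks_zero₁₂, det_fromBlocks_zero₂₁,
    det_fromBlocks_zero₁₂] at h2
  simpa using h2

/-- By `exists_det_eq` every minor is a multiple of some bordered determinant of `Q`, and Cramer's
rule evaluates the latter as `δ (a · v)`. -/
theorem dvd_of_mem_elementaryIdeal [IsDomain R] {ι : Type*} [Fintype ι] [DecidableEq ι]
    (z : ι ⊕ Unit → M) (Q : Matrix ι (ι ⊕ Unit) R)
    (hz : Submodule.span R (Set.range z) = ⊤)
    (hcomplete : ∀ r : ι ⊕ Unit → R, ∑ j, r j • z j = 0 → ∃ c : ι → R, r = c ᵥ* Q)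
    (v : ι ⊕ Unit → R) (hQv : Q *ᵥ v = 0) (hv : v (Sum.inr ()) ≠ 0) (δ : R)
    (hδ : (Q.submatrix id Sum.inl).det = δ * v (Sum.inr ())) {p : R}
    (hp : p ∈ elementaryIdeal R M 1) : δ ∣ p := by
  rw [← Ideal.mem_span_singleton]
  revert p
  change elementaryIdeal R M 1 ≤ Ideal.span {δ}
  rw [elementaryIdeal, Ideal.span_le]
  rintro p ⟨n, x, ρ, c, hx, hρ, rfl⟩
  rw [SetLike.mem_coe, Ideal.mem_span_singleton]
  by_cases hc : Function.Injective c
  -- An injective choice of `n` among `n + 1` columns omits exactly one; reindexing puts it in last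
  -- place. A choice that is not injective repeats a column and gives minor `0`.
  · obtain ⟨j, hj⟩ : ∃ j, j ∉ Set.range c := by
      by_contra! h
      have := Fintype.card_le_of_surjective c h
      simp at this
    have hinj : Function.Injective (Sum.elim c fun _ : Unit => j) :=
      hc.sumElim (Function.injective_of_subsingleton _) (fun a _ h => hj ⟨a, h⟩)
    have hbij : Function.Bijective (Sum.elim c fun _ : Unit => j) :=
      (Fintype.bijective_iff_injective_and_card _).2 ⟨hinj, by simp⟩
    set e := Equiv.ofBijective _ hbij
    obtain ⟨s, a, h⟩ := exists_det_eq z Q hz hcomplete (x ∘ e)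
      (by rw [Set.range_comp, e.range_eq_univ, Set.image_univ, hx]) (ρ.submatrix id e)
      (fun i => by rw [← hρ i]; exact e.sum_comp fun j => ρ i j • x j)
    have h' : (ρ.submatrix id c).det = s * (fromRows Q (replicateRow Unit a)).det := by
      rw [← h]; rfl
    rw [h']
    refine Dvd.dvd.mul_left ⟨a ⬝ᵥ v, mul_right_cancel₀ hv ?_⟩ _
    rw [det_fromRows_replicateRow_mul Q a v hQv, hδ]
    ring
  · simp only [Function.Injective, not_forall] at hc
    obtain ⟨i, j, hij, hne⟩ := hc
    rw [Matrix.det_zero_of_column_eq hne fun k => by simp [hij]]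
    exact dvd_zero _

theorem det_mem_elementaryIdeal {N : ℕ} (z : Fin N ⊕ Unit → M)
    (Q : Matrix (Fin N) (Fin N ⊕ Unit) R) (hz : Submodule.span R (Set.range z) = ⊤)
    (hQz : ∀ i, ∑ j, Q i j • z j = 0) (c : Fin N → Fin N ⊕ Unit) :
    (Q.submatrix id c).det ∈ elementaryIdeal R M 1 := by
  let e : Fin (N + 1) ≃ Fin N ⊕ Unit :=
    finSumFinEquiv.symm.trans (Equiv.sumCongr (Equiv.refl _) finOneEquiv)
  refine Ideal.subset_span ⟨N, z ∘ e, Q.submatrix id e, e.symm ∘ c, ?_, fun i => ?_, ?_⟩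
  · rw [Set.range_comp, e.range_eq_univ, Set.image_univ, hz]
  · rw [← hQz i]; exact e.sum_comp fun j => Q i j • z j
  · congr 1
    ext i j
    simp

/-- The minor obtained by omitting column `j` is `±δ v_j`. Together with
`dvd_of_mem_elementaryIdeal` this reduces the greatest common divisor to that of the entries of `v`.
-/
theorem mul_mem_elementaryIdeal [IsDomain R] {N : ℕ} (z : Fin N ⊕ Unit → M)
    (Q : Matrix (Fin N) (Fin N ⊕ Unit) R) (hz : Submodule.span R (Set.range z) = ⊤)
    (hQz : ∀ i, ∑ j, Q i j • z j = 0)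
    (v : Fin N ⊕ Unit → R) (hQv : Q *ᵥ v = 0) (hv : v (Sum.inr ()) ≠ 0) (δ : R)
    (hδ : (Q.submatrix id Sum.inl).det = δ * v (Sum.inr ())) (j : Fin N ⊕ Unit) :
    δ * v j ∈ elementaryIdeal R M 1 := by
  set σ : Equiv.Perm (Fin N ⊕ Unit) := Equiv.swap (Sum.inr ()) j with hσ
  have h1 := det_mem_elementaryIdeal z Q hz hQz (σ ∘ Sum.inl)
  have h2 : (fromRows Q (replicateRow Unit (Pi.single j 1))).det = δ * v j := by
    apply mul_right_cancel₀ hv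
    rw [det_fromRows_replicateRow_mul Q _ v hQv, hδ, single_one_dotProduct]
    ring
  have h3 : (Q.submatrix id (σ ∘ Sum.inl)).det = (Equiv.Perm.sign σ : ℤ) *
      (fromRows Q (replicateRow Unit (Pi.single j 1))).det := by
    rw [← det_permute']
    change ((Q.submatrix id σ).submatrix id Sum.inl).det = _
    rw [← det_fromRows_single]
    congr 1
    ext i k
    rcases i with i | i
    · simp
    · simp only [fromRows_apply_inr, replicateRow_apply, submatrix_apply, id_eq]
      simp only [Pi.single_apply, hσ, Equiv.swap_apply_eq_iff, Equiv.swap_apply_right]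
  rw [h3, h2] at h1
  rcases Int.units_eq_one_or (Equiv.Perm.sign σ) with h | h
  · simpa [h] using h1
  · simpa [h] using h1

end ElementaryIdeal

/-! ### Crossed homomorphisms and the Fox matrix of a braid -/

/-- The semidirect product of a module and the units of the ring. -/
@[ext]
structure CrossPair (R C : Type*) [CommRing R] [AddCommGroup C] [Module R C] where
  /-- The component in the module. -/
  val : C
  /-- The component in the units. -/
  unit : Rˣ

namespace CrossPair

variable {R R' C C' : Type*} [CommRing R] [CommRing R'] [AddCommGroup C] [AddCommGroup C']
  [Module R C] [Module R' C']

instance : Mul (CrossPair R C) where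
  mul a b := ⟨a.val + (a.unit : R) • b.val, a.unit * b.unit⟩

instance : One (CrossPair R C) where one := ⟨0, 1⟩

instance : Inv (CrossPair R C) where
  inv a := ⟨-((a.unit⁻¹ : Rˣ) : R) • a.val, a.unit⁻¹⟩

@[simp] theorem mul_val (a b : CrossPair R C) :
    (a * b).val = a.val + (a.unit : R) • b.val := rfl
@[simp] theorem mul_unit (a b : CrossPair R C) : (a * b).unit = a.unit * b.unit := rfl
@[simp] theorem one_val : (1 : CrossPair R C).val = 0 := rfl
@[simp] theorem one_unit : (1 : CrossPair R C).unit = 1 := rfl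
@[simp] theorem inv_val (a : CrossPair R C) :
    (a⁻¹).val = -((a.unit⁻¹ : Rˣ) : R) • a.val := rfl
@[simp] theorem inv_unit (a : CrossPair R C) : (a⁻¹).unit = a.unit⁻¹ := rfl

instance : Group (CrossPair R C) where
  mul_assoc a b c := by ext <;> simp [smul_add, mul_smul, add_assoc, mul_assoc]
  one_mul a := by ext <;> simp
  mul_one a := by ext <;> simp
  inv_mul_cancel a := by ext <;> simp

/-- The projection to the units. -/
def unitHom (R C : Type*) [CommRing R] [AddCommGroup C] [Module R C] : CrossPair R C →* Rˣ where
  toFun := unit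
  map_one' := rfl
  map_mul' _ _ := rfl

@[simp] theorem unitHom_apply (a : CrossPair R C) : unitHom R C a = a.unit := rfl

/-- Functoriality for semilinear maps. -/
def map (σ : R →+* R') (f : C →+ C') (h : ∀ r c, f (r • c) = σ r • f c) :
    CrossPair R C →* CrossPair R' C' where
  toFun a := ⟨f a.val, Units.map σ a.unit⟩
  map_one' := by ext <;> simp
  map_mul' a b := by ext <;> simp [h]

/-- The principal crossed homomorphism `u ↦ u - 1`. -/
def principal (R : Type*) [CommRing R] : Rˣ →* CrossPair R R where
  toFun u := ⟨u - 1, u⟩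
  map_one' := by ext <;> simp
  map_mul' u v := by ext <;> simp; ring

/-- The inclusion of the module. -/
def inclusion (R C : Type*) [CommRing R] [AddCommGroup C] [Module R C] :
    Multiplicative C →* CrossPair R C where
  toFun c := ⟨c.toAdd, 1⟩
  map_one' := rfl
  map_mul' a b := by ext <;> simp

@[simp] theorem inclusion_apply (c : Multiplicative C) : inclusion R C c = ⟨c.toAdd, 1⟩ := rfl

end CrossPair

section Fox

variable {R C : Type*} [CommRing R] [AddCommGroup C] [Module R C] {N : ℕ}

/-- The standard basis followed by `0`. -/
def stdTuple (R : Type*) [CommRing R] (N : ℕ) : Fin (N + 1) → (Fin N → R) :=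
  Fin.snoc (α := fun _ => Fin N → R) (fun i => Pi.single i 1) 0

/-- The difference of two entries of the core action on a tuple with values in a semidirect
product, where the last entry serves as base point. -/
def crossDiff (w : BraidWord) (α : Fin (N + 1) → Rˣ) (c : Fin (N + 1) → C) (i : Fin N) :
    CrossPair R C :=
  coreAct w (fun i => ⟨c i, α i⟩) i.castSucc *
    (coreAct w (fun i => (⟨c i, α i⟩ : CrossPair R C)) (Fin.last N))⁻¹

/-- The Fox matrix of a braid, acting on the fundamental group of the double cover of the
punctured disk. -/
def foxMatrix (w : BraidWord) (α : Fin (N + 1) → Rˣ) : Matrix (Fin N) (Fin N) R :=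
  Matrix.of fun i => (crossDiff w α (stdTuple R N) i).val

/-- A semilinear map induces a homomorphism of the semidirect products, so this is naturality of the
core action. It yields both the change of rings for Fox matrices and the formula for arbitrary
coefficients. -/
theorem crossDiff_map {R' C' : Type*} [CommRing R'] [AddCommGroup C'] [Module R' C']
    (σ : R →+* R') (f : C →+ C') (h : ∀ r c, f (r • c) = σ r • f c) (w : BraidWord)
    (α : Fin (N + 1) → Rˣ) (c : Fin (N + 1) → C) (i : Fin N) :
    f (crossDiff w α c i).val =
      (crossDiff w (fun i => Units.map (σ : R →* R') (α i)) (fun i => f (c i)) i).val := by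
  have h1 := coreAct_map (CrossPair.map σ f h) w (fun i => ⟨c i, α i⟩)
  have : CrossPair.map σ f h (crossDiff w α c i) =
      crossDiff w (fun i => Units.map (σ : R →* R') (α i)) (fun i => f (c i)) i := by
    rw [crossDiff, map_mul, map_inv, h1, h1]; rfl
  rw [← this]; rfl

theorem crossDiff_unit (w : BraidWord) (α : Fin (N + 1) → Rˣ) (c : Fin (N + 1) → C)
    (i : Fin N) : (crossDiff w α c i).unit =
      coreAct w α i.castSucc * (coreAct w α (Fin.last N))⁻¹ := by
  have h1 := coreAct_map (CrossPair.unitHom R C) w (fun i => ⟨c i, α i⟩)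
  rw [← CrossPair.unitHom_apply, crossDiff, map_mul, map_inv, h1, h1]; rfl

theorem foxMatrix_map {R' : Type*} [CommRing R'] (σ : R →+* R') (w : BraidWord)
    (α : Fin (N + 1) → Rˣ) :
    (foxMatrix w α).map σ = foxMatrix w fun i => Units.map (σ : R →* R') (α i) := by
  ext i j
  have h := crossDiff_map σ (σ.toAddMonoidHom.compLeft (Fin N)) (fun r c => by ext; simp) w α
    (stdTuple R N) i
  have h2 : (fun i => (σ.toAddMonoidHom.compLeft (Fin N)) (stdTuple R N i)) =
      stdTuple R' N := by
    funext i
    refine Fin.lastCases ?_ (fun i => ?_) i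
    · ext; simp [stdTuple]
    · ext k; simp [stdTuple, Pi.single_apply, apply_ite σ]
  rw [h2] at h
  exact congrFun h j

/-- The standard tuple is universal: `c` is its image under the linear map `e_j ↦ c_j`, the last
entry being `0` on both sides. -/
theorem crossDiff_val (w : BraidWord) (α : Fin (N + 1) → Rˣ) (c : Fin (N + 1) → C)
    (hc : c (Fin.last N) = 0) (i : Fin N) :
    (crossDiff w α c i).val = ∑ j, foxMatrix w α i j • c j.castSucc := by
  let f : (Fin N → R) →ₗ[R] C :=
    Fintype.linearCombination R (fun j : Fin N => c j.castSucc)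
  have h := crossDiff_map (RingHom.id R) f.toAddMonoidHom (fun r c => f.map_smul r c) w α
    (stdTuple R N) i
  have h2 : (fun i => f.toAddMonoidHom (stdTuple R N i)) = c := by
    funext i
    refine Fin.lastCases ?_ (fun i => ?_) i
    · simp [stdTuple, hc]
    · simp [stdTuple, f, Fintype.linearCombination_apply_single]
  have h3 : (fun i => Units.map ((RingHom.id R : R →+* R) : R →* R) (α i)) = α := by
    funext i; ext; simp
  rw [h2, h3] at h
  rw [← h]
  change f _ = _
  rw [Fintype.linearCombination_apply]
  rfl

/-- The fundamental formula of Fox calculus: it is `crossDiff_val` for the principal crossed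
homomorphism `u ↦ u - 1`. -/
theorem foxMatrix_mulVec (w : BraidWord) (α : Fin (N + 1) → Rˣ) (hα : α (Fin.last N) = 1)
    (i : Fin N) : ∑ j, foxMatrix w α i j * ((α j.castSucc : R) - 1) =
      ((coreAct w α i.castSucc * (coreAct w α (Fin.last N))⁻¹ : Rˣ) : R) - 1 := by
  have h1 := coreAct_map (CrossPair.principal R) w α
  have h2 := crossDiff_val w α (fun i => (α i : R) - 1) (by simp [hα]) i
  simp only [smul_eq_mul] at h2
  rw [← h2]
  have : CrossPair.principal R (coreAct w α i.castSucc * (coreAct w α (Fin.last N))⁻¹) =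
      crossDiff w α (fun i => (α i : R) - 1) i := by
    rw [map_mul, map_inv, h1, h1]; rfl
  rw [← this]; rfl

end Fox

/-! ### A presentation of the Alexander module -/

section Presentation

variable {G A : Type} [Group G] [AddCommGroup A]

/-- Group elements as units of the group ring. -/
noncomputable def groupUnit (A : Type) [AddCommGroup A] :
    Multiplicative A →* (AddMonoidAlgebra ℤ A)ˣ :=
  (AddMonoidAlgebra.of ℤ A).toHomUnits

theorem coe_groupUnit (a : Multiplicative A) :
    (groupUnit A a : AddMonoidAlgebra ℤ A) = AddMonoidAlgebra.single a.toAdd 1 := rfl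

/-- The universal crossed homomorphism. -/
noncomputable def alexDiff (ψ : G →* Multiplicative A) (g : G) : AlexanderModule ψ :=
  Submodule.Quotient.mk (Finsupp.single g 1)

theorem alexDiff_mul (ψ : G →* Multiplicative A) (g h : G) :
    alexDiff ψ (g * h) =
      alexDiff ψ g + (groupUnit A (ψ g) : AddMonoidAlgebra ℤ A) • alexDiff ψ h := by
  have h1 : (Submodule.Quotient.mk (Finsupp.single (g * h) 1 - Finsupp.single g 1 -
      Finsupp.single h (AddMonoidAlgebra.single (ψ g).toAdd 1)) : AlexanderModule ψ) = 0 :=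
    (Submodule.Quotient.mk_eq_zero _).2 (Submodule.subset_span ⟨(g, h), rfl⟩)
  rw [Submodule.Quotient.mk_sub, Submodule.Quotient.mk_sub, sub_sub, sub_eq_zero] at h1
  rw [alexDiff, h1, alexDiff, alexDiff, ← Submodule.Quotient.mk_smul, Finsupp.smul_single,
    coe_groupUnit, smul_eq_mul, mul_one]

/-- The universal crossed homomorphism as a homomorphism to a semidirect product. -/
noncomputable def alexHom (ψ : G →* Multiplicative A) :
    G →* CrossPair (AddMonoidAlgebra ℤ A) (AlexanderModule ψ) where
  toFun g := ⟨alexDiff ψ g, groupUnit A (ψ g)⟩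
  map_one' := by
    have h := alexDiff_mul ψ 1 1
    ext
    · simpa using h
    · simp
  map_mul' g h := by
    ext
    · simp [alexDiff_mul]
    · simp

theorem exists_alexLift {C : Type*} [AddCommGroup C] [Module (AddMonoidAlgebra ℤ A) C]
    (ψ : G →* Multiplicative A) (F : G →* CrossPair (AddMonoidAlgebra ℤ A) C)
    (hF : ∀ g, (F g).unit = groupUnit A (ψ g)) :
    ∃ f : AlexanderModule ψ →ₗ[AddMonoidAlgebra ℤ A] C,
      ∀ g, f (alexDiff ψ g) = (F g).val := by
  refine ⟨Submodule.liftQ _ (Finsupp.linearCombination (AddMonoidAlgebra ℤ A)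
    fun g => (F g).val) ?_, fun g => ?_⟩
  · rw [alexanderRelations, Submodule.span_le]
    rintro _ ⟨⟨g, h⟩, rfl⟩
    simp [hF, ← coe_groupUnit]
  · change Finsupp.linearCombination (AddMonoidAlgebra ℤ A) (fun g => (F g).val)
      (Finsupp.single g 1) = _
    simp

theorem span_alexDiff (ψ : G →* Multiplicative A) (S : Set G) (hS : Subgroup.closure S = ⊤) :
    Submodule.span (AddMonoidAlgebra ℤ A) (alexDiff ψ '' S) = ⊤ := by
  have h1 : ∀ g, alexDiff ψ g ∈ Submodule.span (AddMonoidAlgebra ℤ A) (alexDiff ψ '' S) := by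
    intro g
    have hg : g ∈ Subgroup.closure S := hS ▸ Subgroup.mem_top g
    induction hg using Subgroup.closure_induction with
    | mem x hx => exact Submodule.subset_span ⟨x, hx, rfl⟩
    | one =>
      have h := congrArg CrossPair.val (alexHom ψ).map_one
      change alexDiff ψ 1 = 0 at h
      rw [h]; exact zero_mem _
    | mul x y _ _ hx hy =>
      rw [alexDiff_mul]
      exact add_mem hx (Submodule.smul_mem _ _ hy)
    | inv x _ hx =>
      have h := congrArg CrossPair.val ((alexHom ψ).map_inv x)
      change alexDiff ψ x⁻¹ = -_ • alexDiff ψ x at h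
      rw [h]
      exact Submodule.smul_mem _ _ hx
  rw [eq_top_iff]
  rintro x -
  obtain ⟨x, rfl⟩ := Submodule.Quotient.mk_surjective _ x
  induction x using Finsupp.induction_linear with
  | zero => exact zero_mem _
  | add f g hf hg => rw [Submodule.Quotient.mk_add]; exact add_mem hf hg
  | single g r =>
    have : (Submodule.Quotient.mk (Finsupp.single g r) : AlexanderModule ψ) =
        r • alexDiff ψ g := by
      rw [alexDiff, ← Submodule.Quotient.mk_smul, Finsupp.smul_single, smul_eq_mul, mul_one]
    rw [this]
    exact Submodule.smul_mem _ _ (h1 g)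

end Presentation

/-! ### The Alexander module of the covering link -/

section CoverLinkAlexander

open Matrix

variable {N : ℕ} {w : BraidWord}

theorem coverMeridianSnd_eq (i l : Fin (N + 1)) :
    coverMeridianSnd (N + 1) w i = pairLoop (N + 1) w i l * coverMeridianSnd (N + 1) w l *
      (pairLoop (N + 1) w i l)⁻¹ := by
  apply coverInclusion_injective
  simp only [map_mul, map_inv, coverInclusion_pairLoop]
  have hbb := mk_braidMeridian_mul_self (n := N + 1) (w := w) l
  have hbi := inv_eq_of_mul_eq_one_left hbb
  set b : Fin (N + 1) → ClosedBraidAxisGroup (N + 1) w ⧸ branchKernel (N + 1) w :=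
    fun i => QuotientGroup.mk (braidMeridian (N + 1) w i) with hb
  set t : ClosedBraidAxisGroup (N + 1) w ⧸ branchKernel (N + 1) w :=
    QuotientGroup.mk (axisMeridian (N + 1) w) with ht
  change b i * t * (b i)⁻¹ = b i * b l * (b l * t * (b l)⁻¹) * (b i * b l)⁻¹
  change b l * b l = 1 at hbb
  change (b l)⁻¹ = b l at hbi
  have h2 : ∀ x, b l * (b l * x) = x := fun x => by rw [← mul_assoc, hbb, one_mul]
  simp [mul_assoc, h2, hbi]

/-- Dividing the monodromy relation of strand `i` by that of the last strand eliminates the second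
meridian, since its versions at different strands are conjugate by the loops `x_i x_l`. -/
theorem crossDiff_relation (i : Fin N) :
    coreAct w (fun i => pairLoop (N + 1) w i (Fin.last N)) i.castSucc *
      (coreAct w (fun i => pairLoop (N + 1) w i (Fin.last N)) (Fin.last N))⁻¹ *
        coverMeridianFst (N + 1) w =
      coverMeridianFst (N + 1) w * pairLoop (N + 1) w i.castSucc (Fin.last N) := by
  rw [coreAct_pairLoop, coreAct_pairLoop, pairLoop_self,
    coverMeridianSnd_eq i.castSucc (Fin.last N)]
  group

variable {A : Type} [AddCommGroup A] (ψ : CoverLinkGroup (N + 1) w →* Multiplicative A)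

/-- The units of the group ring that correspond to the loops `x_i x_n`. -/
noncomputable def loopUnit (i : Fin (N + 1)) : (AddMonoidAlgebra ℤ A)ˣ :=
  groupUnit A (ψ (pairLoop (N + 1) w i (Fin.last N)))

/-- The unit of the group ring that corresponds to the meridian of the first component. -/
noncomputable def fstUnit : (AddMonoidAlgebra ℤ A)ˣ :=
  groupUnit A (ψ (coverMeridianFst (N + 1) w))

/-- The generators of the Alexander module. -/
noncomputable def alexGen : Fin N ⊕ Unit → AlexanderModule ψ :=
  Sum.elim (fun i => alexDiff ψ (pairLoop (N + 1) w i.castSucc (Fin.last N)))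
    fun _ => alexDiff ψ (coverMeridianFst (N + 1) w)

/-- The presentation matrix of the Alexander module. -/
noncomputable def alexMatrix : Matrix (Fin N) (Fin N ⊕ Unit) (AddMonoidAlgebra ℤ A) :=
  fromCols ((fstUnit ψ : AddMonoidAlgebra ℤ A) • 1 - foxMatrix w (loopUnit ψ))
    (Matrix.of fun i _ => 1 - (loopUnit ψ i.castSucc : AddMonoidAlgebra ℤ A))

theorem loopUnit_last : loopUnit ψ (Fin.last N) = 1 := by
  rw [loopUnit, pairLoop_self, map_one, map_one]

theorem coreAct_loopUnit (i : Fin N) : coreAct w (loopUnit ψ) i.castSucc *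
    (coreAct w (loopUnit ψ) (Fin.last N))⁻¹ = loopUnit ψ i.castSucc := by
  have h := congrArg ((groupUnit A).comp ψ) (crossDiff_relation (w := w) i)
  simp only [map_mul, map_inv, coreAct_map] at h
  rw [mul_comm, mul_left_cancel_iff] at h
  exact h

theorem span_alexGen :
    Submodule.span (AddMonoidAlgebra ℤ A) (Set.range (alexGen ψ)) = ⊤ := by
  rw [eq_top_iff, ← span_alexDiff ψ _ (closure_coverLinkGroup (w := w) (Fin.last N)),
    Submodule.span_le]
  rintro _ ⟨g, hg | ⟨i, rfl⟩, rfl⟩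
  · rw [hg]; exact Submodule.subset_span ⟨Sum.inr (), rfl⟩
  · refine Fin.lastCases ?_ (fun i => ?_) i
    · have h := congrArg CrossPair.val (alexHom ψ).map_one
      change alexDiff ψ 1 = 0 at h
      simp only [pairLoop_self, h]
      exact zero_mem _
    · exact Submodule.subset_span ⟨Sum.inl i, rfl⟩

theorem sum_alexMatrix_smul {C : Type*} [AddCommGroup C] [Module (AddMonoidAlgebra ℤ A) C]
    (c : Fin N ⊕ Unit → C) (i : Fin N) : ∑ j, alexMatrix ψ i j • c j =
      (fstUnit ψ : AddMonoidAlgebra ℤ A) • c (Sum.inl i) -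
        (∑ j, foxMatrix w (loopUnit ψ) i j • c (Sum.inl j)) +
        (1 - (loopUnit ψ i.castSucc : AddMonoidAlgebra ℤ A)) • c (Sum.inr ()) := by
  simp [alexMatrix, sub_smul, Finset.sum_sub_distrib, Matrix.one_apply]

theorem sub_add_sub_eq_zero_of_add_eq {C : Type*} [AddCommGroup C] {a b c d : C}
    (h : b + c = d + a) : a - b + (d - c) = 0 := by
  rw [sub_add_sub_comm, h, add_comm, sub_self]

theorem sum_foxMatrix_smul_of_crossDiff {R C : Type*} [CommRing R] [AddCommGroup C]
    [Module R C] (w : BraidWord) (α : Fin (N + 1) → Rˣ) (c : Fin (N + 1) → C)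
    (hc : c (Fin.last N) = 0) (i : Fin N) (d : C) (t u : Rˣ)
    (hu : coreAct w α i.castSucc * (coreAct w α (Fin.last N))⁻¹ = u)
    (h : crossDiff w α c i * ⟨d, t⟩ = ⟨d, t⟩ * ⟨c i.castSucc, u⟩) :
    (∑ j, foxMatrix w α i j • c j.castSucc) + (u : R) • d = d + (t : R) • c i.castSucc := by
  have h1 := congrArg CrossPair.val h
  rwa [CrossPair.mul_val, CrossPair.mul_val, crossDiff_unit, hu, crossDiff_val _ _ _ hc] at h1

theorem alexMatrix_relations (i : Fin N) :
    ∑ j, alexMatrix ψ i j • alexGen ψ j = 0 := by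
  rw [sum_alexMatrix_smul]
  have h := congrArg (alexHom ψ) (crossDiff_relation (w := w) i)
  simp only [map_mul, map_inv, coreAct_map] at h
  have h0 : alexDiff ψ (pairLoop (N + 1) w (Fin.last N) (Fin.last N)) = 0 := by
    rw [pairLoop_self]
    exact congrArg CrossPair.val (alexHom ψ).map_one
  change crossDiff w (loopUnit ψ) (fun i => alexDiff ψ (pairLoop (N + 1) w i (Fin.last N))) i *
    ⟨alexDiff ψ (coverMeridianFst (N + 1) w), fstUnit ψ⟩ =
      ⟨alexDiff ψ (coverMeridianFst (N + 1) w), fstUnit ψ⟩ *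
        ⟨alexDiff ψ (pairLoop (N + 1) w i.castSucc (Fin.last N)), loopUnit ψ i.castSucc⟩ at h
  have h1 := sum_foxMatrix_smul_of_crossDiff w (loopUnit ψ)
    (fun i => alexDiff ψ (pairLoop (N + 1) w i (Fin.last N))) h0 i _ _ _
    (coreAct_loopUnit ψ i) h
  simp only [alexGen, Sum.elim_inl, Sum.elim_inr, sub_smul, one_smul]
  exact sub_add_sub_eq_zero_of_add_eq h1

/-- Let `K` be the row space. The tautological classes modulo `K` satisfy the differentiated
relations, so `exists_coverLinkHom` gives a homomorphism to the semidirect product of the quotient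
by `K` with the units. The induced linear map from the Alexander module sends the generators to the
standard classes, and hence every relation lies in `K`. -/
theorem alexMatrix_complete (r : Fin N ⊕ Unit → AddMonoidAlgebra ℤ A)
    (hr : ∑ j, r j • alexGen ψ j = 0) :
    ∃ c : Fin N → AddMonoidAlgebra ℤ A, r = c ᵥ* alexMatrix ψ := by
  let K := LinearMap.range (Matrix.vecMulLinear (alexMatrix ψ))
  let e : Fin N ⊕ Unit → (Fin N ⊕ Unit → AddMonoidAlgebra ℤ A) ⧸ K :=
    fun j => Submodule.Quotient.mk (Pi.single j 1)
  have hmk : ∀ x : Fin N ⊕ Unit → AddMonoidAlgebra ℤ A,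
      (Submodule.Quotient.mk x : (Fin N ⊕ Unit → AddMonoidAlgebra ℤ A) ⧸ K) =
        ∑ j, x j • e j := by
    intro x
    have : x = ∑ j, x j • (Pi.single j 1 : Fin N ⊕ Unit → AddMonoidAlgebra ℤ A) := by
      ext k; simp [Finset.sum_apply, Pi.single_apply]
    conv_lhs => rw [this]
    rw [← Submodule.mkQ_apply, map_sum]
    simp only [map_smul, Submodule.mkQ_apply, e]
  have hrel : ∀ i, ∑ j, alexMatrix ψ i j • e j = 0 := by
    intro i
    rw [← hmk, Submodule.Quotient.mk_eq_zero]
    exact ⟨Pi.single i 1, by simp [Matrix.vecMulLinear, Matrix.row]⟩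
  let c : Fin (N + 1) → (Fin N ⊕ Unit → AddMonoidAlgebra ℤ A) ⧸ K :=
    Fin.snoc (α := fun _ => (Fin N ⊕ Unit → AddMonoidAlgebra ℤ A) ⧸ K)
      (fun i => e (Sum.inl i)) 0
  have hc1 : ∀ i : Fin N, c i.castSucc = e (Sum.inl i) := fun i => by simp [c]
  have hc2 : c (Fin.last N) = 0 := by simp [c]
  let a : Fin (N + 1) → CrossPair (AddMonoidAlgebra ℤ A)
    ((Fin N ⊕ Unit → AddMonoidAlgebra ℤ A) ⧸ K) := fun i => ⟨c i, loopUnit ψ i⟩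
  have ha : a (Fin.last N) = 1 := CrossPair.ext hc2 (loopUnit_last ψ)
  let t : CrossPair (AddMonoidAlgebra ℤ A)
    ((Fin N ⊕ Unit → AddMonoidAlgebra ℤ A) ⧸ K) := ⟨e (Sum.inr ()), fstUnit ψ⟩
  -- The image of the second meridian is forced by the equation at the last strand, where the tuple
  -- has the value `1`.
  obtain ⟨F, hF1, -, hF3⟩ := exists_coverLinkHom (w := w) a t ((coreAct w a (Fin.last N))⁻¹ * t)
    (fun i => by
      refine Fin.lastCases ?_ (fun i => ?_) i
      · rw [ha]; group
      · suffices h : t * a i.castSucc = crossDiff w (loopUnit ψ) c i * t by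
          rw [h]; simp only [crossDiff]
          change coreAct w a _ * (coreAct w a _)⁻¹ * t * _ = _
          group
        ext1
        · rw [CrossPair.mul_val, CrossPair.mul_val, crossDiff_val _ _ _ hc2, crossDiff_unit,
            coreAct_loopUnit]
          have h := hrel i
          rw [sum_alexMatrix_smul, sub_smul, one_smul] at h
          simp only [hc1, a, t]
          rw [sub_add_eq_add_sub, sub_eq_zero, add_sub, sub_eq_iff_eq_add] at h
          rw [add_comm, h]
        · rw [CrossPair.mul_unit, CrossPair.mul_unit, crossDiff_unit, coreAct_loopUnit, mul_comm])
  have hunit : ∀ g, (F g).unit = groupUnit A (ψ g) := by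
    have : (CrossPair.unitHom _ _).comp F = (groupUnit A).comp ψ := by
      apply MonoidHom.eq_of_eqOn_dense (closure_coverLinkGroup (w := w) (Fin.last N))
      rintro g (rfl | ⟨i, rfl⟩)
      · simp only [MonoidHom.comp_apply, hF1]; rfl
      · simp only [MonoidHom.comp_apply, hF3, ha]
        rw [inv_one, mul_one]; rfl
    exact fun g => DFunLike.congr_fun this g
  obtain ⟨f, hf⟩ := exists_alexLift ψ F hunit
  have hfg : ∀ j, f (alexGen ψ j) = e j := by
    rintro (i | i)
    · simp only [alexGen, Sum.elim_inl, hf, hF3, ha, inv_one, mul_one]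
      exact hc1 i
    · simp only [alexGen, Sum.elim_inr, hf, hF1]; rfl
  have := congrArg f hr
  rw [map_sum, map_zero] at this
  simp only [map_smul, hfg] at this
  rw [← hmk, Submodule.Quotient.mk_eq_zero] at this
  obtain ⟨c, hc⟩ := this
  exact ⟨c, hc.symm⟩

/-- The vector of the values `ψ(g) - 1` on the generators. -/
noncomputable def augVec : Fin N ⊕ Unit → AddMonoidAlgebra ℤ A :=
  Sum.elim (fun i => (loopUnit ψ i.castSucc : AddMonoidAlgebra ℤ A) - 1)
    fun _ => (fstUnit ψ : AddMonoidAlgebra ℤ A) - 1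

theorem foxMatrix_mulVec_loopUnit (i : Fin N) :
    ∑ j, foxMatrix w (loopUnit ψ) i j *
      ((loopUnit ψ j.castSucc : AddMonoidAlgebra ℤ A) - 1) =
      (loopUnit ψ i.castSucc : AddMonoidAlgebra ℤ A) - 1 := by
  rw [foxMatrix_mulVec w (loopUnit ψ) (loopUnit_last ψ), coreAct_loopUnit]

theorem alexMatrix_mulVec : alexMatrix ψ *ᵥ augVec ψ = 0 := by
  ext1 i
  have h := sum_alexMatrix_smul ψ (augVec ψ) i
  simp only [smul_eq_mul] at h
  change ∑ j, alexMatrix ψ i j * augVec ψ j = 0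
  rw [h]
  simp only [augVec, Sum.elim_inl, Sum.elim_inr, foxMatrix_mulVec_loopUnit]
  ring

theorem alexMatrix_submatrix : (alexMatrix ψ).submatrix id Sum.inl =
    (fstUnit ψ : AddMonoidAlgebra ℤ A) • 1 - foxMatrix w (loopUnit ψ) := by
  ext i j; simp [alexMatrix]

end CoverLinkAlexander

/-! ### The Alexander polynomial of the covering link -/

section AlexanderPolynomial

open Matrix

/-- The substitution `t₁ = 1`. -/
noncomputable def fstOne : AddMonoidAlgebra ℤ (ℤ × ℤ) →+* ℤ[T;T⁻¹] :=
  AddMonoidAlgebra.mapDomainRingHom ℤ (AddMonoidHom.snd ℤ ℤ)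

theorem fstOne_single (a : ℤ × ℤ) (r : ℤ) :
    fstOne (AddMonoidAlgebra.single a r) = AddMonoidAlgebra.single a.2 r := by
  simp [fstOne]

theorem sub_one_dvd_zpow_sub_one {R : Type*} [CommRing R] (u : Rˣ) (n : ℤ) :
    (u : R) - 1 ∣ ((u ^ n : Rˣ) : R) - 1 := by
  obtain ⟨k, rfl | rfl⟩ := n.eq_nat_or_neg
  · simpa using sub_one_dvd_pow_sub_one (u : R) k
  · have h : (u : R) - 1 ∣ (u : R) ^ k - 1 := by simpa using sub_dvd_pow_sub_pow (u : R) 1 k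
    have h2 : ((u ^ (-(k : ℤ)) : Rˣ) : R) - 1 =
        -(((u ^ (-(k : ℤ)) : Rˣ) : R) * ((u : R) ^ k - 1)) := by
      have : ((u ^ (-(k : ℤ)) : Rˣ) : R) * (u : R) ^ k = 1 := by
        rw [← Units.val_pow_eq_pow_val, ← Units.val_mul, _root_.zpow_neg, zpow_natCast,
          inv_mul_cancel, Units.val_one]
      rw [mul_sub, this]; ring
    rw [h2]
    exact (Dvd.dvd.mul_left h _).neg_right

/-- Monomial by monomial, an element differs from its value at `t₁ = 1` by a multiple of `t₁ - 1`.
-/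
theorem dvd_of_fstOne_eq_zero (x : AddMonoidAlgebra ℤ (ℤ × ℤ)) (hx : fstOne x = 0) :
    AddMonoidAlgebra.single (1, 0) 1 - 1 ∣ x := by
  have key : ∀ y : AddMonoidAlgebra ℤ (ℤ × ℤ),
      AddMonoidAlgebra.single ((1, 0) : ℤ × ℤ) (1 : ℤ) - 1 ∣
        y - AddMonoidAlgebra.mapDomainRingHom ℤ (AddMonoidHom.inr ℤ ℤ) (fstOne y) := by
    intro y
    induction y using AddMonoidAlgebra.induction_linear with
    | zero => simp
    | add f g hf hg =>
      have := dvd_add hf hg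
      rw [map_add, map_add]
      convert this using 1
      ring
    | single m r =>
      obtain ⟨a, b⟩ := m
      have h1 := sub_one_dvd_zpow_sub_one (groupUnit (ℤ × ℤ) (Multiplicative.ofAdd (1, 0))) a
      rw [← map_zpow, ← ofAdd_zsmul, coe_groupUnit, coe_groupUnit] at h1
      simp only [toAdd_ofAdd, Prod.smul_mk, smul_eq_mul, mul_one, mul_zero] at h1
      have h2 : (AddMonoidAlgebra.single (a, b) r : AddMonoidAlgebra ℤ (ℤ × ℤ)) -
          AddMonoidAlgebra.mapDomainRingHom ℤ (AddMonoidHom.inr ℤ ℤ)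
            (fstOne (AddMonoidAlgebra.single (a, b) r)) =
          (AddMonoidAlgebra.single (a, 0) 1 - 1) * AddMonoidAlgebra.single (0, b) r := by
        have h3 : AddMonoidAlgebra.mapDomainRingHom ℤ (AddMonoidHom.inr ℤ ℤ)
            (AddMonoidAlgebra.single b r) = AddMonoidAlgebra.single (0, b) r := by
          rw [AddMonoidAlgebra.mapDomainRingHom_apply]
          exact AddMonoidAlgebra.mapDomain_single
        rw [fstOne_single, sub_mul, one_mul, AddMonoidAlgebra.single_mul_single]
        change AddMonoidAlgebra.single (a, b) r - AddMonoidAlgebra.mapDomainRingHom ℤ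
          (AddMonoidHom.inr ℤ ℤ) (AddMonoidAlgebra.single b r) = _
        rw [h3]
        simp
      rw [h2]
      exact Dvd.dvd.mul_right h1 _
  have h := key x
  rwa [hx, map_zero, sub_zero] at h

variable {N : ℕ} {w : BraidWord}

/-- The elementary ideal lies in `(δ)` and contains `δ (t₁ - 1)` and `δ (α_i - 1)`. Since `t₁ - 1`
generates the kernel of a map to a domain and `α_{i₀} - 1` is not in that kernel, these two factors
have no common divisor. -/
theorem exists_alexander_gcd (ψ : CoverLinkGroup (N + 1) w →* Multiplicative (ℤ × ℤ))
    (ht : ψ (coverMeridianFst (N + 1) w) = Multiplicative.ofAdd (1, 0))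
    (hne : ∃ i : Fin N, (ψ (pairLoop (N + 1) w i.castSucc (Fin.last N))).toAdd.2 ≠ 0) :
    ∃ δ : AddMonoidAlgebra ℤ (ℤ × ℤ),
      ((fstUnit ψ : AddMonoidAlgebra ℤ (ℤ × ℤ)) • 1 - foxMatrix w (loopUnit ψ)).det =
        δ * (AddMonoidAlgebra.single (1, 0) 1 - 1) ∧
      ∀ d, d ∣ δ ↔
        ∀ p ∈ elementaryIdeal (AddMonoidAlgebra ℤ (ℤ × ℤ)) (AlexanderModule ψ) 1, d ∣ p := by
  obtain ⟨i₀, hi₀⟩ := hne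
  have htu : (fstUnit ψ : AddMonoidAlgebra ℤ (ℤ × ℤ)) = AddMonoidAlgebra.single (1, 0) 1 := by
    rw [fstUnit, coe_groupUnit, ht]; rfl
  have hfst : fstOne (fstUnit ψ : AddMonoidAlgebra ℤ (ℤ × ℤ)) = 1 := by
    rw [htu, fstOne_single]; rfl
  have hα : fstOne ((loopUnit ψ i₀.castSucc : AddMonoidAlgebra ℤ (ℤ × ℤ)) - 1) ≠ 0 := by
    rw [map_sub, map_one, sub_ne_zero, loopUnit, coe_groupUnit, fstOne_single]
    intro h
    rw [AddMonoidAlgebra.one_def] at h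
    have := (AddMonoidAlgebra.single_left_inj (one_ne_zero (α := ℤ))).1 h
    exact hi₀ this
  -- At `t₁ = 1` the vector `(α_i - 1)` is fixed by the Fox matrix and is nonzero at `i₀`, so the
  -- determinant vanishes there and is divisible by `t₁ - 1`.
  have hdet0 : fstOne ((fstUnit ψ : AddMonoidAlgebra ℤ (ℤ × ℤ)) • 1 -
      foxMatrix w (loopUnit ψ)).det = 0 := by
    rw [RingHom.map_det, ← Matrix.exists_mulVec_eq_zero_iff]
    refine ⟨fun i => fstOne ((loopUnit ψ i.castSucc : AddMonoidAlgebra ℤ (ℤ × ℤ)) - 1),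
      fun h => hα (congrFun h i₀), ?_⟩
    ext1 i
    have h := foxMatrix_mulVec_loopUnit ψ i
    have h' := congrArg fstOne h
    rw [map_sum] at h'
    simp only [map_mul] at h'
    change ∑ j, fstOne (((fstUnit ψ : AddMonoidAlgebra ℤ (ℤ × ℤ)) • 1 -
      foxMatrix w (loopUnit ψ)) i j) * _ = 0
    simp only [Matrix.sub_apply, map_sub, sub_mul, Finset.sum_sub_distrib, Matrix.smul_apply,
      smul_eq_mul, map_mul, hfst, one_mul]
    simp only [map_sub] at h'
    simp only [Matrix.one_apply, apply_ite fstOne, map_one, map_zero] at h' ⊢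
    simp only [mul_sub, Finset.sum_sub_distrib, mul_one] at h' ⊢
    simp only [ite_mul, one_mul, zero_mul, Finset.sum_ite_eq, Finset.mem_univ, if_true]
    rw [← sub_eq_zero] at h'
    linear_combination -h'
  obtain ⟨δ, hδ⟩ := dvd_of_fstOne_eq_zero _ hdet0
  have hδ' : ((alexMatrix ψ).submatrix id Sum.inl).det = δ * augVec ψ (Sum.inr ()) := by
    rw [alexMatrix_submatrix, hδ, mul_comm]
    simp only [augVec, Sum.elim_inr, htu]
  have hv : augVec ψ (Sum.inr ()) ≠ 0 := by
    simp only [augVec, Sum.elim_inr, htu]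
    rw [sub_ne_zero, AddMonoidAlgebra.one_def]
    intro h
    have := (AddMonoidAlgebra.single_left_inj (one_ne_zero (α := ℤ))).1 h
    simp at this
  refine ⟨δ, by rw [hδ, mul_comm], fun d => ⟨fun hd p hp => hd.trans ?_, fun h => ?_⟩⟩
  · exact dvd_of_mem_elementaryIdeal (alexGen ψ) (alexMatrix ψ) (span_alexGen ψ)
      (alexMatrix_complete ψ) (augVec ψ) (alexMatrix_mulVec ψ) hv δ hδ' hp
  · have hmem := mul_mem_elementaryIdeal (alexGen ψ) (alexMatrix ψ) (span_alexGen ψ)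
      (alexMatrix_relations ψ) (augVec ψ) (alexMatrix_mulVec ψ) hv δ hδ'
    obtain ⟨a, ha⟩ := h _ (hmem (Sum.inr ()))
    obtain ⟨b, hb⟩ := h _ (hmem (Sum.inl i₀))
    rcases eq_or_ne d 0 with rfl | hd
    · rw [zero_mul] at ha
      rw [(mul_eq_zero.1 ha).resolve_right hv]
    -- Eliminating `δ` and then setting `t₁ = 1` shows that the cofactor `a` is a multiple of `t₁ -
    -- 1`; cancelling that factor leaves `d ∣ δ`.
    · have hab : a * augVec ψ (Sum.inl i₀) = b * augVec ψ (Sum.inr ()) := by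
        apply mul_left_cancel₀ hd
        linear_combination augVec ψ (Sum.inr ()) * hb - augVec ψ (Sum.inl i₀) * ha
      have h0 : fstOne (augVec ψ (Sum.inr ())) = 0 := by
        simp only [augVec, Sum.elim_inr, map_sub, hfst, map_one, sub_self]
      have h1 := congrArg fstOne hab
      rw [map_mul, map_mul, h0, mul_zero] at h1
      obtain ⟨a', ha'⟩ := dvd_of_fstOne_eq_zero a ((mul_eq_zero.1 h1).resolve_right hα)
      refine ⟨a', mul_right_cancel₀ hv ?_⟩
      rw [ha, ha']
      simp only [augVec, Sum.elim_inr, htu]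
      ring

end AlexanderPolynomial

/-! ### Colorings and the abelianization of the link group -/

section Abelianization

open Matrix

variable {N : ℕ} {w : BraidWord}

/-- The closed braid has only constant colorings by core quandles of abelian groups, i.e. its
determinant is `1`. -/
def OnlyConstantColorings (n : ℕ) (w : BraidWord) : Prop :=
  ∀ (H : Type) [CommGroup H] (f : Fin n → H), coreAct w f = f → ∀ i j, f i = f j

theorem coreAct_div {H : Type*} [CommGroup H] {n : ℕ} (w : BraidWord) (f g : Fin n → H)
    (i : Fin n) : coreAct w (fun i => f i / g i) i = coreAct w f i / coreAct w g i := by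
  have h1 := coreAct_map (divMonoidHom (α := H)) w (fun i => (f i, g i)) i
  have h2 := coreAct_map (MonoidHom.fst H H) w (fun i => (f i, g i)) i
  have h3 := coreAct_map (MonoidHom.snd H H) w (fun i => (f i, g i)) i
  simp only [divMonoidHom_apply, MonoidHom.coe_fst, MonoidHom.coe_snd] at h1 h2 h3
  rw [← h1, ← h2, ← h3]

theorem foxMatrix_one_mulVec {C : Type*} [AddCommGroup C] (w : BraidWord)
    (c : Fin (N + 1) → C) (hc : c (Fin.last N) = 0) (i : Fin N) :
    ∑ j, foxMatrix w (1 : Fin (N + 1) → ℤˣ) i j • c j.castSucc =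
      (coreAct w (fun i => Multiplicative.ofAdd (c i)) i.castSucc).toAdd -
        (coreAct w (fun i => Multiplicative.ofAdd (c i)) (Fin.last N)).toAdd := by
  have h := crossDiff_val w (1 : Fin (N + 1) → ℤˣ) c hc i
  rw [← h]
  have h1 := coreAct_map (CrossPair.inclusion ℤ C) w (fun i => Multiplicative.ofAdd (c i))
  have : crossDiff w (1 : Fin (N + 1) → ℤˣ) c i =
      CrossPair.inclusion ℤ C (coreAct w (fun i => Multiplicative.ofAdd (c i)) i.castSucc *
        (coreAct w (fun i => Multiplicative.ofAdd (c i)) (Fin.last N))⁻¹) := by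
    rw [map_mul, map_inv, h1, h1]; rfl
  rw [this, CrossPair.inclusion_apply, toAdd_mul, toAdd_inv, sub_eq_add_neg]

/-- The tuple which gives the linking numbers with the two components. -/
theorem exists_coreAct_eq_add_one (hcol : OnlyConstantColorings (N + 1) w)
    (hdet : (1 - foxMatrix w (1 : Fin (N + 1) → ℤˣ)).det = 0) :
    ∃ g : Fin (N + 1) → Multiplicative ℤ,
      ∀ i, coreAct w g i = g i * Multiplicative.ofAdd 1 := by
  obtain ⟨v, hv0, hv⟩ := Matrix.exists_mulVec_eq_zero_iff.2 hdet
  rw [Matrix.sub_mulVec, Matrix.one_mulVec, sub_eq_zero] at hv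
  set f : Fin (N + 1) → ℤ := Fin.snoc (α := fun _ => ℤ) v 0 with hf
  have hflast : f (Fin.last N) = 0 := by simp [hf]
  have hfc : ∀ i : Fin N, f i.castSucc = v i := fun i => by simp [hf]
  set F : Fin (N + 1) → Multiplicative ℤ := fun i => Multiplicative.ofAdd (f i) with hF
  -- A fixed vector of the Fox matrix, extended by `0`, is carried to itself up to the constant `q`,
  -- because the Fox matrix only sees differences from the last entry.
  set q : ℤ := (coreAct w F (Fin.last N)).toAdd with hq
  have hact : ∀ i, coreAct w F i = Multiplicative.ofAdd (f i + q) := by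
    intro i
    apply Multiplicative.toAdd.injective
    rw [toAdd_ofAdd]
    refine Fin.lastCases ?_ (fun i => ?_) i
    · rw [hflast, zero_add]
    · have h := foxMatrix_one_mulVec w f hflast i
      simp only [smul_eq_mul, hfc] at h
      have h2 : v i = _ := congrFun hv i
      rw [hfc]
      change v i = ∑ j, foxMatrix w (1 : Fin (N + 1) → ℤˣ) i j * v j at h2
      rw [h2, h]; ring
  -- Modulo `q` the tuple is a coloring, hence constant, and its last entry is `0`. The case `q = 0`
  -- is included because `ZMod 0` is `ℤ`; it would force `v = 0`.
  have hdvd : ∀ i, q ∣ f i := by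
    intro i
    let φ : Multiplicative ℤ →* Multiplicative (ZMod q.natAbs) :=
      AddMonoidHom.toMultiplicative (Int.castAddHom (ZMod q.natAbs))
    have hq0 : ((q : ℤ) : ZMod q.natAbs) = 0 := by
      rw [ZMod.intCast_zmod_eq_zero_iff_dvd, Int.natCast_natAbs, abs_dvd]
    have h := hcol (Multiplicative (ZMod q.natAbs)) (fun i => φ (F i)) (by
      funext i
      rw [← coreAct_map, hact]
      change Multiplicative.ofAdd (((f i + q : ℤ)) : ZMod q.natAbs) =
        Multiplicative.ofAdd ((f i : ℤ) : ZMod q.natAbs)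
      rw [Int.cast_add, hq0, add_zero]) i (Fin.last N)
    have h' : ((f i : ℤ) : ZMod q.natAbs) = ((f (Fin.last N) : ℤ) : ZMod q.natAbs) := h
    rw [hflast, Int.cast_zero, ZMod.intCast_zmod_eq_zero_iff_dvd, Int.natCast_natAbs,
      abs_dvd] at h'
    exact h'
  have hq0 : q ≠ 0 := by
    intro h0
    apply hv0
    funext i
    have := hdvd i.castSucc
    rw [h0, zero_dvd_iff, hfc] at this
    exact this
  choose g hg using hdvd
  refine ⟨fun i => Multiplicative.ofAdd (g i), fun i => ?_⟩
  have h := coreAct_map (AddMonoidHom.toMultiplicative (AddMonoidHom.mulLeft q)) w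
    (fun i => Multiplicative.ofAdd (g i)) i
  have h2 : (fun i => (AddMonoidHom.toMultiplicative (AddMonoidHom.mulLeft q))
      (Multiplicative.ofAdd (g i))) = F := by
    funext i
    change Multiplicative.ofAdd (q * g i) = _
    rw [← hg]
  rw [h2, hact] at h
  apply Multiplicative.toAdd.injective
  apply mul_left_cancel₀ hq0
  have h3 := congrArg Multiplicative.toAdd h
  change q * (coreAct w (fun i => Multiplicative.ofAdd (g i)) i).toAdd = f i + q at h3
  rw [h3, toAdd_mul, toAdd_ofAdd, toAdd_ofAdd, hg i]
  ring

/-- Homomorphisms to abelian groups are determined by the linking numbers. -/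
theorem exists_comp_eq_of_coreAct (hcol : OnlyConstantColorings (N + 1) w)
    (g : Fin (N + 1) → Multiplicative ℤ)
    (hg : ∀ i, coreAct w g i = g i * Multiplicative.ofAdd 1)
    (ψ : CoverLinkGroup (N + 1) w →* Multiplicative (ℤ × ℤ))
    (h1 : ψ (coverMeridianFst (N + 1) w) = Multiplicative.ofAdd (1, 0))
    (h3 : ∀ i, ψ (pairLoop (N + 1) w i (Fin.last N)) =
      zpowersHom _ (Multiplicative.ofAdd ((1, -1) : ℤ × ℤ)) (g i) *
        (zpowersHom _ (Multiplicative.ofAdd ((1, -1) : ℤ × ℤ)) (g (Fin.last N)))⁻¹)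
    {B : Type} [CommGroup B] (π : CoverLinkGroup (N + 1) w →* B) :
    ∃ θ : Multiplicative (ℤ × ℤ) →* B, θ.comp ψ = π := by
  let t := π (coverMeridianFst (N + 1) w)
  let t' := π (coverMeridianSnd (N + 1) w (Fin.last N))
  have hSnd : ∀ i, π (coverMeridianSnd (N + 1) w i) = t' := by
    intro i
    rw [coverMeridianSnd_eq i (Fin.last N), map_mul, map_mul, map_inv, mul_comm,
      inv_mul_cancel_left]
  let κ : Multiplicative ℤ →* B := zpowersHom _ (t / t')
  have hκ : ∀ i, π (pairLoop (N + 1) w i (Fin.last N)) = κ (g i) / κ (g (Fin.last N)) := by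
    intro i
    -- The braid multiplies both `π (x_i x_l)` and `κ (g i)` by `t / t'`, so the quotient is a
    -- coloring and therefore constant.
    have h := hcol B (fun i => π (pairLoop (N + 1) w i (Fin.last N)) / κ (g i)) (by
        funext i
        rw [coreAct_div, ← coreAct_map, coreAct_pairLoop, ← coreAct_map, hg, map_mul, map_mul,
          map_inv, hSnd, map_mul]
        have : κ (Multiplicative.ofAdd 1) = t / t' := by simp [κ]
        rw [this, mul_comm (κ (g i)), ← div_eq_mul_inv, mul_div_mul_left_eq_div]) i (Fin.last N)
    simp only [pairLoop_self, map_one] at h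
    rw [div_eq_iff_eq_mul] at h
    rw [h, one_div, mul_comm, div_eq_mul_inv]
  let θ : Multiplicative (ℤ × ℤ) →* B :=
    { toFun := fun a => t ^ a.toAdd.1 * t' ^ a.toAdd.2
      map_one' := by simp
      map_mul' := fun a b => by
        simp only [toAdd_mul, Prod.fst_add, Prod.snd_add, _root_.zpow_add]
        rw [mul_mul_mul_comm] }
  have hθχ : ∀ z, θ (zpowersHom _ (Multiplicative.ofAdd ((1, -1) : ℤ × ℤ)) z) = κ z := by
    have : θ.comp (zpowersHom _ (Multiplicative.ofAdd ((1, -1) : ℤ × ℤ))) = κ := by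
      ext
      simp [θ, κ, div_eq_mul_inv]
    exact fun z => DFunLike.congr_fun this z
  refine ⟨θ, MonoidHom.eq_of_eqOn_dense (closure_coverLinkGroup (w := w) (Fin.last N)) ?_⟩
  rintro y (rfl | ⟨i, rfl⟩)
  · rw [MonoidHom.comp_apply, h1]; simp [θ, t]
  · rw [MonoidHom.comp_apply, h3, map_mul, map_inv, hθχ, hθχ, hκ, div_eq_mul_inv]

/-- The tuple `g` with `core(g) = g + 1`, placed on the line through `(1, -1)`, satisfies the
hypothesis of `exists_coverLinkHom` with the meridians going to the standard basis. The kernel is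
the commutator subgroup because the abelianization map factors through this homomorphism. -/
theorem exists_isMeridianAbelianization (hcol : OnlyConstantColorings (N + 1) w)
    (hdet : (1 - foxMatrix w (1 : Fin (N + 1) → ℤˣ)).det = 0) :
    ∃ ψ, IsMeridianAbelianization (N + 1) w ψ := by
  obtain ⟨g, hg⟩ := exists_coreAct_eq_add_one hcol hdet
  obtain ⟨ψ, h1, h2, h3⟩ := exists_coverLinkHom (w := w)
    (fun i => zpowersHom _ (Multiplicative.ofAdd ((1, -1) : ℤ × ℤ)) (g i))
    (Multiplicative.ofAdd (1, 0)) (Multiplicative.ofAdd (0, 1)) (fun i => by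
      rw [← coreAct_map, hg, map_mul, mul_right_comm, mul_comm, ← div_eq_mul_inv]
      congr 1)
  refine ⟨ψ, le_antisymm (fun x hx => ?_) (Abelianization.commutator_subset_ker ψ), h1,
    fun i => by rw [h2, mul_comm, inv_mul_cancel_left]⟩
  obtain ⟨θ, hθ⟩ := exists_comp_eq_of_coreAct hcol g hg ψ h1 (fun i => h3 i _)
    (Abelianization.of (G := CoverLinkGroup (N + 1) w))
  have hx' : Abelianization.of x = 1 := by
    rw [← hθ, MonoidHom.comp_apply, MonoidHom.mem_ker.1 hx, map_one]
  rwa [← MonoidHom.mem_ker, Abelianization.ker_of] at hx'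

theorem diagonalSubst_single (a : ℤ × ℤ) (r : ℤ) :
    diagonalSubst (AddMonoidAlgebra.single a r) = AddMonoidAlgebra.single (a.1 + a.2) r := by
  simp [diagonalSubst]

/-- The sum of the two linking numbers of each loop `x_i x_l` vanishes, so on the diagonal all `α_i`
become `1` and `t₁ - Fox` becomes the characteristic matrix of the integral Fox matrix. Cancelling
`t - 1` identifies `δ(t,t)` with `P`. -/
theorem IsMeridianAbelianization.exists_gcd
    {ψ : CoverLinkGroup (N + 1) w →* Multiplicative (ℤ × ℤ)}
    (hψ : IsMeridianAbelianization (N + 1) w ψ) (hcol : OnlyConstantColorings (N + 1) w)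
    (P : ℤ[X]) (hP : (foxMatrix w (1 : Fin (N + 1) → ℤˣ)).charpoly = (X - 1) * P) :
    ∃ δ : AddMonoidAlgebra ℤ (ℤ × ℤ), diagonalSubst δ = toLaurent P ∧
      ∀ d, d ∣ δ ↔
        ∀ p ∈ elementaryIdeal (AddMonoidAlgebra ℤ (ℤ × ℤ)) (AlexanderModule ψ) 1, d ∣ p := by
  obtain ⟨-, ht, ht'⟩ := hψ
  -- The two meridians have equal total linking number, so total linking of the loops is a coloring;
  -- it is constant and vanishes at the last strand.
  have hsum : ∀ i, (ψ (pairLoop (N + 1) w i (Fin.last N))).toAdd.1 +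
      (ψ (pairLoop (N + 1) w i (Fin.last N))).toAdd.2 = 0 := by
    intro i
    let σ : Multiplicative (ℤ × ℤ) →* Multiplicative ℤ :=
      AddMonoidHom.toMultiplicative ((AddMonoidHom.id ℤ).coprod (AddMonoidHom.id ℤ))
    have h := hcol (Multiplicative ℤ) (fun i => σ (ψ (pairLoop (N + 1) w i (Fin.last N)))) (by
      funext i
      have h1 := coreAct_map (σ.comp ψ) w (fun i => pairLoop (N + 1) w i (Fin.last N)) i
      simp only [MonoidHom.comp_apply] at h1
      rw [← h1, coreAct_pairLoop]
      simp only [map_mul, map_inv, ht, ht']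
      have : σ (Multiplicative.ofAdd (1, 0)) * (σ (Multiplicative.ofAdd (0, 1)))⁻¹ = 1 := rfl
      rw [this, one_mul]) i (Fin.last N)
    simp only [pairLoop_self, map_one] at h
    exact h
  -- If all loops had trivial image, so would their core action, and the monodromy relation at the
  -- last strand would give `t₁ = t₂`.
  have hne : ∃ i : Fin N,
      (ψ (pairLoop (N + 1) w i.castSucc (Fin.last N))).toAdd.2 ≠ 0 := by
    by_contra! h
    have hall : ∀ i, ψ (pairLoop (N + 1) w i (Fin.last N)) = 1 := by
      intro i
      refine Fin.lastCases (by rw [pairLoop_self, map_one]) (fun i => ?_) i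
      apply Multiplicative.toAdd.injective
      have h1 := hsum i.castSucc
      rw [h i, add_zero] at h1
      exact Prod.ext h1 (h i)
    have h1 := coreAct_map ψ w (fun i => pairLoop (N + 1) w i (Fin.last N)) (Fin.last N)
    have h2 := coreAct_mem (⊥ : Subgroup (Multiplicative (ℤ × ℤ))) w
      (fun i => ψ (pairLoop (N + 1) w i (Fin.last N))) (fun i => hall i) (Fin.last N)
    rw [← h1, coreAct_pairLoop, pairLoop_self, Subgroup.mem_bot, mul_one, map_mul, map_inv, ht,
      ht'] at h2
    exact absurd h2 (by decide)
  obtain ⟨δ, hδ, hgcd⟩ := exists_alexander_gcd ψ ht hne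
  refine ⟨δ, ?_, hgcd⟩
  have h1 := congrArg diagonalSubst hδ
  have hT : diagonalSubst (fstUnit ψ : AddMonoidAlgebra ℤ (ℤ × ℤ)) = LaurentPolynomial.T 1 := by
    rw [fstUnit, coe_groupUnit, ht, diagonalSubst_single]; rfl
  have hT' : diagonalSubst (AddMonoidAlgebra.single (1, 0) 1) = LaurentPolynomial.T 1 := by
    rw [diagonalSubst_single]; rfl
  have hα : (fun i => Units.map (diagonalSubst : AddMonoidAlgebra ℤ (ℤ × ℤ) →* ℤ[T;T⁻¹])
      (loopUnit ψ i)) = fun i => Units.map ((LaurentPolynomial.C : ℤ →+* ℤ[T;T⁻¹]) :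
        ℤ →* ℤ[T;T⁻¹]) ((1 : Fin (N + 1) → ℤˣ) i) := by
    funext i
    ext1
    rw [Units.coe_map, Units.coe_map]
    simp only [MonoidHom.coe_coe, Pi.one_apply, Units.val_one, map_one]
    rw [loopUnit, coe_groupUnit, diagonalSubst_single, hsum]
    rfl
  have hdetL : diagonalSubst ((fstUnit ψ : AddMonoidAlgebra ℤ (ℤ × ℤ)) • 1 -
      foxMatrix w (loopUnit ψ)).det = toLaurent ((X - 1) * P) := by
    rw [← hP, Matrix.charpoly, RingHom.map_det, RingHom.map_det]
    congr 1
    have h2 := foxMatrix_map diagonalSubst w (loopUnit ψ)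
    rw [hα, ← foxMatrix_map] at h2
    ext1 i j
    have h3 := congrFun (congrFun h2 i) j
    simp only [Matrix.map_apply] at h3
    simp only [RingHom.mapMatrix_apply, Matrix.map_apply, Matrix.sub_apply, map_sub,
      Matrix.smul_apply, smul_eq_mul, map_mul, hT, h3, charmatrix_apply, Matrix.one_apply,
      Matrix.diagonal_apply, apply_ite diagonalSubst, map_one, map_zero,
      apply_ite (toLaurent : ℤ[X] →+* ℤ[T;T⁻¹]), Polynomial.toLaurent_X, Polynomial.toLaurent_C]
    simp
  rw [hdetL, map_mul, map_mul, map_sub, map_sub, map_one, map_one, hT', Polynomial.toLaurent_X,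
    mul_comm] at h1
  refine (mul_right_cancel₀ ?_ h1).symm
  rw [sub_ne_zero, ← LaurentPolynomial.T_zero]
  intro h
  have h4 := (AddMonoidAlgebra.single_left_inj (one_ne_zero (α := ℤ))).1 h
  exact one_ne_zero h4

theorem isReducedAlexanderPolynomial_iff (hcol : OnlyConstantColorings (N + 1) w)
    (P : ℤ[X]) (hP : (foxMatrix w (1 : Fin (N + 1) → ℤˣ)).charpoly = (X - 1) * P)
    (δ : LaurentPolynomial ℤ) :
    IsReducedAlexanderPolynomial (N + 1) w δ ↔ Associated δ (toLaurent P) := by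
  constructor
  · rintro ⟨Δ, ⟨ψ, hψ, hΔ⟩, rfl⟩
    obtain ⟨δ₀, h0, h1⟩ := hψ.exists_gcd hcol P hP
    have h2 : Associated Δ δ₀ :=
      associated_of_dvd_dvd ((h1 Δ).2 ((hΔ Δ).1 dvd_rfl)) ((hΔ δ₀).2 ((h1 δ₀).1 dvd_rfl))
    rw [← h0]
    exact h2.map diagonalSubst
  · intro h
    have hdet : (1 - foxMatrix w (1 : Fin (N + 1) → ℤˣ)).det = 0 := by
      have h1 := congrArg (Polynomial.eval 1) hP
      rw [Matrix.eval_charpoly] at h1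
      simpa using h1
    obtain ⟨ψ, hψ⟩ := exists_isMeridianAbelianization hcol hdet
    obtain ⟨δ₀, h0, h1⟩ := hψ.exists_gcd hcol P hP
    obtain ⟨u, hu⟩ := h.symm
    -- The substitution `t ↦ t₁` is a section of `t₁ = t₂ = t`; it lifts the unit relating `δ` and
    -- `P` to a unit in two variables.
    let s : ℤ[T;T⁻¹] →+* AddMonoidAlgebra ℤ (ℤ × ℤ) :=
      AddMonoidAlgebra.mapDomainRingHom ℤ (AddMonoidHom.inl ℤ ℤ)
    have hs : ∀ x, diagonalSubst (s x) = x := by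
      intro x
      induction x using AddMonoidAlgebra.induction_linear with
      | zero => simp
      | add f g hf hg => rw [map_add, map_add, hf, hg]
      | single m r =>
        have h3 : s (AddMonoidAlgebra.single m r) = AddMonoidAlgebra.single (m, 0) r := by
          change AddMonoidAlgebra.mapDomainRingHom ℤ (AddMonoidHom.inl ℤ ℤ) _ = _
          rw [AddMonoidAlgebra.mapDomainRingHom_apply]
          exact AddMonoidAlgebra.mapDomain_single
        rw [h3, diagonalSubst_single, add_zero]
    refine ⟨δ₀ * (Units.map (s : ℤ[T;T⁻¹] →* AddMonoidAlgebra ℤ (ℤ × ℤ)) u :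
      (AddMonoidAlgebra ℤ (ℤ × ℤ))ˣ), ⟨ψ, hψ, fun d => ?_⟩, ?_⟩
    · rw [← h1, Units.dvd_mul_right]
    · rw [map_mul, h0, ← hu]
      congr 1
      exact hs u

end Abelianization

/-! ### Transvections -/

section Transvections

variable {X : Type*} [AddCommGroup X]

/-- The transvection `x ↦ x + λ(x) v` of a pair `z = (v, λ)` with `λ(v) = 0`. -/
noncomputable def twist (z : X × Module.Dual ℤ X) : X ≃ₗ[ℤ] X :=
  open Classical in
  if h : z.2 z.1 = 0 then
    { toFun := fun x => x + z.2 x • z.1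
      map_add' := fun x y => by rw [map_add, add_smul]; abel
      map_smul' := fun r x => by simp [smul_add, mul_smul]
      invFun := fun x => x - z.2 x • z.1
      left_inv := fun x => by simp [h]
      right_inv := fun x => by simp [h] }
  -- With the value `1` for degenerate pairs, conjugation and change of sign of the pair need no
  -- hypothesis.
  else 1

theorem twist_apply {z : X × Module.Dual ℤ X} (h : z.2 z.1 = 0) (x : X) :
    twist z x = x + z.2 x • z.1 := by
  rw [twist, dif_pos h]; rfl

theorem twist_inv_apply {z : X × Module.Dual ℤ X} (h : z.2 z.1 = 0) (x : X) :
    (twist z)⁻¹ x = x - z.2 x • z.1 := by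
  rw [twist, dif_pos h]; rfl

theorem twist_neg (z : X × Module.Dual ℤ X) : twist (-z) = twist z := by
  by_cases h : z.2 z.1 = 0
  · ext x
    rw [twist_apply h, twist_apply (by simpa using h)]
    simp
  · rw [twist, dif_neg (by simpa using h), twist, dif_neg h]

/-- The action of automorphisms on pairs of a vector and a functional. -/
noncomputable def pairAction (X : Type*) [AddCommGroup X] :
    (X ≃ₗ[ℤ] X) →* Module.End ℤ (X × Module.Dual ℤ X) where
  toFun g :=
    { toFun := fun z => (g z.1, z.2.comp (g⁻¹ : X ≃ₗ[ℤ] X).toLinearMap)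
      map_add' := fun y z => by ext <;> simp
      map_smul' := fun r z => by ext <;> simp }
  map_one' := by ext <;> rfl
  map_mul' g h := by
    apply LinearMap.ext
    intro z
    ext
    · rfl
    · simp [mul_inv_rev]

theorem pairAction_apply (g : X ≃ₗ[ℤ] X) (z : X × Module.Dual ℤ X) :
    pairAction X g z = (g z.1, z.2.comp (g⁻¹ : X ≃ₗ[ℤ] X).toLinearMap) := rfl

theorem LinearEquiv.inv_apply_apply_self (g : X ≃ₗ[ℤ] X) (x : X) : g⁻¹ (g x) = x := by
  rw [← LinearEquiv.mul_apply, inv_mul_cancel]; rfl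

/-- The conjugate of a transvection is the transvection of the transported pair. All conjugations in
the braid word are absorbed into the curves in this way. -/
theorem conj_twist (g : X ≃ₗ[ℤ] X) (z : X × Module.Dual ℤ X) :
    MulAut.conj g (twist z) = twist (pairAction X g z) := by
  rw [MulAut.conj_apply]
  have h' : (pairAction X g z).2 (pairAction X g z).1 = z.2 z.1 := by
    rw [pairAction_apply]
    simp only [LinearMap.comp_apply, LinearEquiv.coe_coe, LinearEquiv.inv_apply_apply_self]
  by_cases h : z.2 z.1 = 0
  · ext x
    rw [twist_apply (h'.trans h), LinearEquiv.mul_apply, LinearEquiv.mul_apply, twist_apply h,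
      map_add, map_smul, ← LinearEquiv.mul_apply g, mul_inv_cancel]
    rfl
  · rw [twist, dif_neg h, twist, dif_neg (by rwa [h']), mul_one, mul_inv_cancel]

/-- Skew-symmetry of the pairing makes the functional component change by the same coefficient as
the vector, so pairs can be manipulated like homology classes. -/
theorem pairAction_twist {y z : X × Module.Dual ℤ X} (h : z.2 z.1 = 0)
    (hyz : y.2 z.1 = -z.2 y.1) : pairAction X (twist z) y = y + z.2 y.1 • z := by
  rw [pairAction_apply]
  ext x
  · simp [twist_apply h]
  · change y.2 ((twist z)⁻¹ x) = _
    simp only [twist_inv_apply h, map_sub, map_smul, hyz, Prod.snd_add, Prod.smul_snd,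
      LinearMap.add_apply, LinearMap.smul_apply, smul_eq_mul]
    ring

theorem pairAction_twist_inv {y z : X × Module.Dual ℤ X} (h : z.2 z.1 = 0)
    (hyz : y.2 z.1 = -z.2 y.1) : pairAction X (twist z)⁻¹ y = y - z.2 y.1 • z := by
  rw [pairAction_apply, inv_inv]
  ext x
  · simp [twist_inv_apply h]
  · simp [twist_apply h, hyz]; ring

/-- A chain of vectors and functionals, with the intersection numbers of a chain of curves. -/
def IsTwistChain (n : ℕ) (z : ℕ → X × Module.Dual ℤ X) : Prop :=
  ∀ i j, 1 ≤ i → i < n → 1 ≤ j → j < n →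
    (z i).2 (z j).1 = if j = i + 1 then 1 else if i = j + 1 then -1 else 0

/-- The representation of braid words by transvections. -/
noncomputable def twistRep (z : ℕ → X × Module.Dual ℤ X) : BraidWord →* (X ≃ₗ[ℤ] X) :=
  FreeGroup.lift fun j => twist (z j)

theorem twistRep_braidGen (z : ℕ → X × Module.Dual ℤ X) (j : ℕ) :
    twistRep z (braidGen j) = twist (z j) := by
  simp [twistRep, braidGen]

namespace IsTwistChain

variable {n : ℕ} {z : ℕ → X × Module.Dual ℤ X}

theorem self (hz : IsTwistChain n z) {j : ℕ} (h1 : 1 ≤ j) (h2 : j < n) : (z j).2 (z j).1 = 0 := by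
  rw [hz j j h1 h2 h1 h2]; simp

theorem skew (hz : IsTwistChain n z) {i j : ℕ} (h1 : 1 ≤ i) (h2 : i < n) (h3 : 1 ≤ j) (h4 : j < n) :
    (z i).2 (z j).1 = -(z j).2 (z i).1 := by
  rw [hz i j h1 h2 h3 h4, hz j i h3 h4 h1 h2]
  split_ifs <;> omega

theorem act (hz : IsTwistChain n z) {i j : ℕ} (h1 : 1 ≤ i) (h2 : i < n) (h3 : 1 ≤ j) (h4 : j < n) :
    pairAction X (twist (z j)) (z i) =
      z i + (if i = j + 1 then 1 else if j = i + 1 then -1 else 0 : ℤ) • z j := by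
  rw [pairAction_twist (hz.self h3 h4) (hz.skew h1 h2 h3 h4), hz j i h3 h4 h1 h2]

theorem act_inv (hz : IsTwistChain n z) {i j : ℕ} (h1 : 1 ≤ i) (h2 : i < n) (h3 : 1 ≤ j) (h4 : j < n) :
    pairAction X (twist (z j))⁻¹ (z i) =
      z i - (if i = j + 1 then 1 else if j = i + 1 then -1 else 0 : ℤ) • z j := by
  rw [pairAction_twist_inv (hz.self h3 h4) (hz.skew h1 h2 h3 h4), hz j i h3 h4 h1 h2]

theorem act_far (hz : IsTwistChain n z) {i j : ℕ} (h1 : 1 ≤ i) (h2 : i < n) (h3 : 1 ≤ j) (h4 : j < n)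
    (h5 : i ≠ j + 1) (h6 : j ≠ i + 1) : pairAction X (twist (z j)) (z i) = z i := by
  rw [hz.act h1 h2 h3 h4, if_neg h5, if_neg h6, zero_smul, add_zero]

theorem act_inv_far (hz : IsTwistChain n z) {i j : ℕ} (h1 : 1 ≤ i) (h2 : i < n) (h3 : 1 ≤ j) (h4 : j < n)
    (h5 : i ≠ j + 1) (h6 : j ≠ i + 1) : pairAction X (twist (z j))⁻¹ (z i) = z i := by
  rw [hz.act_inv h1 h2 h3 h4, if_neg h5, if_neg h6, zero_smul, sub_zero]

theorem act_succ (hz : IsTwistChain n z) {j : ℕ} (h1 : 1 ≤ j) (h2 : j + 1 < n) :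
    pairAction X (twist (z j)) (z (j + 1)) = z (j + 1) + z j := by
  rw [hz.act (by omega) h2 h1 (by omega), if_pos rfl, one_smul]

theorem act_pred (hz : IsTwistChain n z) {j : ℕ} (h1 : 1 ≤ j) (h2 : j + 1 < n) :
    pairAction X (twist (z (j + 1))) (z j) = z j - z (j + 1) := by
  rw [hz.act h1 (by omega) (by omega) h2, if_neg (by omega), if_pos rfl, neg_smul, one_smul,
    sub_eq_add_neg]

theorem act_inv_pred (hz : IsTwistChain n z) {j : ℕ} (h1 : 1 ≤ j) (h2 : j + 1 < n) :
    pairAction X (twist (z (j + 1)))⁻¹ (z j) = z j + z (j + 1) := by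
  rw [hz.act_inv h1 (by omega) (by omega) h2, if_neg (by omega), if_pos rfl, neg_smul, one_smul,
    sub_neg_eq_add]

end IsTwistChain

/-- The sum `z_1 + z_3 + ⋯ + z_{2s-1}`. -/
def oddSum (z : ℕ → X × Module.Dual ℤ X) (s : ℕ) : X × Module.Dual ℤ X :=
  ∑ i ∈ Finset.range s, z (2 * i + 1)

theorem oddSum_succ (z : ℕ → X × Module.Dual ℤ X) (s : ℕ) :
    oddSum z (s + 1) = oddSum z s + z (2 * s + 1) := Finset.sum_range_succ _ _

theorem IsTwistChain.act_oddSum {n : ℕ} {z : ℕ → X × Module.Dual ℤ X} (hz : IsTwistChain n z)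
    {s j : ℕ} (h1 : 2 * s < j) (h2 : j < n) :
    pairAction X (twist (z j)) (oddSum z s) = oddSum z s := by
  rw [oddSum, map_sum]
  refine Finset.sum_congr rfl fun i hi => ?_
  rw [Finset.mem_range] at hi
  exact hz.act_far (by omega) (by omega) (by omega) h2 (by omega) (by omega)

theorem twistRep_gammaWord_add_two (z : ℕ → X × Module.Dual ℤ X) (r : ℕ)
    (y : X × Module.Dual ℤ X) :
    pairAction X (twistRep z (gammaWord (r + 2))) y =
      pairAction X (twist (z (r + 2))) (pairAction X (twist (z (r + 1)))
        (pairAction X (twistRep z (gammaWord r)) (pairAction X (twist (z (r + 1)))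
          (pairAction X (twist (z (r + 2))) y)))) := by
  rw [gammaWord, gammaWord]
  simp only [map_mul, twistRep_braidGen, Module.End.mul_apply]

/-- The action of `Γ_{2s}` on the chain. -/
theorem IsTwistChain.act_gammaWord {n : ℕ} {z : ℕ → X × Module.Dual ℤ X} (hz : IsTwistChain n z)
    (s : ℕ) :
    (∀ j, 1 ≤ j → j < 2 * s → 2 * s < n →
      pairAction X (twistRep z (gammaWord (2 * s))) (z j) = -z j) ∧
    (1 ≤ s → 2 * s < n → pairAction X (twistRep z (gammaWord (2 * s))) (z (2 * s)) =
      -z (2 * s) + 2 • oddSum z s) ∧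
    (2 * s + 1 < n → pairAction X (twistRep z (gammaWord (2 * s))) (z (2 * s + 1)) =
      z (2 * s + 1) + 2 • oddSum z s) := by
  induction s with
  | zero => simp [gammaWord, oddSum]
  | succ s ih =>
    obtain ⟨ih1, ih2, ih3⟩ := ih
    rw [show 2 * (s + 1) = 2 * s + 2 from rfl]
    set r := 2 * s with hr
    -- The induction uses `Γ_{r+2} = (r+2).(r+1).Γ_r.(r+1).(r+2)`: only four outer twists need to be
    -- followed, given that `Γ_r` negates the odd sum and fixes `z_{r+2}` and `z_{r+3}`, which are
    -- disjoint from its letters.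
    have hG : ∀ i, i ≤ s → r < n → pairAction X (twistRep z (gammaWord r)) (oddSum z i) =
        -oddSum z i := by
      intro i hi hrn
      rw [oddSum, map_sum, ← Finset.sum_neg_distrib]
      refine Finset.sum_congr rfl fun i hi => ?_
      rw [Finset.mem_range] at hi
      exact ih1 _ (by omega) (by omega) hrn
    have hGz : r + 2 < n → pairAction X (twistRep z (gammaWord r)) (z (r + 2)) = z (r + 2) := by
      intro hrn
      clear ih1 ih2 ih3 hG
      have : ∀ r', r' ≤ r → pairAction X (twistRep z (gammaWord r')) (z (r + 2)) =
          z (r + 2) := by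
        intro r'
        induction r' with
        | zero => simp [gammaWord]
        | succ r' ih =>
          intro h
          have hf := hz.act_far (i := r + 2) (j := r' + 1) (by omega) hrn (by omega) (by omega)
            (by omega) (by omega)
          rw [gammaWord]
          simp only [map_mul, twistRep_braidGen, Module.End.mul_apply]
          rw [hf, ih (by omega), hf]
      exact this r le_rfl
    have hGz3 : r + 3 < n → pairAction X (twistRep z (gammaWord r)) (z (r + 3)) =
        z (r + 3) := by
      intro hrn
      clear ih1 ih2 ih3 hG hGz
      have : ∀ r', r' ≤ r → pairAction X (twistRep z (gammaWord r')) (z (r + 3)) =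
          z (r + 3) := by
        intro r'
        induction r' with
        | zero => simp [gammaWord]
        | succ r' ih =>
          intro h
          have hf := hz.act_far (i := r + 3) (j := r' + 1) (by omega) hrn (by omega) (by omega)
            (by omega) (by omega)
          rw [gammaWord]
          simp only [map_mul, twistRep_braidGen, Module.End.mul_apply]
          rw [hf, ih (by omega), hf]
      exact this r le_rfl
    refine ⟨fun j h1 h2 h3 => ?_, fun _ h3 => ?_, fun h3 => ?_⟩
    · rw [twistRep_gammaWord_add_two]
      rcases Nat.lt_or_ge j r with h | h
      · have hf1 := hz.act_far (i := j) (j := r + 1) h1 (by omega) (by omega) (by omega)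
          (by omega) (by omega)
        have hf2 := hz.act_far (i := j) (j := r + 2) h1 (by omega) (by omega) (by omega)
          (by omega) (by omega)
        rw [hf2, hf1, ih1 j h1 h (by omega), map_neg, hf1, map_neg, hf2]
      · rcases Nat.eq_or_lt_of_le h with rfl | h
        · have hf2 := hz.act_far (i := r) (j := r + 2) h1 (by omega) (by omega) (by omega)
            (by omega) (by omega)
          rw [hf2, hz.act_pred h1 (by omega), map_sub, ih2 (by omega) (by omega),
            ih3 (by omega)]
          have : -z r + 2 • oddSum z s - (z (r + 1) + 2 • oddSum z s) =
            -z r - z (r + 1) := by abel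
          rw [this, map_sub, map_neg, hz.act_pred h1 (by omega),
            hz.act_far (by omega) (by omega) (by omega) (by omega) (by omega) (by omega)]
          have : -(z r - z (r + 1)) - z (r + 1) = -z r := by abel
          rw [this, map_neg, hf2]
        · obtain rfl : j = r + 1 := by omega
          rw [hz.act_pred (by omega) h3, map_sub, hz.act_succ (by omega) h3,
            hz.act_far (by omega) (by omega) (by omega) (by omega) (by omega) (by omega)]
          have : z (r + 1) - (z (r + 1 + 1) + z (r + 1)) = -z (r + 1 + 1) := by abel
          rw [this, map_neg, hGz h3, map_neg, hz.act_succ (by omega) h3, map_neg, map_add,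
            hz.act_pred (by omega) h3,
            hz.act_far (by omega) (by omega) (by omega) (by omega) (by omega) (by omega)]
          abel
    · rw [twistRep_gammaWord_add_two, oddSum_succ]
      rw [hz.act_far (i := r + 2) (j := r + 2) (by omega) (by omega) (by omega) (by omega)
        (by omega) (by omega), hz.act_succ (by omega) h3, map_add, hGz h3, ih3 (by omega)]
      simp only [map_add, map_nsmul]
      rw [hz.act_succ (by omega) h3, hz.act_oddSum (by omega) (by omega),
        hz.act_far (i := r + 1) (j := r + 1) (by omega) (by omega) (by omega) (by omega)
          (by omega) (by omega)]
      simp only [map_add]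
      rw [hz.act_far (i := r + 1 + 1) (j := r + 2) (by omega) (by omega) (by omega) (by omega)
        (by omega) (by omega), hz.act_oddSum (by omega) (by omega),
        hz.act_pred (by omega) h3]
      abel
    · rw [twistRep_gammaWord_add_two, oddSum_succ]
      have e1 := hz.act_succ (j := r + 2) (by omega) h3
      have e2 := hz.act_succ (j := r + 1) (by omega) (by omega)
      have e3 := hz.act_far (i := r + 3) (j := r + 1) (by omega) (by omega) (by omega)
        (by omega) (by omega) (by omega)
      have e4 := hz.act_far (i := r + 1) (j := r + 1) (by omega) (by omega) (by omega)
        (by omega) (by omega) (by omega)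
      have e5 := hz.act_far (i := r + 2) (j := r + 2) (by omega) (by omega) (by omega)
        (by omega) (by omega) (by omega)
      have e6 := hz.act_pred (j := r + 1) (by omega) (by omega)
      have e7 := hz.act_oddSum (s := s) (j := r + 1) (by omega) (by omega)
      have e8 := hz.act_oddSum (s := s) (j := r + 2) (by omega) (by omega)
      change pairAction X (twist (z (r + 2))) (pairAction X (twist (z (r + 1)))
        (pairAction X (twistRep z (gammaWord r)) (pairAction X (twist (z (r + 1)))
          (pairAction X (twist (z (r + 2))) (z (r + 3)))))) =
            z (r + 3) + 2 • (oddSum z s + z (r + 1))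
      change pairAction X (twist (z (r + 2))) (z (r + 3)) = z (r + 3) + z (r + 2) at e1
      change pairAction X (twist (z (r + 1))) (z (r + 2)) = z (r + 2) + z (r + 1) at e2
      change pairAction X (twist (z (r + 2))) (z (r + 1)) = z (r + 1) - z (r + 2) at e6
      simp only [e1, e2, e3, e4, e5, e6, e7, e8, map_add, map_nsmul, hGz3 (by omega),
        hGz (by omega), ih3 (by omega)]
      abel

end Transvections

/-! ### The braids `B_{n,k}` as products of transvections -/

section Factorization

variable {X : Type*} [AddCommGroup X]

/-- `(s+l-1).⋯.(s+1).s`. -/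
def downWord (s : ℕ) : ℕ → BraidWord
  | 0 => 1
  | l + 1 => braidGen (s + l) * downWord s l

/-- `s.(s+1).⋯.(s+l-1)`. -/
def upWord (s : ℕ) : ℕ → BraidWord
  | 0 => 1
  | l + 1 => upWord s l * braidGen (s + l)

theorem psiWord_add_four (l : ℕ) :
    psiWord (l + 4) = (upWord 3 l)⁻¹ * psiWord 4 * upWord 3 l := by
  induction l with
  | zero => simp [upWord]
  | succ l ih =>
    change (braidGen (l + 3))⁻¹ * psiWord (l + 4) * braidGen (l + 3) = _
    rw [ih, upWord, add_comm 3 l]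
    group

theorem commute_twist {y z : X × Module.Dual ℤ X} (h : pairAction X (twist y) z = z) :
    Commute (twist y) (twist z) := by
  have h1 := conj_twist (twist y) z
  rw [h, MulAut.conj_apply, mul_inv_eq_iff_eq_mul] at h1
  exact h1

variable {n : ℕ} {z : ℕ → X × Module.Dual ℤ X}

theorem IsTwistChain.commute_downWord (hz : IsTwistChain n z) {s l j : ℕ} (hs : 1 ≤ s)
    (h1 : s + l < j) (h2 : j < n) :
    Commute (twist (z j)) (twistRep z (downWord s l)) := by
  induction l with
  | zero => simp [downWord]
  | succ l ih =>
    rw [downWord, map_mul, twistRep_braidGen]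
    exact (commute_twist (hz.act_far (by omega) (by omega) (by omega) (by omega)
      (by omega) (by omega))).mul_right (ih (by omega))

/-- Each step of the recursion for `Φ` is a conjugation by `n-1` preceded by the extra letter `n-2`.
The letter `n-1` commutes with the prefix collected so far, whose letters are at most `n-3`, so the
extra letters gather in front. -/
theorem IsTwistChain.twistRep_phiWord (hz : IsTwistChain n z) {l : ℕ} (hl : l + 2 < n) :
    twistRep z (phiWord (l + 4)) = twistRep z (downWord 2 l) *
      MulAut.conj (twistRep z (downWord 3 l)) (twistRep z (phiWord 4)) := by
  induction l with
  | zero => simp [downWord]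
  | succ l ih =>
    change twistRep z (braidGen (l + 2) * braidGen (l + 3) * phiWord (l + 4) *
      (braidGen (l + 3))⁻¹) = _
    have h := hz.commute_downWord (s := 2) (l := l) (j := l + 3) (by omega) (by omega)
      (by omega)
    rw [downWord, downWord, add_comm 2 l, add_comm 3 l]
    simp only [map_mul, map_inv, twistRep_braidGen, MulAut.mul_apply]
    rw [ih (by omega), MulAut.conj_apply (twist (z (l + 3)))]
    simp only [← mul_assoc]
    rw [mul_assoc _ (twist (z (l + 3))) (twistRep z (downWord 2 l)), h.eq]
    simp only [mul_assoc]

/-- The sum `z_2 + ε z_3 + ⋯ + ε^l z_{l+2}`. -/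
def arcSum (z : ℕ → X × Module.Dual ℤ X) (ε : ℤ) (l : ℕ) : X × Module.Dual ℤ X :=
  ∑ i ∈ Finset.range (l + 1), ε ^ i • z (i + 2)

theorem arcSum_succ (z : ℕ → X × Module.Dual ℤ X) (ε : ℤ) (l : ℕ) :
    arcSum z ε (l + 1) = arcSum z ε l + ε ^ (l + 1) • z (l + 3) := Finset.sum_range_succ _ _

theorem map_arcSum (z : ℕ → X × Module.Dual ℤ X) (ε c : ℤ) (l : ℕ)
    (A : Module.End ℤ (X × Module.Dual ℤ X)) (y : X × Module.Dual ℤ X)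
    (h1 : ∀ i < l, A (z (i + 2)) = z (i + 2)) (h2 : A (z (l + 2)) = z (l + 2) + c • y) :
    A (arcSum z ε l) = arcSum z ε l + (ε ^ l * c) • y := by
  rw [arcSum, Finset.sum_range_succ, map_add, map_sum, map_smul, h2, smul_add, smul_smul,
    ← add_assoc]
  congr 2
  refine Finset.sum_congr rfl fun i hi => ?_
  rw [map_smul, h1 i (Finset.mem_range.1 hi)]

theorem IsTwistChain.act_downWord (hz : IsTwistChain n z) {l : ℕ} (hl : l + 2 < n) :
    pairAction X (twistRep z (downWord 3 l)) (z 2) = arcSum z (-1) l := by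
  induction l with
  | zero => simp [downWord, arcSum]
  | succ l ih =>
    rw [downWord, map_mul, map_mul, Module.End.mul_apply, ih (by omega), twistRep_braidGen,
      add_comm 3 l, map_arcSum z (-1) (-1) l _ (z (l + 3)), arcSum_succ, pow_succ]
    · intro i hi
      exact hz.act_far (by omega) (by omega) (by omega) (by omega) (by omega) (by omega)
    · have := hz.act_pred (j := l + 2) (by omega) (by omega)
      rw [neg_smul, one_smul, ← sub_eq_add_neg]
      exact this

theorem IsTwistChain.act_upWord_inv (hz : IsTwistChain n z) {l : ℕ} (hl : l + 2 < n) :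
    pairAction X (twistRep z (upWord 3 l))⁻¹ (z 2) = arcSum z 1 l := by
  induction l with
  | zero => simp [upWord, arcSum]
  | succ l ih =>
    rw [upWord, map_mul, mul_inv_rev, map_mul, Module.End.mul_apply, ih (by omega),
      twistRep_braidGen, add_comm 3 l, map_arcSum z 1 1 l _ (z (l + 3)), arcSum_succ, one_pow,
      one_pow, mul_one]
    · intro i hi
      exact hz.act_inv_far (by omega) (by omega) (by omega) (by omega) (by omega) (by omega)
    · have := hz.act_inv_pred (j := l + 2) (by omega) (by omega)
      rw [one_smul]
      exact this

theorem IsTwistChain.act_downWord_one (hz : IsTwistChain n z) {l : ℕ} (hl : l + 2 < n) :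
    pairAction X (twistRep z (downWord 3 l)) (z 1) = z 1 := by
  induction l with
  | zero => simp [downWord]
  | succ l ih =>
    rw [downWord, map_mul, map_mul, Module.End.mul_apply, ih (by omega), twistRep_braidGen]
    exact hz.act_far (by omega) (by omega) (by omega) (by omega) (by omega) (by omega)

theorem IsTwistChain.act_upWord_inv_one (hz : IsTwistChain n z) {l : ℕ} (hl : l + 2 < n) :
    pairAction X (twistRep z (upWord 3 l))⁻¹ (z 1) = z 1 := by
  induction l with
  | zero => simp [upWord]
  | succ l ih =>
    rw [upWord, map_mul, mul_inv_rev, map_mul, Module.End.mul_apply, ih (by omega),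
      twistRep_braidGen]
    exact hz.act_inv_far (by omega) (by omega) (by omega) (by omega) (by omega) (by omega)

/-- The curve `f` of the factorization. -/
def curveF (z : ℕ → X × Module.Dual ℤ X) (e k : ℕ) : X × Module.Dual ℤ X :=
  arcSum z (-1) (2 * e) + (2 * (k : ℤ)) • oddSum z (e + 1)

/-- The curve `p` of the factorization. -/
def curveP (z : ℕ → X × Module.Dual ℤ X) (e : ℕ) : X × Module.Dual ℤ X :=
  arcSum z 1 (2 * e) - z (2 * e + 3)

theorem IsTwistChain.act_gammaWord_pow_one (hz : IsTwistChain n z) {e : ℕ}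
    (hn : 2 * e + 3 < n) (k : ℕ) :
    pairAction X (twistRep z (gammaWord (2 * (e + 1))) ^ k) (z 1) = (-1 : ℤ) ^ k • z 1 := by
  have h1 := (hz.act_gammaWord (e + 1)).1 1 le_rfl (by omega) (by omega)
  induction k with
  | zero => simp
  | succ k ih =>
    rw [pow_succ, map_mul, Module.End.mul_apply, h1, map_neg, ih, pow_succ]
    simp

/-- Up to sign, `Γ` lowers the parameter of the curve by one: it negates the odd sum and sends the
alternating arc to its negative plus twice the odd sum. Thus `curveF z e k` is the image of the arc
under `Γ^{-k}`, up to sign. -/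
theorem IsTwistChain.act_gammaWord_pow_curveF (hz : IsTwistChain n z) {e : ℕ}
    (hn : 2 * e + 3 < n) (k : ℕ) :
    pairAction X (twistRep z (gammaWord (2 * (e + 1))) ^ k) (curveF z e k) =
      (-1 : ℤ) ^ k • arcSum z (-1) (2 * e) := by
  obtain ⟨h1, h2, -⟩ := hz.act_gammaWord (e + 1)
  have hd : pairAction X (twistRep z (gammaWord (2 * (e + 1)))) (oddSum z (e + 1)) =
      -oddSum z (e + 1) := by
    rw [oddSum, map_sum, ← Finset.sum_neg_distrib]
    refine Finset.sum_congr rfl fun i hi => ?_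
    rw [Finset.mem_range] at hi
    exact h1 _ (by omega) (by omega) (by omega)
  have ha : pairAction X (twistRep z (gammaWord (2 * (e + 1)))) (arcSum z (-1) (2 * e)) =
      -arcSum z (-1) (2 * e) + 2 • oddSum z (e + 1) := by
    rw [arcSum, Finset.sum_range_succ, map_add, map_sum, map_smul, Even.neg_one_pow (by simp),
      one_smul, neg_add, add_assoc]
    congr 1
    · rw [← Finset.sum_neg_distrib]
      refine Finset.sum_congr rfl fun i hi => ?_
      rw [Finset.mem_range] at hi
      rw [map_smul, h1 _ (by omega) (by omega) (by omega), smul_neg]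
    · rw [one_smul]
      exact h2 (by omega) (by omega)
  induction k with
  | zero => simp [curveF]
  | succ k ih =>
    have hstep : pairAction X (twistRep z (gammaWord (2 * (e + 1)))) (curveF z e (k + 1)) =
        -curveF z e k := by
      rw [curveF, map_add, map_smul, ha, hd, curveF]
      push_cast
      module
    rw [pow_succ, map_mul, Module.End.mul_apply, hstep, map_neg, ih, pow_succ]
    simp

theorem twist_neg_one_pow_smul (k : ℕ) (y : X × Module.Dual ℤ X) :
    twist ((-1 : ℤ) ^ k • y) = twist y := by
  rcases neg_one_pow_eq_or ℤ k with h | h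
  · rw [h, one_smul]
  · rw [h, neg_smul, one_smul, twist_neg]

theorem pairAction_inv_eq {g : X ≃ₗ[ℤ] X} {y y' : X × Module.Dual ℤ X}
    (h : pairAction X g y = y') : pairAction X g⁻¹ y' = y := by
  rw [← h, ← Module.End.mul_apply, ← map_mul, inv_mul_cancel, map_one]; rfl

/-- `Γ` sends each `z_j` involved to `-z_j`, and a transvection does not see the sign of its pair.
-/
theorem IsTwistChain.commute_gammaWord_downWord (hz : IsTwistChain n z) {e l : ℕ}
    (hn : 2 * e + 3 < n) (hl : l ≤ 2 * e) :
    Commute (twistRep z (gammaWord (2 * (e + 1)))) (twistRep z (downWord 2 l)) := by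
  induction l with
  | zero => simp [downWord]
  | succ l ih =>
    rw [downWord, map_mul, twistRep_braidGen]
    refine Commute.mul_right ?_ (ih (by omega))
    have h1 := (hz.act_gammaWord (e + 1)).1 (2 + l) (by omega) (by omega) (by omega)
    have h2 := conj_twist (twistRep z (gammaWord (2 * (e + 1)))) (z (2 + l))
    rw [h1, twist_neg, MulAut.conj_apply, mul_inv_eq_iff_eq_mul] at h2
    exact h2

/-- The part of the factorization of `B_{n,k}` which does not grow with `n`. -/
noncomputable def headMap (f p z₁ : X × Module.Dual ℤ X) : X ≃ₗ[ℤ] X :=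
  (twist f)⁻¹ * (twist f)⁻¹ * twist z₁ * (twist f)⁻¹ *
    (twist p * twist p * twist p * (twist z₁)⁻¹ * twist p)

/-- Since `Γ^{-k}` commutes with the descending prefix of `Φ_n`, what remains is a conjugate of
`Φ_4` times a conjugate of `Ψ_4`. The first conjugation carries `z_2` to `f`, the second carries it
to `p`, and both preserve `z_1`, up to irrelevant signs. -/
theorem IsTwistChain.twistRep_braidB (hz : IsTwistChain n z) {e k : ℕ} (hn : 2 * e + 3 < n) :
    twistRep z (braidB (2 * e + 4) k) =
      twistRep z (downWord 2 (2 * e)) * headMap (curveF z e k) (curveP z e) (z 1) := by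
  set G := twistRep z (gammaWord (2 * (e + 1))) with hG
  set U := twistRep z (downWord 3 (2 * e)) with hU
  set R := twistRep z (upWord 3 (2 * e)) with hR
  set S := twist (z (2 * e + 3)) with hS
  have hC : Commute (G ^ k)⁻¹ (twistRep z (downWord 2 (2 * e))) :=
    ((hz.commute_gammaWord_downWord hn le_rfl).pow_left k).inv_left
  have h1 : twistRep z (braidB (2 * e + 4) k) = twistRep z (downWord 2 (2 * e)) *
      (MulAut.conj ((G ^ k)⁻¹ * U) (twistRep z (phiWord 4)) *
        MulAut.conj (S * R⁻¹) (twistRep z (psiWord 4))) := by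
    have : braidB (2 * e + 4) k = (gammaWord (2 * (e + 1)) ^ k)⁻¹ * phiWord (2 * e + 4) *
      gammaWord (2 * (e + 1)) ^ k * braidGen (2 * e + 3) * psiWord (2 * e + 4) *
        (braidGen (2 * e + 3))⁻¹ := rfl
    rw [this, psiWord_add_four]
    simp only [map_mul (twistRep z), map_inv (twistRep z), map_pow (twistRep z),
      twistRep_braidGen]
    rw [hz.twistRep_phiWord (by omega)]
    simp only [MulAut.conj_apply, ← hG, ← hU, ← hR, ← hS]
    simp only [mul_inv_rev, inv_inv, ← mul_assoc]
    rw [hC.eq]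
  have hf : pairAction X ((G ^ k)⁻¹ * U) (z 2) = (-1 : ℤ) ^ k • curveF z e k := by
    rw [map_mul, Module.End.mul_apply, hU, hz.act_downWord (by omega)]
    apply pairAction_inv_eq
    rw [map_smul, hz.act_gammaWord_pow_curveF hn, smul_smul, ← mul_pow]
    simp
  have hf1 : pairAction X ((G ^ k)⁻¹ * U) (z 1) = (-1 : ℤ) ^ k • z 1 := by
    rw [map_mul, Module.End.mul_apply, hU, hz.act_downWord_one (by omega)]
    apply pairAction_inv_eq
    rw [map_smul, hz.act_gammaWord_pow_one hn, smul_smul, ← mul_pow]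
    simp
  have hp : pairAction X (S * R⁻¹) (z 2) = curveP z e := by
    rw [map_mul, Module.End.mul_apply, hR, hz.act_upWord_inv (by omega), hS,
      map_arcSum z 1 (-1) (2 * e) _ (z (2 * e + 3)), curveP]
    · simp [sub_eq_add_neg]
    · intro i hi
      exact hz.act_far (by omega) (by omega) (by omega) (by omega) (by omega) (by omega)
    · have := hz.act_pred (j := 2 * e + 2) (by omega) (by omega)
      rw [neg_smul, one_smul, ← sub_eq_add_neg]
      exact this
  have hp1 : pairAction X (S * R⁻¹) (z 1) = z 1 := by
    rw [map_mul, Module.End.mul_apply, hR, hz.act_upWord_inv_one (by omega), hS]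
    exact hz.act_far (by omega) (by omega) (by omega) (by omega) (by omega) (by omega)
  have hphi : phiWord 4 = (braidGen 2)⁻¹ * (braidGen 2)⁻¹ * braidGen 1 * (braidGen 2)⁻¹ := rfl
  have hpsi : psiWord 4 = braidGen 2 * braidGen 2 * braidGen 2 * (braidGen 1)⁻¹ *
    braidGen 2 := rfl
  rw [h1, hphi, hpsi]
  simp only [map_mul (twistRep z), map_inv (twistRep z), twistRep_braidGen]
  rw [headMap]
  simp only [map_mul (MulAut.conj ((G ^ k)⁻¹ * U)), map_inv (MulAut.conj ((G ^ k)⁻¹ * U)),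
    map_mul (MulAut.conj (S * R⁻¹)), map_inv (MulAut.conj (S * R⁻¹)), conj_twist, hf, hf1, hp,
    hp1, twist_neg_one_pow_smul]

end Factorization

/-! ### Intersection numbers -/

section Intersection

variable {X : Type*} [AddCommGroup X] {n : ℕ} {z : ℕ → X × Module.Dual ℤ X}

theorem IsTwistChain.skew_span (hz : IsTwistChain n z) {y y' : X × Module.Dual ℤ X}
    (hy : y ∈ Submodule.span ℤ (z '' Set.Ico 1 n))
    (hy' : y' ∈ Submodule.span ℤ (z '' Set.Ico 1 n)) : y.2 y'.1 = -y'.2 y.1 := by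
  induction hy using Submodule.span_induction with
  | mem y hy =>
    obtain ⟨i, ⟨hi1, hi2⟩, rfl⟩ := hy
    induction hy' using Submodule.span_induction with
    | mem y' hy' =>
      obtain ⟨j, ⟨hj1, hj2⟩, rfl⟩ := hy'
      exact hz.skew hi1 hi2 hj1 hj2
    | zero => simp
    | add a b _ _ ha hb =>
      simp only [Prod.fst_add, Prod.snd_add, map_add, LinearMap.add_apply, ha, hb]; ring
    | smul r a _ ha =>
      simp only [Prod.smul_fst, Prod.smul_snd, map_smul, LinearMap.smul_apply, ha, smul_neg]
  | zero => simp
  | add a b _ _ ha hb =>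
    simp only [Prod.fst_add, Prod.snd_add, map_add, LinearMap.add_apply, ha, hb]; ring
  | smul r a _ ha =>
    simp only [Prod.smul_fst, Prod.smul_snd, map_smul, LinearMap.smul_apply, ha, smul_neg]

theorem mem_span_chain {j : ℕ} (h1 : 1 ≤ j) (h2 : j < n) :
    z j ∈ Submodule.span ℤ (z '' Set.Ico 1 n) :=
  Submodule.subset_span ⟨j, ⟨h1, h2⟩, rfl⟩

theorem arcSum_mem (ε : ℤ) {l : ℕ} (hl : l + 2 < n) :
    arcSum z ε l ∈ Submodule.span ℤ (z '' Set.Ico 1 n) :=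
  Submodule.sum_mem _ fun i hi => Submodule.smul_mem _ _
    (mem_span_chain (by omega) (by rw [Finset.mem_range] at hi; omega))

theorem oddSum_mem {s : ℕ} (hs : 2 * s ≤ n) :
    oddSum z s ∈ Submodule.span ℤ (z '' Set.Ico 1 n) :=
  Submodule.sum_mem _ fun i hi =>
    mem_span_chain (by omega) (by rw [Finset.mem_range] at hi; omega)

theorem curveF_mem {e k : ℕ} (hn : 2 * e + 3 < n) :
    curveF z e k ∈ Submodule.span ℤ (z '' Set.Ico 1 n) :=
  add_mem (arcSum_mem _ (by omega)) (Submodule.smul_mem _ _ (oddSum_mem (by omega)))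

theorem curveP_mem {e : ℕ} (hn : 2 * e + 3 < n) :
    curveP z e ∈ Submodule.span ℤ (z '' Set.Ico 1 n) :=
  sub_mem (arcSum_mem _ (by omega)) (mem_span_chain (by omega) hn)

theorem IsTwistChain.apply_arcSum (hz : IsTwistChain n z) (ε : ℤ) {l j : ℕ} (hl : l + 2 < n)
    (h1 : 1 ≤ j) (h2 : j < n) : (z j).2 (arcSum z ε l).1 =
      (if j ≤ l + 1 then ε ^ (j - 1) else 0) -
        (if 3 ≤ j ∧ j ≤ l + 3 then ε ^ (j - 3) else 0) := by
  induction l with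
  | zero =>
    have h : (arcSum z ε 0) = z 2 := by simp [arcSum]
    rw [h, hz j 2 h1 h2 (by omega) (by omega)]
    rcases (by omega : j = 1 ∨ j = 2 ∨ j = 3 ∨ 4 ≤ j) with rfl | rfl | rfl | h4
    · simp
    · simp
    · simp
    · rw [if_neg (by omega), if_neg (by omega), if_neg (by omega), if_neg (by omega), sub_zero]
  | succ l ih =>
    rw [arcSum_succ, Prod.fst_add, map_add, ih (by omega), Prod.smul_fst, map_smul,
      hz j (l + 3) h1 h2 (by omega) (by omega)]
    rcases (by omega : j ≤ l + 1 ∨ j = l + 2 ∨ j = l + 3 ∨ j = l + 4 ∨ l + 5 ≤ j) with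
      h | rfl | rfl | rfl | h
    · rw [if_pos h, if_pos (by omega : j ≤ l + 1 + 1), if_neg (by omega : ¬ l + 3 = j + 1),
        if_neg (by omega : ¬ j = l + 3 + 1), smul_zero, add_zero]
      congr 1
      by_cases h3 : 3 ≤ j
      · rw [if_pos (by omega), if_pos (by omega)]
      · rw [if_neg (by omega), if_neg (by omega)]
    · rw [if_neg (by omega : ¬ l + 2 ≤ l + 1), if_pos (by omega : l + 2 ≤ l + 1 + 1),
        if_pos (by omega : l + 3 = l + 2 + 1), smul_eq_mul, mul_one,
        show l + 2 - 1 = l + 1 by omega]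
      by_cases h3 : 1 ≤ l
      · rw [if_pos (by omega), if_pos (by omega)]; ring
      · rw [if_neg (by omega), if_neg (by omega)]; ring
    · rw [if_neg (by omega : ¬ l + 3 ≤ l + 1), if_neg (by omega : ¬ l + 3 ≤ l + 1 + 1),
        if_neg (by omega : ¬ l + 3 = l + 3 + 1), if_neg (by omega : ¬ l + 3 = l + 3 + 1),
        if_pos (by omega), if_pos (by omega)]; ring
    · rw [if_neg (by omega : ¬ l + 4 ≤ l + 1), if_neg (by omega : ¬ l + 4 ≤ l + 1 + 1),
        if_neg (by omega : ¬ l + 3 = l + 4 + 1), if_pos (by omega : l + 4 = l + 3 + 1),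
        if_neg (by omega), if_pos (by omega), show l + 4 - 3 = l + 1 by omega]
      simp
    · rw [if_neg (by omega), if_neg (by omega), if_neg (by omega), if_neg (by omega),
        if_neg (by omega), if_neg (by omega)]; simp

theorem IsTwistChain.apply_oddSum (hz : IsTwistChain n z) {s j : ℕ} (hs : 2 * s ≤ n)
    (h1 : 1 ≤ j) (h2 : j < n) : (z j).2 (oddSum z s).1 = if j = 2 * s then -1 else 0 := by
  induction s with
  | zero => rw [if_neg (by omega)]; simp [oddSum]
  | succ s ih =>
    rw [oddSum_succ, Prod.fst_add, map_add, ih (by omega),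
      hz j (2 * s + 1) h1 h2 (by omega) (by omega)]
    split_ifs <;> omega

/-- In the alternating arc the two neighbours of an interior `z_j` contribute opposite numbers, and
the odd sum meets only `z_{2e+2}`. -/
theorem IsTwistChain.apply_curveF (hz : IsTwistChain n z) {e k j : ℕ} (hn : 2 * e + 3 < n)
    (h1 : 1 ≤ j) (h2 : j ≤ 2 * e + 1) : (z j).2 (curveF z e k).1 =
      if j = 1 then 1 else if j = 2 then -1 else 0 := by
  rw [curveF, Prod.fst_add, map_add, hz.apply_arcSum _ (by omega) h1 (by omega), Prod.smul_fst,
    map_smul, hz.apply_oddSum (by omega) h1 (by omega), if_pos h2,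
    if_neg (by omega : ¬ j = 2 * (e + 1)), smul_zero, add_zero]
  rcases (by omega : j = 1 ∨ j = 2 ∨ 3 ≤ j) with rfl | rfl | h3
  · simp
  · simp
  · rw [if_neg (by omega : ¬ j = 1), if_neg (by omega : ¬ j = 2), if_pos (by omega)]
    obtain ⟨i, rfl⟩ := Nat.exists_eq_add_of_le h3
    rw [show 3 + i - 1 = i + 2 by omega, show 3 + i - 3 = i by omega]
    ring

theorem IsTwistChain.apply_curveP (hz : IsTwistChain n z) {e j : ℕ} (hn : 2 * e + 3 < n)
    (h1 : 1 ≤ j) (h2 : j ≤ 2 * e + 2) : (z j).2 (curveP z e).1 =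
      (if j = 1 then 1 else 0) + (if j = 2 then 1 else 0) -
        if j = 2 * e + 2 then 2 else 0 := by
  rw [curveP, Prod.fst_sub, map_sub, hz.apply_arcSum _ (by omega) h1 (by omega),
    hz j (2 * e + 3) h1 (by omega) (by omega) hn]
  simp only [one_pow]
  split_ifs <;> omega

/-- The arc contributes `1 - 2 = -1`, from its first and last terms, and the odd sum contributes `1`
through `z_1`, with multiplicity `2k`. -/
theorem IsTwistChain.curveF_curveP (hz : IsTwistChain n z) {e k : ℕ} (hn : 2 * e + 3 < n) :
    (curveF z e k).2 (curveP z e).1 = 2 * (k : ℤ) - 1 := by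
  rw [curveF, Prod.snd_add, LinearMap.add_apply, Prod.smul_snd, LinearMap.smul_apply]
  have h1 : (arcSum z (-1) (2 * e)).2 (curveP z e).1 = -1 := by
    rw [arcSum, Prod.snd_sum, LinearMap.sum_apply]
    have : ∀ i ∈ Finset.range (2 * e + 1), ((-1 : ℤ) ^ i • z (i + 2)).2 (curveP z e).1 =
        (if i = 0 then 1 else 0) - if i = 2 * e then 2 else 0 := by
      intro i hi
      rw [Finset.mem_range] at hi
      rw [Prod.smul_snd, LinearMap.smul_apply, hz.apply_curveP hn (by omega) (by omega),
        if_neg (by omega : ¬ i + 2 = 1), zero_add, smul_sub]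
      congr 1
      · rcases Nat.eq_zero_or_pos i with rfl | h
        · simp
        · rw [if_neg (by omega), if_neg (by omega), smul_zero]
      · by_cases h : i = 2 * e
        · rw [if_pos (by omega), if_pos h, h, Even.neg_one_pow (by simp), one_smul]
        · rw [if_neg (by omega), if_neg h, smul_zero]
    rw [Finset.sum_congr rfl this, Finset.sum_sub_distrib, Finset.sum_ite_eq', Finset.sum_ite_eq',
      if_pos (by simp), if_pos (by simp)]
    norm_num
  have h2 : (oddSum z (e + 1)).2 (curveP z e).1 = 1 := by
    rw [oddSum, Prod.snd_sum, LinearMap.sum_apply]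
    have : ∀ i ∈ Finset.range (e + 1), (z (2 * i + 1)).2 (curveP z e).1 =
        if i = 0 then 1 else 0 := by
      intro i hi
      rw [Finset.mem_range] at hi
      rw [hz.apply_curveP hn (by omega) (by omega)]
      split_ifs <;> omega
    rw [Finset.sum_congr rfl this, Finset.sum_ite_eq', if_pos (by simp)]
  rw [h1, h2, smul_eq_mul]; ring

/-- The intersection numbers of the three curves of `headMap`. -/
structure IsHeadTriple (q : ℤ) (f p y : X × Module.Dual ℤ X) : Prop where
  ff : f.2 f.1 = 0
  pp : p.2 p.1 = 0
  yy : y.2 y.1 = 0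
  fp : f.2 p.1 = q
  pf : p.2 f.1 = -q
  fy : f.2 y.1 = -1
  yf : y.2 f.1 = 1
  py : p.2 y.1 = -1
  yp : y.2 p.1 = 1

theorem IsTwistChain.isHeadTriple (hz : IsTwistChain n z) {e k : ℕ} (hn : 2 * e + 3 < n) :
    IsHeadTriple (2 * k - 1) (curveF z e k) (curveP z e) (z 1) := by
  have hf := curveF_mem (z := z) (k := k) hn
  have hp := curveP_mem (z := z) hn
  have hy := mem_span_chain (z := z) (n := n) (j := 1) le_rfl (by omega)
  have hyf := hz.apply_curveF (k := k) (j := 1) hn le_rfl (by omega)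
  have hyp := hz.apply_curveP (j := 1) hn le_rfl (by omega)
  have hfp := hz.curveF_curveP (k := k) hn
  have h1 := hz.skew_span hf hf
  have h2 := hz.skew_span hp hp
  have h3 := hz.skew_span hp hf
  have h4 := hz.skew_span hf hy
  have h5 := hz.skew_span hp hy
  simp only [if_true, show ¬ 1 = 2 by omega, if_false, show ¬ 1 = 2 * e + 2 by omega] at hyf hyp
  exact ⟨by omega, by omega, hz.self le_rfl (by omega), hfp, by rw [h3, hfp],
    by rw [h4, hyf], hyf, by rw [h5, hyp]; norm_num, by rw [hyp]; norm_num⟩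

/-- Each of the nine transvections changes one of the three coefficients by a combination of the
others and of the pairings `r`, `s`, `t` with `u`; the displayed coefficients are the result of
composing them. -/
theorem IsHeadTriple.headMap_apply {q : ℤ} {f p y : X × Module.Dual ℤ X}
    (h : IsHeadTriple q f p y) (u : X) (a b c r s t : ℤ) (hr : f.2 u = r) (hs : p.2 u = s)
    (ht : y.2 u = t) :
    headMap f p y (u + a • f.1 + b • p.1 + c • y.1) = u +
      ((35 * q ^ 2 - 24 * q + 4) * a + (-20 * q + 3) * b + (35 * q - 4) * c - 5 * r +
        (-35 * q + 9) * s + (-15 * q + 3) * t) • f.1 +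
      ((-7 * q + 3) * a + 4 * b - 7 * c + 7 * s + 3 * t) • p.1 +
      ((7 * q ^ 2 - 8 * q + 2) * a + (-4 * q + 2) * b + (7 * q - 3) * c - r +
        (-7 * q + 5) * s + (-3 * q + 2) * t) • y.1 := by
  have F : ∀ a b c : ℤ, (twist f)⁻¹ (u + a • f.1 + b • p.1 + c • y.1) =
      u + (a - (r + b * q - c)) • f.1 + b • p.1 + c • y.1 := by
    intro a b c
    rw [twist_inv_apply h.ff]
    simp only [map_add, map_smul, h.ff, h.fp, h.fy, hr, smul_eq_mul]
    module
  have P : ∀ a b c : ℤ, twist p (u + a • f.1 + b • p.1 + c • y.1) =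
      u + a • f.1 + (b + (s - a * q - c)) • p.1 + c • y.1 := by
    intro a b c
    rw [twist_apply h.pp]
    simp only [map_add, map_smul, h.pf, h.pp, h.py, hs, smul_eq_mul]
    module
  have Y : ∀ a b c : ℤ, twist y (u + a • f.1 + b • p.1 + c • y.1) =
      u + a • f.1 + b • p.1 + (c + (t + a + b)) • y.1 := by
    intro a b c
    rw [twist_apply h.yy]
    simp only [map_add, map_smul, h.yf, h.yp, h.yy, ht, smul_eq_mul]
    module
  have Y' : ∀ a b c : ℤ, (twist y)⁻¹ (u + a • f.1 + b • p.1 + c • y.1) =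
      u + a • f.1 + b • p.1 + (c - (t + a + b)) • y.1 := by
    intro a b c
    rw [twist_inv_apply h.yy]
    simp only [map_add, map_smul, h.yf, h.yp, h.yy, ht, smul_eq_mul]
    module
  simp only [headMap, LinearEquiv.mul_apply, F, P, Y, Y']
  congr 1
  · congr 1
    · congr 2
      ring
    · congr 1
      ring
  · congr 1
    ring

end Intersection

/-! ### Characteristic polynomials -/

section Charpoly

/-- Semiconjugate integer matrices have the same characteristic polynomial. -/
theorem charpoly_eq_of_mul_eq {ι : Type*} [Fintype ι] [DecidableEq ι] {A B M : Matrix ι ι ℤ}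
    (h : A * B = B * M) (hB : B.det ≠ 0) : A.charpoly = M.charpoly := by
  have h1 : A.charmatrix * B.map C = B.map C * M.charmatrix := by
    have h2 := congrArg (fun D : Matrix ι ι ℤ => D.map (C : ℤ →+* ℤ[X])) h
    simp only [Matrix.map_mul] at h2
    simp only [Matrix.charmatrix, RingHom.mapMatrix_apply, sub_mul, mul_sub]
    rw [h2]
    congr 1
    exact Matrix.scalar_commute (X : ℤ[X]) (fun r => mul_comm _ _) _
  have h3 := congrArg Matrix.det h1
  rw [Matrix.det_mul, Matrix.det_mul, mul_comm] at h3
  refine mul_left_cancel₀ ?_ h3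
  have h4 : (B.map C).det = C B.det := ((C : ℤ →+* ℤ[X]).map_det B).symm
  rw [h4]
  exact fun h => hB (C_eq_zero.1 h)

/-- The determinant of a matrix whose last row and column have only two nonzero entries. -/
theorem det_eq_of_last_sparse {R : Type*} [CommRing R] {m : ℕ}
    (A : Matrix (Fin (m + 2)) (Fin (m + 2)) R)
    (hr : ∀ j : Fin m, A (Fin.last _) j.castSucc.castSucc = 0)
    (hc : ∀ i : Fin m, A i.castSucc.castSucc (Fin.last _) = 0) :
    A.det = A (Fin.last _) (Fin.last _) * (A.submatrix Fin.castSucc Fin.castSucc).det -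
      A (Fin.last _) (Fin.last m).castSucc * A (Fin.last m).castSucc (Fin.last _) *
        (A.submatrix (fun i : Fin m => i.castSucc.castSucc)
          fun i : Fin m => i.castSucc.castSucc).det := by
  rw [Matrix.det_succ_row A (Fin.last _), Fin.sum_univ_castSucc, Fin.sum_univ_castSucc]
  simp only [hr, mul_zero, zero_mul, Finset.sum_const_zero, zero_add, Fin.succAbove_last]
  have h : (A.submatrix Fin.castSucc (Fin.last m).castSucc.succAbove).det =
      A (Fin.last m).castSucc (Fin.last _) *
        (A.submatrix (fun i : Fin m => i.castSucc.castSucc)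
          fun i : Fin m => i.castSucc.castSucc).det := by
    have hl : (Fin.last m).castSucc.succAbove (Fin.last m) = Fin.last (m + 1) := by
      ext; simp [Fin.succAbove]
    have hl' : ∀ i : Fin m, (Fin.last m).castSucc.succAbove i.castSucc = i.castSucc.castSucc := by
      intro i; ext; simp [Fin.succAbove, Fin.lt_def]
    rw [Matrix.det_succ_column _ (Fin.last m), Fin.sum_univ_castSucc]
    simp only [Matrix.submatrix_apply, hl, hc, mul_zero, zero_mul, Finset.sum_const_zero,
      zero_add, Fin.succAbove_last, Matrix.submatrix_submatrix]
    rw [Even.neg_one_pow ⟨_, rfl⟩, one_mul]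
    congr 2
    ext i j
    simp [hl']
  rw [h]
  have e1 : (-1 : R) ^ ((Fin.last (m + 1) : ℕ) + ((Fin.last m).castSucc : ℕ)) = -1 :=
    Odd.neg_one_pow ⟨m, by simp; ring⟩
  have e2 : (-1 : R) ^ ((Fin.last (m + 1) : ℕ) + (Fin.last (m + 1) : ℕ)) = 1 :=
    Even.neg_one_pow ⟨_, rfl⟩
  rw [e1, e2]
  ring

/-- The matrix of the monodromy in the basis which consists of the curves `f`, `p` and of all but
the last two curves of the chain. -/
def headMatrix (q : ℤ) : ℕ → ℕ → ℤ
  | 0, 0 => 35 * q ^ 2 - 24 * q + 4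
  | 0, 1 => -20 * q + 3
  | 0, 2 => 35 * q - 4
  | 0, 3 => 20 * q - 11
  | 1, 0 => -7 * q + 3
  | 1, 1 => 4
  | 1, 2 => -7
  | 1, 3 => -4
  | 2, 0 => 7 * q ^ 2 - 8 * q + 2
  | 2, 1 => -4 * q + 2
  | 2, 2 => 7 * q - 3
  | 2, 3 => 4 * q - 4
  | 3, 0 => -42 * q ^ 2 + 25 * q - 3
  | 3, 1 => 24 * q - 1
  | 3, 2 => -42 * q
  | 3, 3 => 12 - 24 * q
  | 0, _ + 4 | 1, _ + 4 | 2, _ + 4 => 0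
  | 3, j + 4 => if j = 0 then 1 else 0
  | i + 4, j => -headMatrix q (i + 3) j + (if j = i + 5 then 1 else 0) +
      if j = i + 4 then 1 else 0

theorem headMatrix_add_four (q : ℤ) (i j : ℕ) : headMatrix q (i + 4) j =
    -headMatrix q (i + 3) j + (if j = i + 5 then 1 else 0) + if j = i + 4 then 1 else 0 := by
  rw [headMatrix]

theorem headMatrix_of_four_le (q : ℤ) {i j : ℕ} (hj : 4 ≤ j) :
    headMatrix q i j = if j = i + 1 then 1 else 0 := by
  obtain ⟨j, rfl⟩ := Nat.exists_eq_add_of_le' hj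
  match i with
  | 0 => rw [headMatrix, if_neg (by omega)]
  | 1 => rw [headMatrix, if_neg (by omega)]
  | 2 => rw [headMatrix, if_neg (by omega)]
  | 3 => rw [headMatrix]; simp
  | i + 4 =>
    rw [headMatrix_add_four, headMatrix_of_four_le (i := i + 3) q hj]
    split_ifs <;> omega

/-- The characteristic polynomial of the leading block of size `m` of `headMatrix q`. -/
noncomputable def headCharpoly (q : ℤ) (m : ℕ) : ℤ[X] :=
  (Matrix.of fun i j : Fin m => headMatrix q i j).charpoly

/-- By construction the last row of the matrix is minus the preceding one, up to two entries. Adding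
the preceding row of the characteristic matrix to the last leaves only `X` and `X - 1`, and the last
column has two nonzero entries as well, so the determinant expands into the two smaller ones. -/
theorem headCharpoly_rec (q : ℤ) (m : ℕ) : headCharpoly q (m + 5) =
    (X - 1) * headCharpoly q (m + 4) + X * headCharpoly q (m + 3) := by
  set A : Matrix (Fin (m + 5)) (Fin (m + 5)) ℤ := Matrix.of fun i j => headMatrix q i j with hA
  have hne : Fin.last (m + 4) ≠ (Fin.last (m + 3)).castSucc := by
    intro h; simpa using congrArg Fin.val h
  have h1 := Matrix.det_updateRow_add_self A.charmatrix hne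
  set D := A.charmatrix.updateRow (Fin.last (m + 4))
    (A.charmatrix (Fin.last (m + 4)) + A.charmatrix (Fin.last (m + 3)).castSucc) with hD
  have hup : ∀ (i : Fin (m + 4)) j, D i.castSucc j = A.charmatrix i.castSucc j := by
    intro i j
    rw [hD, Matrix.updateRow_ne]
    intro h
    have := congrArg Fin.val h
    simp at this
    omega
  have hlast : ∀ j, D (Fin.last (m + 4)) j = A.charmatrix (Fin.last (m + 4)) j +
      A.charmatrix (Fin.last (m + 3)).castSucc j := by
    intro j; rw [hD, Matrix.updateRow_self]; rfl
  have hch : ∀ i j : Fin (m + 5), A.charmatrix i j =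
      (if (i : ℕ) = j then X else 0) - C (headMatrix q i j) := by
    intro i j
    rw [Matrix.charmatrix_apply, Matrix.diagonal_apply]
    simp only [Fin.ext_iff, hA, Matrix.of_apply]
  have hrow : ∀ j, D (Fin.last (m + 4)) j = (if (j : ℕ) = m + 4 then X - 1 else 0) +
      if (j : ℕ) = m + 3 then X else 0 := by
    intro j
    rw [hlast, hch, hch]
    simp only [Fin.val_last, Fin.val_castSucc]
    rw [headMatrix_add_four]
    have hj := j.2
    rcases (by omega : (j : ℕ) = m + 4 ∨ (j : ℕ) = m + 3 ∨ (j : ℕ) < m + 3) with h | h | h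
    · rw [h]; simp; ring
    · rw [h]; simp
    · rw [if_neg (by omega), if_neg (by omega), if_neg (by omega), if_neg (by omega),
        if_neg (by omega), if_neg (by omega)]
      simp
  have h2 := det_eq_of_last_sparse D
    (fun j => by
      have := j.2
      rw [hrow]; simp only [Fin.val_castSucc]; rw [if_neg (by omega), if_neg (by omega), add_zero])
    (fun i => by
      have := i.2
      rw [hup, hch]
      simp only [Fin.val_last, Fin.val_castSucc]
      rw [headMatrix_of_four_le q (by omega), if_neg (by omega), if_neg (by omega)]
      simp)
  rw [headCharpoly, Matrix.charpoly, ← h1, h2, hrow, hrow, hup, hch]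
  simp only [Fin.val_last, Fin.val_castSucc]
  rw [headMatrix_of_four_le q (by omega)]
  have e1 : D.submatrix Fin.castSucc Fin.castSucc =
      (Matrix.of fun i j : Fin (m + 4) => headMatrix q i j).charmatrix := by
    ext1 i j
    rw [Matrix.submatrix_apply, hup, hch, Matrix.charmatrix_apply, Matrix.diagonal_apply]
    simp [Fin.ext_iff]
  have e2 : D.submatrix (fun i : Fin (m + 3) => i.castSucc.castSucc)
      (fun i : Fin (m + 3) => i.castSucc.castSucc) =
      (Matrix.of fun i j : Fin (m + 3) => headMatrix q i j).charmatrix := by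
    ext1 i j
    rw [Matrix.submatrix_apply, hup, hch, Matrix.charmatrix_apply, Matrix.diagonal_apply]
    simp [Fin.ext_iff]
  rw [e1, e2, headCharpoly, headCharpoly, Matrix.charpoly, Matrix.charpoly]
  simp

theorem headCharpoly_three (q : ℤ) : headCharpoly q 3 =
    X ^ 3 - C (35 * q ^ 2 - 17 * q + 5) * X ^ 2 + C (35 * q ^ 2 - 17 * q + 5) * X - 1 := by
  rw [headCharpoly, Matrix.charpoly, Matrix.det_fin_three]
  simp [headMatrix]
  ring

theorem headCharpoly_four (q : ℤ) : headCharpoly q 4 =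
    X ^ 4 - C (35 * q ^ 2 - 41 * q + 17) * X ^ 3 + C (69 * q ^ 2 - 78 * q + 28) * X ^ 2 -
      C (35 * q ^ 2 - 41 * q + 17) * X + 1 := by
  rw [headCharpoly, Matrix.charpoly, Matrix.det_succ_row_zero]
  simp only [Fin.sum_univ_four, Matrix.det_fin_three, Matrix.submatrix_apply,
    Matrix.charmatrix_apply, Matrix.diagonal_apply, Matrix.of_apply]
  simp [headMatrix, Fin.succAbove, Fin.ext_iff]
  ring

end Charpoly

/-! ### The closed form of the characteristic polynomials -/

section ClosedForm

/-- The recursion has the characteristic roots `X` and `-1`. This combination removes the root `-1`,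
and the next lemma removes the root `X`. -/
theorem headCharpoly_add_succ (q : ℤ) (s : ℕ) :
    headCharpoly q (s + 4) + headCharpoly q (s + 3) =
      X ^ s * (headCharpoly q 4 + headCharpoly q 3) := by
  induction s with
  | zero => simp
  | succ s ih =>
    rw [pow_succ', mul_assoc, ← ih, headCharpoly_rec]
    ring

theorem headCharpoly_sub_X_mul (q : ℤ) (s : ℕ) :
    headCharpoly q (s + 4) - X * headCharpoly q (s + 3) =
      (-1) ^ s * (headCharpoly q 4 - X * headCharpoly q 3) := by
  induction s with
  | zero => simp
  | succ s ih =>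
    rw [pow_succ', mul_assoc, ← ih, headCharpoly_rec]
    ring

theorem X_add_one_mul_headCharpoly (q : ℤ) (e : ℕ) :
    (X + 1) * headCharpoly q (2 * e + 3) =
      X ^ (2 * e) * (headCharpoly q 4 + headCharpoly q 3) -
        (headCharpoly q 4 - X * headCharpoly q 3) := by
  have h1 := headCharpoly_add_succ q (2 * e)
  have h2 := headCharpoly_sub_X_mul q (2 * e)
  rw [Even.neg_one_pow (by simp), one_mul] at h2
  linear_combination h1 - h2

theorem X_sq_sub_one_mul_sum_even (e : ℕ) :
    (X ^ 2 - 1 : ℤ[X]) * ∑ j ∈ Finset.Icc 1 e, X ^ (2 * j) = X ^ (2 * e + 2) - X ^ 2 := by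
  induction e with
  | zero => simp
  | succ e ih => rw [Finset.sum_Icc_succ_top (by omega), mul_add, ih]; ring

theorem X_sq_sub_one_mul_sum_odd (e : ℕ) :
    (X ^ 2 - 1 : ℤ[X]) * ∑ j ∈ Finset.Icc 1 e, X ^ (2 * j + 1) = X ^ (2 * e + 3) - X ^ 3 := by
  induction e with
  | zero => simp
  | succ e ih => rw [Finset.sum_Icc_succ_top (by omega), mul_add, ih]; ring

theorem headCharpoly_three_eq (k : ℤ) : headCharpoly (2 * k - 1) 3 =
    (X - 1) * (X ^ 2 - C (140 * k ^ 2 - 174 * k + 56) * X + 1) := by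
  rw [headCharpoly_three]
  simp only [map_add, map_sub, map_mul, map_pow, map_ofNat, map_one]
  ring

theorem headCharpoly_eq (k : ℤ) (e : ℕ) : headCharpoly (2 * k - 1) (2 * e + 5) =
    (X - 1) * ((X ^ (2 * e + 4) + 1) - C (140 * k ^ 2 - 222 * k + 92) * (X ^ (2 * e + 3) + X) +
      C (136 * k ^ 2 - 258 * k + 119) * ∑ j ∈ Finset.Icc 1 (e + 1), X ^ (2 * j) -
      C (140 * k ^ 2 - 270 * k + 128) * ∑ j ∈ Finset.Icc 1 e, X ^ (2 * j + 1)) := by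
  have h1 := X_sq_sub_one_mul_sum_even (e + 1)
  have h2 := X_sq_sub_one_mul_sum_odd e
  have h3 := X_add_one_mul_headCharpoly (2 * k - 1) (e + 1)
  rw [headCharpoly_three, headCharpoly_four] at h3
  have h4 : (X + 1 : ℤ[X]) ≠ 0 := (monic_X_add_C 1).ne_zero
  -- After multiplication by `X + 1` the factor `X - 1` becomes `X² - 1`, against which the even and
  -- odd power sums telescope.
  apply mul_left_cancel₀ h4
  rw [show 2 * (e + 1) + 3 = 2 * e + 5 by ring] at h3
  rw [h3]
  simp only [map_add, map_sub, map_mul, map_pow, map_ofNat, map_one] at *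
  linear_combination -(136 * C k ^ 2 - 258 * C k + 119) * h1 +
    (140 * C k ^ 2 - 270 * C k + 128) * h2

end ClosedForm

/-! ### The matrix of the monodromy -/

section Basis

variable {X : Type*} [AddCommGroup X] {n : ℕ} {z : ℕ → X × Module.Dual ℤ X}

/-- The curves `f`, `p`, `z_1`, `z_2`, …. -/
noncomputable def headBasis (z : ℕ → X × Module.Dual ℤ X) (e k : ℕ) : ℕ → X
  | 0 => (curveF z e k).1
  | 1 => (curveP z e).1
  | j + 2 => (z (j + 1)).1

theorem IsTwistChain.twistRep_downWord_apply (hz : IsTwistChain n z) {l j : ℕ}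
    (h1 : l + 2 < j) (h2 : j < n) : twistRep z (downWord 2 l) (z j).1 = (z j).1 := by
  induction l with
  | zero => simp [downWord]
  | succ l ih =>
    rw [downWord, map_mul, LinearEquiv.mul_apply, ih (by omega), twistRep_braidGen,
      twist_apply (hz.self (by omega) (by omega)), hz _ _ (by omega) (by omega) (by omega) h2,
      if_neg (by omega), if_neg (by omega), zero_smul, add_zero]

theorem IsHeadTriple.headMap_apply_of_zero {q : ℤ} {f p y : X × Module.Dual ℤ X}
    (h : IsHeadTriple q f p y) {u : X} (hr : f.2 u = 0) (hs : p.2 u = 0) (ht : y.2 u = 0) :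
    headMap f p y u = u := by
  simpa using h.headMap_apply u 0 0 0 0 0 0 hr hs ht

theorem IsTwistChain.headMap_chain (hz : IsTwistChain n z) {e k j : ℕ} (hn : 2 * e + 3 < n)
    (h1 : 3 ≤ j) (h2 : j ≤ 2 * e + 1) :
    headMap (curveF z e k) (curveP z e) (z 1) (z j).1 = (z j).1 := by
  have hj := mem_span_chain (z := z) (n := n) (j := j) (by omega) (by omega)
  apply (hz.isHeadTriple hn).headMap_apply_of_zero
  · rw [hz.skew_span (curveF_mem hn) hj, hz.apply_curveF hn (by omega) h2, if_neg (by omega),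
      if_neg (by omega), neg_zero]
  · rw [hz.skew_span (curveP_mem hn) hj, hz.apply_curveP hn (by omega) (by omega),
      if_neg (by omega), if_neg (by omega), if_neg (by omega)]
    norm_num
  · rw [hz 1 j le_rfl (by omega) (by omega) (by omega), if_neg (by omega), if_neg (by omega)]

/-- For every partial descending product the span of the first `l + 3` vectors is invariant, and
each further letter enlarges it by one curve. The induction over `l` thus runs through the leading
blocks of a single infinite matrix. -/
theorem IsTwistChain.headBasis_apply (hz : IsTwistChain n z) {e k : ℕ} (hn : 2 * e + 3 < n)
    {l : ℕ} (hl : l ≤ 2 * e) {i : ℕ} (hi : i < l + 3) :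
    twistRep z (downWord 2 l) (headMap (curveF z e k) (curveP z e) (z 1) (headBasis z e k i)) =
      ∑ j ∈ Finset.range (l + 3), headMatrix (2 * k - 1) j i • headBasis z e k j := by
  have hH := hz.isHeadTriple (k := k) hn
  match l with
  | 0 =>
    have h0 := hH.headMap_apply 0
    simp only [map_zero, zero_add] at h0
    have hf := h0 1 0 0 0 0 0 rfl rfl rfl
    have hp := h0 0 1 0 0 0 0 rfl rfl rfl
    have hy := h0 0 0 1 0 0 0 rfl rfl rfl
    simp only [Finset.sum_range_succ, Finset.sum_range_zero, zero_add, downWord, map_one,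
      LinearEquiv.coe_one, id_eq]
    rcases (by omega : i = 0 ∨ i = 1 ∨ i = 2) with rfl | rfl | rfl
    · simpa [headMatrix, headBasis] using hf
    · simpa [headMatrix, headBasis] using hp
    · simpa [headMatrix, headBasis] using hy
  | 1 =>
    have ih : ∀ i < 3, _ := fun i hi => hz.headBasis_apply (k := k) hn (l := 0) (by omega) (i := i) hi
    simp only [Finset.sum_range_succ, Finset.sum_range_zero, zero_add, downWord, map_one,
      LinearEquiv.coe_one, id_eq] at ih
    simp only [downWord, mul_one, twistRep_braidGen, add_zero]
    have h22 := hz.self (j := 2) (by omega) (by omega)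
    have h2f := hz.apply_curveF (k := k) (j := 2) hn (by omega) (by omega)
    have h2p := hz.apply_curveP (j := 2) hn (by omega) (by omega)
    have h21 := hz 2 1 (by omega) (by omega) le_rfl (by omega)
    have h12 := hz 1 2 (by omega) (by omega) (by omega) (by omega)
    have hm := mem_span_chain (z := z) (n := n) (j := 2) (by omega) (by omega)
    have hf2 := hz.skew_span (curveF_mem (k := k) hn) hm
    have hp2 := hz.skew_span (curveP_mem hn) hm
    rw [if_neg (by omega), if_pos rfl, if_neg (by omega)] at h2p
    rw [if_neg (by omega), if_pos rfl] at h2f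
    rw [if_neg (by omega), if_pos rfl] at h21
    rw [if_pos rfl] at h12
    rw [h2f] at hf2
    rw [h2p] at hp2
    have h0 := hH.headMap_apply (z 2).1 0 0 0 _ _ _ hf2 hp2 h12
    simp only [zero_smul, add_zero] at h0
    rcases (by omega : i < 3 ∨ i = 3) with h | rfl
    · rw [ih i h, twist_apply h22]
      simp only [Finset.sum_range_succ, Finset.sum_range_zero, zero_add, headBasis, map_add,
        map_smul, h2f, h2p, h21, smul_eq_mul, add_assoc, add_right_inj]
      congr 1
      rcases (by omega : i = 0 ∨ i = 1 ∨ i = 2) with rfl | rfl | rfl <;>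
      · simp only [headMatrix]; ring
    · rw [headBasis, h0, twist_apply h22]
      simp only [Finset.sum_range_succ, Finset.sum_range_zero, zero_add, headBasis, map_add,
        map_smul, h2f, h2p, h21, h22, smul_eq_mul, headMatrix]
      module
  | l + 2 =>
    have hself := hz.self (j := l + 3) (by omega) (by omega)
    rw [downWord, map_mul, LinearEquiv.mul_apply, twistRep_braidGen, add_comm 2 (l + 1)]
    rcases (by omega : i < l + 4 ∨ i = l + 4) with h | rfl
    · rw [hz.headBasis_apply hn (l := l + 1) (by omega) h, twist_apply hself,
        Finset.sum_range_succ _ (l + 4)]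
      congr 1
      rw [headBasis, map_sum, Finset.sum_eq_single (l + 3), headMatrix_add_four,
        if_neg (by omega), if_neg (by omega), map_smul, headBasis,
        hz (l + 3) (l + 2) (by omega) (by omega) (by omega) (by omega), if_neg (by omega),
        if_pos (by omega)]
      · simp
      · intro j hj hne
        rw [Finset.mem_range] at hj
        rw [map_smul]
        match j with
        | 0 =>
          rw [headBasis, hz.apply_curveF hn (by omega) (by omega), if_neg (by omega),
            if_neg (by omega), smul_zero]
        | 1 =>
          rw [headBasis, hz.apply_curveP hn (by omega) (by omega), if_neg (by omega),
            if_neg (by omega), if_neg (by omega)]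
          simp
        | j + 2 =>
          rw [headBasis, hz _ _ (by omega) (by omega) (by omega) (by omega), if_neg (by omega),
            if_neg (by omega), smul_zero]
      · intro h; simp at h
    -- The new curve is fixed by all factors except the last two twists, which carry it to
    -- `z_{l+2}`: the new column has a single entry.
    · have h3 : ∀ j ∈ Finset.range (l + 2 + 3), j ≠ l + 3 →
          headMatrix (2 * (k : ℤ) - 1) j (l + 4) • headBasis z e k j = 0 := by
        intro j _ hj
        rw [headMatrix_of_four_le _ (by omega), if_neg (by omega), zero_smul]
      rw [Finset.sum_eq_single (l + 3) h3 (by simp), headMatrix_of_four_le _ (by omega),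
        if_pos rfl, one_smul, headBasis, headBasis, hz.headMap_chain hn (by omega) (by omega),
        downWord, map_mul, LinearEquiv.mul_apply, hz.twistRep_downWord_apply (by omega) (by omega),
        twistRep_braidGen, add_comm 2 l]
      change twist (z (l + 3)) (twist (z (l + 2)) (z (l + 3)).1) = (z (l + 2)).1
      rw [twist_apply (hz.self (j := l + 2) (by omega) (by omega)),
        hz (l + 2) (l + 3) (by omega) (by omega) (by omega) (by omega), if_pos rfl, one_smul,
        twist_apply hself, map_add, hself,
        hz (l + 3) (l + 2) (by omega) (by omega) (by omega) (by omega), if_neg (by omega),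
        if_pos rfl]
      module

end Basis

/-! ### Functions which are invariant under the monodromy -/

section Invariants

variable {X : Type*} [AddCommGroup X] {n : ℕ} {z : ℕ → X × Module.Dual ℤ X}

theorem arcSum_apply_eq_last {A : Type*} [AddCommGroup A] (φ : X →ₗ[ℤ] A) (ε : ℤ) {l : ℕ}
    (h : ∀ j, 2 ≤ j → j < l + 2 → φ (z j).1 = 0) :
    φ (arcSum z ε l).1 = ε ^ l • φ (z (l + 2)).1 := by
  rw [arcSum, Finset.sum_range_succ, Prod.fst_add, map_add, Prod.fst_sum, map_sum,
    Finset.sum_eq_zero, zero_add, Prod.smul_fst, map_smul]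
  intro i hi
  rw [Finset.mem_range] at hi
  rw [Prod.smul_fst, map_smul, h _ (by omega) (by omega), smul_zero]

theorem oddSum_apply_eq_zero {A : Type*} [AddCommGroup A] (φ : X →ₗ[ℤ] A) {s : ℕ}
    (h : ∀ j, 1 ≤ j → j < 2 * s → φ (z j).1 = 0) : φ (oddSum z s).1 = 0 := by
  rw [oddSum, Prod.fst_sum, map_sum]
  refine Finset.sum_eq_zero fun i hi => h _ (by omega) ?_
  rw [Finset.mem_range] at hi
  omega

theorem curveF_apply_eq_last {A : Type*} [AddCommGroup A] (φ : X →ₗ[ℤ] A) {e k : ℕ}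
    (h : ∀ j, 1 ≤ j → j < 2 * e + 2 → φ (z j).1 = 0) :
    φ (curveF z e k).1 = φ (z (2 * e + 2)).1 := by
  rw [curveF, Prod.fst_add, map_add, Prod.smul_fst, map_smul,
    arcSum_apply_eq_last φ _ fun j h1 h2 => h j (by omega) (by omega),
    oddSum_apply_eq_zero φ fun j h1 h2 => h j h1 (by omega), smul_zero, add_zero,
    Even.neg_one_pow (by simp), one_smul]

theorem curveP_apply_eq_last {A : Type*} [AddCommGroup A] (φ : X →ₗ[ℤ] A) {e : ℕ}
    (h : ∀ j, 1 ≤ j → j < 2 * e + 2 → φ (z j).1 = 0) :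
    φ (curveP z e).1 = φ (z (2 * e + 2)).1 - φ (z (2 * e + 3)).1 := by
  rw [curveP, Prod.fst_sub, map_sub,
    arcSum_apply_eq_last φ _ fun j h1 h2 => h j (by omega) (by omega), one_pow, one_smul]

/-- Evaluation at a vector, as a function of the pair rather than of the functional, obeys the same
rules as the functions of the vector. -/
theorem snd_apply_curve {e k : ℕ} (x : X)
    (h : ∀ j, 1 ≤ j → j < 2 * e + 2 → (z j).2 x = 0) :
    (curveF z e k).2 x = (z (2 * e + 2)).2 x ∧
      (curveP z e).2 x = (z (2 * e + 2)).2 x - (z (2 * e + 3)).2 x := by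
  -- The functionals are placed in the vector slot; the formulas for the curves are linear and apply
  -- unchanged.
  let z' : ℕ → Module.Dual ℤ X × Module.Dual ℤ (Module.Dual ℤ X) := fun j => ((z j).2, 0)
  let S : X × Module.Dual ℤ X →ₗ[ℤ] Module.Dual ℤ X × Module.Dual ℤ (Module.Dual ℤ X) :=
    (LinearMap.inl ℤ _ _).comp (LinearMap.snd ℤ _ _)
  let φ : Module.Dual ℤ X →ₗ[ℤ] ℤ := Module.Dual.eval ℤ X x
  have hS : ∀ y, φ (S y).1 = y.2 x := fun y => rfl
  have hz' : ∀ j, z' j = S (z j) := fun j => rfl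
  have ha : ∀ ε l, arcSum z' ε l = S (arcSum z ε l) := fun ε l => by
    simp only [arcSum, hz', map_sum, map_smul]
  have ho : ∀ s, oddSum z' s = S (oddSum z s) := fun s => by simp only [oddSum, hz', map_sum]
  have hf : curveF z' e k = S (curveF z e k) := by simp only [curveF, ha, ho, map_add, map_smul]
  have hp : curveP z' e = S (curveP z e) := by simp only [curveP, ha, hz', map_sub]
  have h1 := curveF_apply_eq_last (z := z') (k := k) φ h
  have h2 := curveP_apply_eq_last (z := z') φ h
  rw [hf] at h1
  rw [hp] at h2
  exact ⟨h1, h2⟩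

/-- Modulo the earlier members of the chain, `f` is `z_{2e+2}` and `p` is `z_{2e+2} - z_{2e+3}`, a
unimodular change. The vectors `a` and `b` are dual to this pair, up to the sign of `b`. -/
theorem exists_prescribed (hd : ∀ τ : ℕ → ℤ, ∃ x, ∀ j, 1 ≤ j → j < n → (z j).2 x = τ j)
    {e : ℕ} (k : ℕ) (hn : 2 * e + 3 < n) (τ : ℕ → ℤ) (r s : ℤ) :
    ∃ x, (∀ j, 1 ≤ j → j < 2 * e + 2 → (z j).2 x = τ j) ∧
      (curveF z e k).2 x = r ∧ (curveP z e).2 x = s := by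
  obtain ⟨x, hx⟩ := hd τ
  obtain ⟨a, ha⟩ := hd fun j => if j = 2 * e + 2 ∨ j = 2 * e + 3 then 1 else 0
  obtain ⟨b, hb⟩ := hd fun j => if j = 2 * e + 3 then 1 else 0
  have ha0 : ∀ j, 1 ≤ j → j < 2 * e + 2 → (z j).2 a = 0 := fun j h1 h2 => by
    rw [ha j h1 (by omega), if_neg (by omega)]
  have hb0 : ∀ j, 1 ≤ j → j < 2 * e + 2 → (z j).2 b = 0 := fun j h1 h2 => by
    rw [hb j h1 (by omega), if_neg (by omega)]
  obtain ⟨ha1, ha2⟩ := snd_apply_curve (k := k) a ha0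
  obtain ⟨hb1, hb2⟩ := snd_apply_curve (k := k) b hb0
  rw [ha _ (by omega) (by omega), if_pos (by omega)] at ha1 ha2
  rw [ha _ (by omega) (by omega), if_pos (by omega)] at ha2
  rw [hb _ (by omega) (by omega), if_neg (by omega)] at hb1 hb2
  rw [hb _ (by omega) (by omega), if_pos rfl] at hb2
  refine ⟨x + (r - (curveF z e k).2 x) • a + ((curveP z e).2 x - s) • b, fun j h1 h2 => ?_, ?_, ?_⟩
  · simp [hx j h1 (by omega), ha0 j h1 h2, hb0 j h1 h2]
  · simp [ha1, hb1]
  · simp [ha2, hb2]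

/-- Testing invariance on vectors with prescribed pairings strips the outermost twist off the
product and shows that `φ` kills its curve. What remains is invariance under `headMap`, a unimodular
system for the values at `f`, `p` and `z_1`; the last two curves are recovered from `f` and `p`. -/
theorem IsTwistChain.eq_zero_of_invariant (hz : IsTwistChain n z)
    (hd : ∀ τ : ℕ → ℤ, ∃ x, ∀ j, 1 ≤ j → j < n → (z j).2 x = τ j) {e k : ℕ}
    (hn : 2 * e + 3 < n) {A : Type*} [AddCommGroup A] (φ : X →ₗ[ℤ] A)
    (hφ : ∀ x, φ (twistRep z (braidB (2 * e + 4) k) x) = φ x) {j : ℕ} (h1 : 1 ≤ j)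
    (h2 : j ≤ 2 * e + 3) : φ (z j).1 = 0 := by
  have hH := hz.isHeadTriple (k := k) hn
  set W := headMap (curveF z e k) (curveP z e) (z 1) with hW
  have hφ' : ∀ x, φ (twistRep z (downWord 2 (2 * e)) (W x)) = φ x := fun x => by
    rw [← hφ x, hz.twistRep_braidB hn]; rfl
  have hdown : ∀ l, l ≤ 2 * e → (∀ x, φ (twistRep z (downWord 2 l) (W x)) = φ x) ∧
      ∀ j, l + 2 ≤ j → j < 2 * e + 2 → φ (z j).1 = 0 := by
    intro l hl
    induction hl using Nat.decreasingInduction with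
    | self => exact ⟨hφ', fun j h1 h2 => by omega⟩
    | of_succ l hl ih =>
      obtain ⟨ih1, ih2⟩ := ih
      have hself := hz.self (j := l + 2) (by omega) (by omega)
      have hstep : ∀ x, twistRep z (downWord 2 (l + 1)) x =
          twistRep z (downWord 2 l) x +
            (z (l + 2)).2 (twistRep z (downWord 2 l) x) • (z (l + 2)).1 := fun x => by
        rw [downWord, map_mul, LinearEquiv.mul_apply, twistRep_braidGen, add_comm 2 l,
          twist_apply hself]
      have hv : φ (z (l + 2)).1 = 0 := by
        -- Such a vector is fixed by every factor except the outermost twist, which adds its curve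
        -- `z_{l+2}` once.
        obtain ⟨x, hx, hr, hs⟩ := exists_prescribed hd k hn (fun j => if j = l + 2 then 1 else 0)
          0 0
        have hWx : W x = x := hH.headMap_apply_of_zero hr hs
          (by rw [hx 1 le_rfl (by omega), if_neg (by omega)])
        have hfix : ∀ i ≤ l, twistRep z (downWord 2 i) x = x := by
          intro i hi
          induction i with
          | zero => simp [downWord]
          | succ i ih' =>
            rw [downWord, map_mul, LinearEquiv.mul_apply, ih' (by omega), twistRep_braidGen,
              twist_apply (hz.self (by omega) (by omega)), hx _ (by omega) (by omega),
              if_neg (by omega), zero_smul, add_zero]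
        have := ih1 x
        rw [hWx, hstep, hfix l le_rfl, hx _ (by omega) (by omega), if_pos rfl, one_smul,
          map_add] at this
        simpa using this
      refine ⟨fun x => ?_, fun j h1 h2 => ?_⟩
      · rw [← ih1 x, hstep, map_add, map_smul, hv, smul_zero, add_zero]
      · rcases Nat.eq_or_lt_of_le h1 with rfl | h
        · exact hv
        · exact ih2 j (by omega) h2
  obtain ⟨h3, h4⟩ := hdown 0 (by omega)
  simp only [downWord, map_one, LinearEquiv.coe_one, id_eq] at h3
  have h5 : ∀ r s t : ℤ, (-5 * r + (-35 * (2 * k - 1) + 9) * s + (-15 * (2 * k - 1) + 3) * t) •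
      φ (curveF z e k).1 + (7 * s + 3 * t) • φ (curveP z e).1 +
      (-r + (-7 * (2 * k - 1) + 5) * s + (-3 * (2 * k - 1) + 2) * t) • φ (z 1).1 = 0 := by
    intro r s t
    obtain ⟨x, hx, hr, hs⟩ := exists_prescribed hd k hn (fun _ => t) r s
    have h6 := hH.headMap_apply x 0 0 0 r s t hr hs (hx 1 le_rfl (by omega))
    have h7 := h3 x
    simp only [zero_smul, add_zero] at h6
    rw [hW, h6] at h7
    simp only [map_add, map_smul] at h7
    rw [← sub_eq_zero] at h7
    rw [← h7]
    module
  have e1 := h5 1 0 0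
  have e2 := h5 0 1 0
  have e3 := h5 0 0 1
  -- After `φ(z_1) = -5 φ(f)` from `e1`, the equations `e2` and `e3` read `-16 F + 7 P = 0` and `-7
  -- F + 3 P = 0`, whose determinant is `1` for every `k`.
  have hF : φ (curveF z e k).1 = 0 := by
    linear_combination (norm := module) (3 : ℤ) • e2 - (7 : ℤ) • e3 +
      (3 * (5 - 7 * (2 * k - 1)) - 7 * (2 - 3 * (2 * k - 1)) : ℤ) • e1
  have hP : φ (curveP z e).1 = 0 := by
    linear_combination (norm := module) (7 : ℤ) • e2 - (16 : ℤ) • e3 +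
      (7 * (5 - 7 * (2 * k - 1)) - 16 * (2 - 3 * (2 * k - 1)) : ℤ) • e1
  have hY : φ (z 1).1 = 0 := by
    rw [hF] at e1
    linear_combination (norm := module) -e1
  have h6 : ∀ j, 1 ≤ j → j < 2 * e + 2 → φ (z j).1 = 0 := by
    intro j h1 h2
    rcases Nat.eq_or_lt_of_le h1 with rfl | h
    · exact hY
    · exact h4 j (by omega) h2
  have h7 := curveF_apply_eq_last (k := k) φ h6
  have h8 := curveP_apply_eq_last φ h6
  rw [hF] at h7
  rw [hP, ← h7, zero_sub, eq_comm, neg_eq_zero] at h8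
  rcases (by omega : j < 2 * e + 2 ∨ j = 2 * e + 2 ∨ j = 2 * e + 3) with h | rfl | rfl
  · exact h6 j h1 h
  · exact h7.symm
  · exact h8

end Invariants

/-! ### Transfer of the matrix to concrete representations -/

section Semiconjugacy

variable {X : Type*} [AddCommGroup X] {n : ℕ} {z : ℕ → X × Module.Dual ℤ X}

/-- The last two dual functionals see only `p` and `f`: the one at `2e+3` detects `p` and the one at
`2e+2` then detects `f`. The others give the coefficients of the chain. -/
theorem headBasis_independent (e k : ℕ) (κ : ℕ → X →ₗ[ℤ] ℤ)
    (hκ : ∀ i j, 1 ≤ i → i ≤ 2 * e + 3 → 1 ≤ j → j ≤ 2 * e + 3 →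
      κ i (z j).1 = if i = j then 1 else 0) (c : ℕ → ℤ)
    (hc : ∀ j, κ j (∑ i ∈ Finset.range (2 * e + 3), c i • headBasis z e k i) = 0) :
    ∀ i < 2 * e + 3, c i = 0 := by
  have h0 : ∀ j, 1 ≤ j → j ≤ 2 * e + 3 → (c 0 * κ j (curveF z e k).1 +
      c 1 * κ j (curveP z e).1) + (if j ≤ 2 * e + 1 then c (j + 1) else 0) = 0 := by
    intro j h1 h2
    have h := hc j
    rw [map_sum, Finset.sum_range_succ', Finset.sum_range_succ'] at h
    simp only [map_smul, headBasis, zero_add, smul_eq_mul] at h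
    have : ∀ i ∈ Finset.range (2 * e + 1), c (i + 1 + 1) * κ j (z (i + 1)).1 =
        if i = j - 1 then c (j + 1) else 0 := by
      intro i hi
      rw [Finset.mem_range] at hi
      rw [hκ j _ h1 h2 (by omega) (by omega)]
      by_cases hij : i = j - 1
      · rw [if_pos (by omega), if_pos hij, mul_one]; congr 1; omega
      · rw [if_neg (by omega), if_neg hij, mul_zero]
    rw [Finset.sum_congr rfl this, Finset.sum_ite_eq'] at h
    by_cases hj : j ≤ 2 * e + 1
    · rw [if_pos (by rw [Finset.mem_range]; omega)] at h
      rw [if_pos hj]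
      linarith
    · rw [if_neg (by rw [Finset.mem_range]; omega)] at h
      rw [if_neg hj]
      linarith
  have hk : ∀ i, 2 * e + 2 ≤ i → i ≤ 2 * e + 3 → ∀ j, 1 ≤ j → j < 2 * e + 2 →
      κ i (z j).1 = 0 := fun i h1 h2 j h3 h4 => by
    rw [hκ i j (by omega) h2 h3 (by omega), if_neg (by omega)]
  have hc1 : c 1 = 0 := by
    have h := h0 (2 * e + 3) (by omega) le_rfl
    have h' := hκ (2 * e + 3) (2 * e + 2) (by omega) le_rfl (by omega) (by omega)
    have h'' := hκ (2 * e + 3) (2 * e + 3) (by omega) le_rfl (by omega) le_rfl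
    rw [if_neg (by omega)] at h'
    rw [if_pos rfl] at h''
    rw [curveF_apply_eq_last _ (hk _ (by omega) le_rfl),
      curveP_apply_eq_last _ (hk _ (by omega) le_rfl), h', h'', if_neg (by omega)] at h
    linarith
  have hc0 : c 0 = 0 := by
    have h := h0 (2 * e + 2) (by omega) (by omega)
    rw [curveF_apply_eq_last _ (hk _ le_rfl (by omega)), hc1, hκ _ _ (by omega) (by omega)
      (by omega) (by omega), if_pos rfl, if_neg (by omega)] at h
    linarith
  intro i hi
  match i with
  | 0 => exact hc0
  | 1 => exact hc1
  | i + 2 =>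
    have h := h0 (i + 1) (by omega) (by omega)
    rw [hc0, hc1, if_pos (by omega)] at h
    linarith

/-- The coordinates of `f, p, z_1, …` form a matrix that intertwines `A` with the head matrix, and
independence makes its determinant nonzero. The map `π` allows the chain to live in a larger lattice
than the one on which `A` acts. -/
theorem IsTwistChain.charpoly_eq (hz : IsTwistChain n z) {e k : ℕ} (hn : 2 * e + 3 < n)
    (A : Matrix (Fin (2 * e + 3)) (Fin (2 * e + 3)) ℤ) (π : X →ₗ[ℤ] (Fin (2 * e + 3) → ℤ))
    (κ : ℕ → (Fin (2 * e + 3) → ℤ) →ₗ[ℤ] ℤ)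
    (hκ : ∀ i j, 1 ≤ i → i ≤ 2 * e + 3 → 1 ≤ j → j ≤ 2 * e + 3 →
      κ i (π (z j).1) = if i = j then 1 else 0)
    (hA : ∀ i < 2 * e + 3, A.mulVec (π (headBasis z e k i)) =
      π (twistRep z (braidB (2 * e + 4) k) (headBasis z e k i))) :
    A.charpoly = headCharpoly (2 * k - 1) (2 * e + 3) := by
  set B : Matrix (Fin (2 * e + 3)) (Fin (2 * e + 3)) ℤ :=
    Matrix.of fun a i => π (headBasis z e k i) a with hB
  refine charpoly_eq_of_mul_eq (B := B) ?_ ?_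
  · ext a i
    have h := congrFun (hA i i.2) a
    rw [hz.twistRep_braidB hn, LinearEquiv.mul_apply, hz.headBasis_apply hn le_rfl i.2, map_sum,
      Finset.sum_range] at h
    rw [Matrix.mul_apply, Matrix.mul_apply]
    simp only [Matrix.mulVec, dotProduct, Finset.sum_apply, map_smul, Pi.smul_apply,
      smul_eq_mul] at h
    simp only [hB, Matrix.of_apply]
    rw [h]
    exact Finset.sum_congr rfl fun j _ => mul_comm _ _
  · intro hdet
    obtain ⟨v, hv, h⟩ := Matrix.exists_mulVec_eq_zero_iff.2 hdet
    apply hv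
    set c : ℕ → ℤ := fun i => if hi : i < 2 * e + 3 then v ⟨i, hi⟩ else 0 with hc
    have hci : ∀ i : Fin (2 * e + 3), c i = v i := fun i => by simp [hc]
    have hsum : π (∑ i ∈ Finset.range (2 * e + 3), c i • headBasis z e k i) = 0 := by
      rw [map_sum, Finset.sum_range, ← h]
      ext a
      simp only [Matrix.mulVec, dotProduct, hB, Matrix.of_apply, Finset.sum_apply, map_smul,
        Pi.smul_apply, smul_eq_mul, hci]
      exact Finset.sum_congr rfl fun i _ => mul_comm _ _
    have h0 := headBasis_independent e k (fun i => (κ i).comp π) hκ c fun j => by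
      rw [LinearMap.comp_apply, hsum, map_zero]
    ext i
    rw [← hci, h0 i i.2, Pi.zero_apply]

end Semiconjugacy

/-! ### Strands -/

section Strands

/-- The chain of differences of neighbouring strands. -/
noncomputable def strandChain (n j : ℕ) : (Fin n → ℤ) × Module.Dual ℤ (Fin n → ℤ) :=
  if h : 1 ≤ j ∧ j < n then
    (Pi.single ⟨j - 1, by omega⟩ 1 - Pi.single ⟨j, h.2⟩ 1,
      LinearMap.proj ⟨j - 1, by omega⟩ + LinearMap.proj ⟨j, h.2⟩)
  else 0

theorem strandChain_of_lt {n j : ℕ} (h1 : 1 ≤ j) (h2 : j < n) : strandChain n j =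
    (Pi.single ⟨j - 1, by omega⟩ 1 - Pi.single ⟨j, h2⟩ 1,
      LinearMap.proj ⟨j - 1, by omega⟩ + LinearMap.proj ⟨j, h2⟩) := dif_pos ⟨h1, h2⟩

theorem strandChain_snd {n j : ℕ} (h1 : 1 ≤ j) (h2 : j < n) (x : Fin n → ℤ) :
    (strandChain n j).2 x = x ⟨j - 1, by omega⟩ + x ⟨j, h2⟩ := by
  rw [strandChain_of_lt h1 h2]; rfl

theorem isTwistChain_strandChain (n : ℕ) : IsTwistChain n (strandChain n) := by
  intro i j h1 h2 h3 h4
  rw [strandChain_snd h1 h2, strandChain_of_lt h3 h4]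
  simp only [Pi.sub_apply, Pi.single_apply, Fin.mk.injEq]
  split_ifs <;> omega

variable {A : Type*} [AddCommGroup A]

/-- The linear combinations of the entries of a tuple. -/
noncomputable def tupleEval {n : ℕ} (f : Fin n → A) : (Fin n → ℤ) →ₗ[ℤ] A :=
  ∑ i, (LinearMap.proj i : (Fin n → ℤ) →ₗ[ℤ] ℤ).smulRight (f i)

theorem tupleEval_apply {n : ℕ} (f : Fin n → A) (x : Fin n → ℤ) :
    tupleEval f x = ∑ i, x i • f i := by simp [tupleEval]

theorem tupleEval_strandChain {n j : ℕ} (h1 : 1 ≤ j) (h2 : j < n) (f : Fin n → A) :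
    tupleEval f (strandChain n j).1 = f ⟨j - 1, by omega⟩ - f ⟨j, h2⟩ := by
  rw [tupleEval_apply, strandChain_of_lt h1 h2]
  simp [sub_smul, Finset.sum_sub_distrib, Pi.single_apply, ite_smul]

/-- In additive notation the core operation is `(a, b) ↦ (2a - b, a)`, and its transpose on
coefficient vectors is the transvection along the difference of the two strands. Transposition also
turns the right action into a left one. -/
theorem tupleEval_coreLetter {n : ℕ} (j : ℕ) (f : Fin n → Multiplicative A) (x : Fin n → ℤ) :
    tupleEval (fun i => (coreLetter _ n j f i).toAdd) x =
      tupleEval (fun i => (f i).toAdd) (twist (strandChain n j) x) := by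
  by_cases h : 1 ≤ j ∧ j < n
  · rw [twist_apply ((isTwistChain_strandChain n).self h.1 h.2), map_add, map_smul,
      tupleEval_strandChain h.1 h.2, strandChain_snd h.1 h.2]
    rw [tupleEval_apply, tupleEval_apply, ← sub_eq_iff_eq_add', ← Finset.sum_sub_distrib]
    have hne : (⟨j - 1, by omega⟩ : Fin n) ≠ ⟨j, h.2⟩ := by
      simp only [ne_eq, Fin.mk.injEq]; omega
    rw [Finset.sum_eq_add _ _ hne _ (by simp) (by simp)]
    · simp only [coreLetter, dif_pos h, coreHalfTwist, Equiv.coe_fn_mk, if_true, if_neg hne.symm,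
        toAdd_mul, toAdd_inv]
      module
    · intro c _ hc
      simp only [coreLetter, dif_pos h, coreHalfTwist, Equiv.coe_fn_mk, if_neg hc.1, if_neg hc.2,
        sub_self]
  · rw [coreLetter, dif_neg h, strandChain, dif_neg h, twist_apply (by simp)]
    simp

theorem tupleEval_coreAct {n : ℕ} (w : BraidWord) (f : Fin n → Multiplicative A)
    (x : Fin n → ℤ) : tupleEval (fun i => (coreAct w f i).toAdd) x =
      tupleEval (fun i => (f i).toAdd) (twistRep (strandChain n) w x) := by
  induction w using FreeGroup.induction_on generalizing f x with
  | C1 => simp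
  | of j =>
    rw [coreAct_of, tupleEval_coreLetter]
    simp [twistRep]
  | inv_of j hj =>
    have h := hj (coreAct (FreeGroup.of j)⁻¹ f) (twistRep (strandChain n) (FreeGroup.of j)⁻¹ x)
    rw [coreAct_coreAct_inv, ← LinearEquiv.mul_apply, ← map_mul, mul_inv_cancel, map_one] at h
    exact h.symm
  | mul v w hv hw =>
    rw [coreAct_mul, hw, hv, map_mul, LinearEquiv.mul_apply]

/-- The sums of neighbouring entries may be prescribed by solving successively from `0`. For even
`n` this needs the full lattice `ℤ^n`: on the span of the chain the pairing is skew of odd rank,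
hence degenerate. -/
theorem exists_strandChain_apply (n : ℕ) (τ : ℕ → ℤ) :
    ∃ x, ∀ j, 1 ≤ j → j < n → (strandChain n j).2 x = τ j := by
  let y : ℕ → ℤ := fun j => Nat.rec 0 (fun i r => τ (i + 1) - r) j
  refine ⟨fun i => y i, fun j h1 h2 => ?_⟩
  rw [strandChain_snd h1 h2]
  obtain ⟨i, rfl⟩ := Nat.exists_eq_add_of_le' h1
  change y i + (τ (i + 1) - y i) = _
  ring

/-- A coloring is an invariant linear function on the strand lattice; its vanishing on the chain
says that neighbouring strands have equal colors. -/
theorem onlyConstantColorings_braidB (e k : ℕ) :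
    OnlyConstantColorings (2 * e + 4) (braidB (2 * e + 4) k) := by
  intro H _ f hf
  set φ := tupleEval (A := Additive H) (n := 2 * e + 4) fun i => Additive.ofMul (f i) with hφ
  have hinv : ∀ x, φ (twistRep (strandChain _) (braidB (2 * e + 4) k) x) = φ x := by
    intro x
    have h := tupleEval_coreAct (A := Additive H) (braidB (2 * e + 4) k)
      (fun i => Multiplicative.ofAdd (Additive.ofMul (f i))) x
    have h2 : coreAct (braidB (2 * e + 4) k)
        (fun i => Multiplicative.ofAdd (Additive.ofMul (f i))) =
          fun i => Multiplicative.ofAdd (Additive.ofMul (f i)) := hf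
    rw [h2] at h
    exact h.symm
  have h0 : ∀ j (h1 : 1 ≤ j) (h2 : j < 2 * e + 4), f ⟨j - 1, by omega⟩ = f ⟨j, h2⟩ := by
    intro j h1 h2
    have h := (isTwistChain_strandChain (2 * e + 4)).eq_zero_of_invariant
      (exists_strandChain_apply _) (by omega) φ hinv h1 (by omega)
    rw [hφ, tupleEval_strandChain h1 h2, sub_eq_zero] at h
    exact h
  have h1 : ∀ j (h : j < 2 * e + 4), f ⟨j, h⟩ = f ⟨0, by omega⟩ := by
    intro j
    induction j with
    | zero => intro h; rfl
    | succ j ih => intro h; rw [← h0 (j + 1) (by omega) h, ← ih (by omega)]; rfl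
  intro i j
  rw [h1 i i.2, h1 j j.2]

theorem tupleEval_eq_sub_last {N : ℕ} (f : Fin (N + 1) → A) (x : Fin (N + 1) → ℤ)
    (hx : ∑ i, x i = 0) :
    tupleEval f x = ∑ i : Fin N, x i.castSucc • (f i.castSucc - f (Fin.last N)) := by
  rw [Fin.sum_univ_castSucc] at hx
  rw [tupleEval_apply, Fin.sum_univ_castSucc, eq_neg_of_add_eq_zero_right hx]
  simp only [smul_sub, Finset.sum_sub_distrib, neg_smul, Finset.sum_smul]
  rw [sub_eq_add_neg]

/-- A vector of coordinate sum zero pairs with a tuple through the differences from the last entry,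
which is exactly what the Fox matrix at `α = 1` records. -/
theorem foxMatrix_transpose_mulVec {N : ℕ} (w : BraidWord) (x : Fin (N + 1) → ℤ)
    (hx : ∑ i, x i = 0) :
    (foxMatrix w (1 : Fin (N + 1) → ℤˣ)).transpose.mulVec (fun i => x i.castSucc) =
      fun i => twistRep (strandChain (N + 1)) w x i.castSucc := by
  ext j
  set c : Fin (N + 1) → ℤ := Pi.single j.castSucc 1 with hc
  have h1 := tupleEval_coreAct w (fun i => Multiplicative.ofAdd (c i)) x
  have h2 : ∀ i, foxMatrix w (1 : Fin (N + 1) → ℤˣ) i j =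
      (coreAct w (fun i => Multiplicative.ofAdd (c i)) i.castSucc).toAdd -
        (coreAct w (fun i => Multiplicative.ofAdd (c i)) (Fin.last N)).toAdd := fun i => by
    rw [← foxMatrix_one_mulVec w c (by simp [hc]) i]
    simp [hc, Pi.single_apply]
  rw [tupleEval_eq_sub_last _ _ hx] at h1
  simp only [Matrix.mulVec, dotProduct, Matrix.transpose_apply, h2]
  simp only [smul_eq_mul, mul_comm (x _)] at h1
  rw [h1, tupleEval_apply]
  simp [hc, Pi.single_apply]

theorem sum_headBasis_strandChain (e k : ℕ) (i : ℕ) (hi : i < 2 * e + 3) :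
    ∑ a, headBasis (strandChain (2 * e + 4)) e k i a = 0 := by
  have h1 : ∀ j, 1 ≤ j → j < 2 * e + 4 →
      tupleEval (fun _ => (1 : ℤ)) (strandChain (2 * e + 4) j).1 = 0 := fun j h1 h2 => by
    rw [tupleEval_strandChain h1 h2, sub_self]
  have h2 : tupleEval (fun _ => (1 : ℤ)) (headBasis (strandChain (2 * e + 4)) e k i) = 0 := by
    match i with
    | 0 =>
      rw [headBasis, curveF_apply_eq_last _ fun j h3 h4 => h1 j h3 (by omega),
        h1 _ (by omega) (by omega)]
    | 1 =>
      rw [headBasis, curveP_apply_eq_last _ fun j h3 h4 => h1 j h3 (by omega),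
        h1 _ (by omega) (by omega), h1 _ (by omega) (by omega), sub_zero]
    | i + 2 => exact h1 _ (by omega) (by omega)
  simpa [tupleEval_apply] using h2

theorem foxMatrix_charpoly (e k : ℕ) :
    (foxMatrix (braidB (2 * e + 4) k) (1 : Fin (2 * e + 3 + 1) → ℤˣ)).charpoly =
      headCharpoly (2 * k - 1) (2 * e + 3) := by
  rw [← Matrix.charpoly_transpose]
  refine (isTwistChain_strandChain (2 * e + 4)).charpoly_eq (by omega) _
    (LinearMap.funLeft ℤ ℤ Fin.castSucc)
    -- Partial sums of coordinates are dual to the differences of neighbouring strands, also after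
    -- the last coordinate is dropped.
    (fun j => tupleEval fun i : Fin (2 * e + 3) => if (i : ℕ) < j then (1 : ℤ) else 0) ?_ ?_
  · intro i j h1 h2 h3 h4
    rw [tupleEval_apply]
    have h : ∀ a : Fin (2 * e + 3), LinearMap.funLeft ℤ ℤ Fin.castSucc
        (strandChain (2 * e + 4) j).1 a =
          (if (a : ℕ) = j - 1 then 1 else 0) - if (a : ℕ) = j then 1 else 0 := fun a => by
      rw [strandChain_of_lt h3 (by omega)]
      simp [LinearMap.funLeft_apply, Pi.single_apply, Fin.ext_iff]
    simp only [h]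
    rw [Fin.sum_univ_eq_sum_range (fun a => ((if a = j - 1 then (1 : ℤ) else 0) -
      if a = j then 1 else 0) • if a < i then (1 : ℤ) else 0) (2 * e + 3)]
    simp only [sub_smul, Finset.sum_sub_distrib, ite_smul, zero_smul, one_smul,
      Finset.sum_ite_eq', Finset.mem_range]
    split_ifs <;> omega
  · intro i hi
    exact foxMatrix_transpose_mulVec _ _ (sum_headBasis_strandChain e k i hi)

end Strands

/-! ### The fiber -/

section Fiber

/-- The chain of curves in the fiber. The sign makes it an `IsTwistChain`. -/
noncomputable def fiberChain (n j : ℕ) : (Fin (n - 1) → ℤ) × Module.Dual ℤ (Fin (n - 1) → ℤ) :=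
  ((-1 : ℤ) ^ j • fun a : Fin (n - 1) => if (a : ℕ) + 1 = j then 1 else 0,
    (-1 : ℤ) ^ j • tupleEval fun b : Fin (n - 1) =>
      if (b : ℕ) + 1 + 1 = j then 1 else if (b : ℕ) + 1 = j + 1 then -1 else 0)

theorem fiberChain_pairing (n i j : ℕ) (h1 : 1 ≤ i) (h2 : i < n) (h3 : 1 ≤ j) (h4 : j < n) :
    (fiberChain n i).2 (fiberChain n j).1 =
      if j = i + 1 then 1 else if i = j + 1 then -1 else 0 := by
  simp only [fiberChain, LinearMap.smul_apply, map_smul, tupleEval_apply]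
  rw [Finset.sum_eq_single ⟨j - 1, by omega⟩]
  · rw [if_pos (by simp only; omega)]
    rcases (by omega : j = i + 1 ∨ i = j + 1 ∨ (j ≠ i + 1 ∧ i ≠ j + 1)) with rfl | rfl | h
    · have hp : (-1 : ℤ) ^ i * (-1) ^ i = 1 := by rw [← mul_pow]; simp
      rw [if_neg (by simp only; omega), if_pos (by simp only; omega), if_pos rfl, pow_succ]
      simp only [smul_eq_mul]
      linear_combination hp
    · have hp : (-1 : ℤ) ^ j * (-1) ^ j = 1 := by rw [← mul_pow]; simp
      rw [if_pos (by simp only; omega), if_neg (by omega), if_pos rfl, pow_succ]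
      simp only [smul_eq_mul]
      linear_combination -hp
    · rw [if_neg (by simp only; omega), if_neg (by simp only; omega), if_neg h.1, if_neg h.2]
      simp
  · intro b _ hb
    rw [if_neg (fun h => hb (Fin.ext (by simp only; omega))), zero_smul]
  · simp

theorem isTwistChain_fiberChain (n : ℕ) : IsTwistChain n (fiberChain n) :=
  fun i j h1 h2 h3 h4 => fiberChain_pairing n i j h1 h2 h3 h4

theorem fiberChain_self (n j : ℕ) : (fiberChain n j).2 (fiberChain n j).1 = 0 := by
  simp only [fiberChain, LinearMap.smul_apply, map_smul, tupleEval_apply]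
  rw [Finset.sum_eq_zero, smul_zero, smul_zero]
  intro b _
  split_ifs <;> first | omega | simp

theorem dehnJ_mulVec (n j : ℕ) (x : Fin (n - 1) → ℤ) :
    (dehnJ n j).mulVec x = (fiberChain n j).2 x • (fiberChain n j).1 := by
  ext a
  simp only [Matrix.mulVec, dotProduct, dehnJ, Matrix.of_apply, fiberChain, LinearMap.smul_apply,
    tupleEval_apply, Pi.smul_apply, smul_eq_mul]
  have h : (-1 : ℤ) ^ j * (-1) ^ j = 1 := by rw [← mul_pow]; simp
  by_cases ha : (a : ℕ) + 1 = j
  · simp only [if_pos ha]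
    rw [mul_one, mul_right_comm, h, one_mul]
    exact Finset.sum_congr rfl fun b _ => mul_comm _ _
  · simp [if_neg ha]

theorem homologyMonodromy_mul (n : ℕ) (v w : BraidWord) :
    homologyMonodromy n (v * w) = homologyMonodromy n v * homologyMonodromy n w := by
  simp [homologyMonodromy]

theorem homologyMonodromy_mulVec (n : ℕ) (w : BraidWord) (x : Fin (n - 1) → ℤ) :
    (homologyMonodromy n w).mulVec x = twistRep (fiberChain n) w x := by
  induction w using FreeGroup.induction_on generalizing x with
  | C1 => simp [homologyMonodromy]
  | of j =>
    change (homologyMonodromy n (FreeGroup.of j)).mulVec x =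
      twistRep (fiberChain n) (braidGen j) x
    have h : homologyMonodromy n (FreeGroup.of j) = 1 + dehnJ n j := by
      rw [homologyMonodromy, FreeGroup.lift_apply_of]; rfl
    rw [h, Matrix.add_mulVec, Matrix.one_mulVec, dehnJ_mulVec, twistRep_braidGen,
      twist_apply (fiberChain_self n j)]
  | inv_of j hj =>
    obtain ⟨y, rfl⟩ := (twistRep (fiberChain n) (FreeGroup.of j)).surjective x
    have h1 : homologyMonodromy n (FreeGroup.of j)⁻¹ * homologyMonodromy n (FreeGroup.of j) =
        1 := by
      rw [← homologyMonodromy_mul, inv_mul_cancel]; simp [homologyMonodromy]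
    have h2 := hj y
    change (homologyMonodromy n (FreeGroup.of j)).mulVec y = _ at h2
    rw [← LinearEquiv.mul_apply, ← map_mul, inv_mul_cancel, map_one, ← h2, Matrix.mulVec_mulVec]
    erw [h1]
    simp
  | mul v w hv hw =>
    rw [map_mul, LinearEquiv.mul_apply, ← hw, ← hv, Matrix.mulVec_mulVec,
      homologyMonodromy_mul]

theorem homologyMonodromy_charpoly (e k : ℕ) :
    (homologyMonodromy (2 * e + 4) (braidB (2 * e + 4) k)).charpoly =
      headCharpoly (2 * k - 1) (2 * e + 3) := by
  refine (isTwistChain_fiberChain (2 * e + 4)).charpoly_eq (by omega) _ LinearMap.id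
    (fun j => (-1 : ℤ) ^ j • tupleEval fun i : Fin (2 * e + 3) =>
      if (i : ℕ) + 1 = j then (1 : ℤ) else 0) ?_ ?_
  · intro i j h1 h2 h3 h4
    have hp : (-1 : ℤ) ^ i * (-1) ^ i = 1 := by rw [← mul_pow]; simp
    rw [LinearMap.id_apply, LinearMap.smul_apply, tupleEval_apply]
    simp only [fiberChain, Pi.smul_apply]
    rw [Finset.sum_eq_single ⟨i - 1, by omega⟩]
    · simp only [Nat.sub_add_cancel h1, if_true]
      split_ifs
      · subst i; simpa using hp
      · simp
    · intro b _ hb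
      rw [if_neg (c := (b : ℕ) + 1 = i) (fun h => hb (Fin.ext (by simp only; omega))), smul_zero]
    · simp
  · intro i hi
    exact homologyMonodromy_mulVec _ _ _

end Fiber

/-! ### Assembly of the two statements -/

theorem mainTheorem3 :
    (∀ (k : ℕ) (P : ℤ[X]),
      P = X ^ 2 - C (140 * (k : ℤ) ^ 2 - 174 * (k : ℤ) + 56) * X + 1 →
      (∀ δ : LaurentPolynomial ℤ,
        IsReducedAlexanderPolynomial 4 (braidB 4 k) δ ↔ Associated δ (toLaurent P)) ∧
      (homologyMonodromy 4 (braidB 4 k)).charpoly = (X - 1) * P) ∧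
    (∀ (m k : ℕ) (P : ℤ[X]), 3 ≤ m →
      P = (X ^ (2 * m - 2) + 1)
        - C (140 * (k : ℤ) ^ 2 - 222 * (k : ℤ) + 92) * (X ^ (2 * m - 3) + X)
        + C (136 * (k : ℤ) ^ 2 - 258 * (k : ℤ) + 119) *
            ∑ j ∈ Finset.Icc 1 (m - 2), X ^ (2 * j)
        - C (140 * (k : ℤ) ^ 2 - 270 * (k : ℤ) + 128) *
            ∑ j ∈ Finset.Icc 1 (m - 3), X ^ (2 * j + 1) →
      (∀ δ : LaurentPolynomial ℤ,
        IsReducedAlexanderPolynomial (2 * m) (braidB (2 * m) k) δ ↔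
          Associated δ (toLaurent P)) ∧
      (homologyMonodromy (2 * m) (braidB (2 * m) k)).charpoly = (X - 1) * P) := by
  -- Here `e = m - 2`, so that the braid has `2m = 2e + 4` strands and the matrices have size `2e +
  -- 3`.
  have key : ∀ (e k : ℕ) (P : ℤ[X]), headCharpoly (2 * k - 1) (2 * e + 3) = (X - 1) * P →
      (∀ δ : LaurentPolynomial ℤ,
        IsReducedAlexanderPolynomial (2 * e + 4) (braidB (2 * e + 4) k) δ ↔
          Associated δ (toLaurent P)) ∧
      (homologyMonodromy (2 * e + 4) (braidB (2 * e + 4) k)).charpoly = (X - 1) * P := by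
    intro e k P hP
    exact ⟨fun δ => isReducedAlexanderPolynomial_iff (onlyConstantColorings_braidB e k) P
      ((foxMatrix_charpoly e k).trans hP) δ, (homologyMonodromy_charpoly e k).trans hP⟩
  refine ⟨fun k P hP => key 0 k P ?_, fun m k P hm hP => ?_⟩
  · rw [hP]
    exact headCharpoly_three_eq k
  · obtain ⟨e, rfl⟩ := Nat.exists_eq_add_of_le' hm
    refine key (e + 1) k P ?_
    rw [hP]
    exact headCharpoly_eq k e
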